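/- Let $\Omega,\tilde\Omega\subset\mathbb{R}^n$ be bounded, uniformly convex domains with smooth boundary (all principal curvatures of the boundary are bounded below by a positive constant). For a symmetric matrix $M$ with eigenvalues $\lambda_1,\dots,\lambda_n$ put $F(M)=\sum_{k=1}^n\arctan\lambda_k$. By a solution of $(\star)$ we mean a convex function $u$ on $\overline\Omega$, smooth up to the boundary, together with a constant $c\in(0,\frac{n\pi}{2})$, such that $\nabla u$ is a smooth diffeomorphism from $\overline\Omega$ onto $\overline{\tilde\Omega}$ and $F(D^2u(x))=c$ for all $x\in\Omega$. Then there exist positive constants $C_9,C_{10}$, depending only on $\Omega$ and $\tilde\Omega$ (and not on the solution), such that every solution $(u,c)$ of $(\star)$ satisfies \begin{align*} \sum_{k,l=1}^n\partial_k\partial_lu(x)\,w_kw_l&\le C_9\,|w|^2\quad\text{for all }x\in\partial\Omega,\ w\in T_x(\partial\Omega),\\ \sum_{k,l=1}^n\partial_k\partial_lu(x)\,w_kw_l&\le C_{10}\,|w|^2\quad\text{for all }x\in\partial\Omega,\ w\in\mathbb{R}^n,\\ \sum_{k,l=1}^n\partial_k\partial_lu(x)\,w_kw_l&\le C_{10}\,|w|^2\quad\text{for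 all }x\in\Omega,\ w\in\mathbb{R}^n. \end{align*} Moreover, the constants depend on the domains only through boundary defining functions and volumes: given $\theta,v,\tilde v>0$ and $K\in\mathbb{R}$, there exist positive $C_9,C_{10}$, depending only on $n,\theta,K,v,\tilde v$, such that the three estimates hold for every solution of $(\star)$ and for all $\Omega,\tilde\Omega$ as above with $\mathrm{vol}(\Omega)=v$ and $\mathrm{vol}(\tilde\Omega)=\tilde v$ which admit functions $h\in C^\infty(\overline\Omega)$, $\tilde h\in C^\infty(\overline{\tilde\Omega})$ with $h=0$ on $\partial\Omega$, $\tilde h=0$ on $\partial\tilde\Omega$, $D^2h\ge\theta I$, $D^2\tilde h\ge\theta I$, and with all derivatives of $h,\tilde h$ of orders $1,2,3$ bounded in norm by $K$. -/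

import Mathlib

open Set MeasureTheory
open scoped ContDiff Real

namespace MinimalLagrangian

/-- The Euclidean space `ℝⁿ`. -/
abbrev E (n : ℕ) : Type := EuclideanSpace ℝ (Fin n)

variable {n : ℕ}

/-! ### Uniformly convex domains with smooth boundary -/

/-- `ρ` is a smooth function on the open neighbourhood `U` of `p` with nonzero differential at `p`
such that `Ω` coincides with `{ρ < 0}` in `U`. -/
structure IsLocalDefiningFunction (Ω : Set (E n)) (p : E n) (U : Set (E n)) (ρ : E n → ℝ) :
    Prop where
  isOpen : IsOpen U
  mem : p ∈ U
  smooth : ContDiffOn ℝ ∞ ρ U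
  fderiv_ne_zero : fderiv ℝ ρ p ≠ 0
  inter_eq : Ω ∩ U = {x ∈ U | ρ x < 0}

/-- The boundary of `Ω` is smooth, and `Ω` lies locally on one side of it. -/
def HasSmoothBoundary (Ω : Set (E n)) : Prop :=
  ∀ p ∈ frontier Ω, ∃ U ρ, IsLocalDefiningFunction Ω p U ρ

/-- The tangent space `T_p(∂Ω)` at a boundary point of a set with smooth boundary. -/
def boundaryTangentSpace (Ω : Set (E n)) (p : E n) : Set (E n) :=
  {w | ∀ U ρ, IsLocalDefiningFunction Ω p U ρ → fderiv ℝ ρ p w = 0}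

/-- A bounded uniformly convex domain with smooth boundary. The last field says that the second
fundamental form `w ↦ D²ρ(p)(w, w) / |∇ρ(p)|` of `∂Ω` with respect to the outward normal (`ρ` a
local defining function) is bounded below by a positive constant `κ`, that is, that all principal
curvatures of `∂Ω` are at least `κ`. -/
structure IsUniformlyConvexDomain (Ω : Set (E n)) : Prop where
  isOpen : IsOpen Ω
  nonempty : Ω.Nonempty
  isBounded : Bornology.IsBounded Ω
  convex : Convex ℝ Ω
  smoothBoundary : HasSmoothBoundary Ω
  curvature_pos : ∃ κ : ℝ, 0 < κ ∧ ∀ p ∈ frontier Ω, ∀ U ρ, IsLocalDefiningFunction Ω p U ρ →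
    ∀ w ∈ boundaryTangentSpace Ω p,
      κ * ‖fderiv ℝ ρ p‖ * ‖w‖ ^ 2 ≤ iteratedFDeriv ℝ 2 ρ p ![w, w]

/-! ### The problem `(⋆)` -/

/-- The Hessian matrix `(∂ₖ∂ₗ u(x))` of a function on `S`. The sets `S` in use are closures of
nonempty convex open sets, so that the derivatives within `S` are unique; in the interior they are
the usual derivatives, on the boundary their continuous extensions. -/
noncomputable def hessMatrix (u : E n → ℝ) (S : Set (E n)) (x : E n) :
    Matrix (Fin n) (Fin n) ℝ :=
  Matrix.of fun k l => iteratedFDerivWithin ℝ 2 u S x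
    ![EuclideanSpace.single k (1 : ℝ), EuclideanSpace.single l (1 : ℝ)]

/-- The quadratic form `∑ₖₗ ∂ₖ∂ₗ u(x) wₖ wₗ`. -/
noncomputable def hessForm (u : E n → ℝ) (S : Set (E n)) (x w : E n) : ℝ :=
  ∑ k, ∑ l, hessMatrix u S x k l * w k * w l

open Classical in
/-- `F(M) = ∑ₖ arctan λₖ`, the sum over the eigenvalues (with multiplicity) of the symmetric
matrix `M`. The value at nonsymmetric matrices is irrelevant. -/
noncomputable def lagrangianAngle (M : Matrix (Fin n) (Fin n) ℝ) : ℝ :=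
  if hM : M.IsHermitian then ∑ k, Real.arctan (hM.eigenvalues k) else 0

/-- `f` restricts to a `C^∞` diffeomorphism from `S` onto `T`. -/
def IsDiffeoOn (f : E n → E n) (S T : Set (E n)) : Prop :=
  ContDiffOn ℝ ∞ f S ∧ MapsTo f S T ∧
    ∃ g : E n → E n, ContDiffOn ℝ ∞ g T ∧ MapsTo g T S ∧ InvOn g f S T

/-- `(u, c)` is a solution of `(⋆)` for the domains `Ω` and `Ω'`: `u` is convex (and smooth up to
the boundary), `c ∈ (0, nπ/2)`, `∇u` is a diffeomorphism from `Ω` to `Ω'` (up to and including the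
boundaries), and `F(D²u) = c` in `Ω`. -/
structure IsSolution (Ω Ω' : Set (E n)) (u : E n → ℝ) (c : ℝ) : Prop where
  smooth : ContDiffOn ℝ ∞ u (closure Ω)
  convex : ConvexOn ℝ (closure Ω) u
  const_mem : c ∈ Ioo (0 : ℝ) (n * π / 2)
  diffeo : IsDiffeoOn (gradientWithin u (closure Ω)) (closure Ω) (closure Ω')
  angle_eq : ∀ x ∈ Ω, lagrangianAngle (hessMatrix u (closure Ω) x) = c

/-! ### Boundary defining functions and the estimates -/

/-- `h` is a boundary defining function of `Ω`, smooth up to the boundary: it vanishes on `∂Ω`,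
`D²h ≥ θ I`, and its derivatives of order one, two and three are bounded by `K`. -/
structure IsBoundaryDefiningFunction (Ω : Set (E n)) (h : E n → ℝ) (θ K : ℝ) : Prop where
  smooth : ContDiffOn ℝ ∞ h (closure Ω)
  eq_zero : ∀ x ∈ frontier Ω, h x = 0
  hess_ge : ∀ x ∈ closure Ω, ∀ w : E n, θ * ‖w‖ ^ 2 ≤ hessForm h (closure Ω) x w
  deriv_le : ∀ m ∈ Finset.Icc 1 3, ∀ x ∈ closure Ω,
    ‖iteratedFDerivWithin ℝ m h (closure Ω) x‖ ≤ K

/-- `D²u ≤ C₉` in tangential directions on `∂Ω`, `D²u ≤ C₁₀ I` on `∂Ω`, and `D²u ≤ C₁₀ I` in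
`Ω`. -/
def HessianBounds (Ω : Set (E n)) (u : E n → ℝ) (C₉ C₁₀ : ℝ) : Prop :=
  (∀ x ∈ frontier Ω, ∀ w ∈ boundaryTangentSpace Ω x,
    hessForm u (closure Ω) x w ≤ C₉ * ‖w‖ ^ 2) ∧
  (∀ x ∈ frontier Ω, ∀ w : E n, hessForm u (closure Ω) x w ≤ C₁₀ * ‖w‖ ^ 2) ∧
  (∀ x ∈ Ω, ∀ w : E n, hessForm u (closure Ω) x w ≤ C₁₀ * ‖w‖ ^ 2)

end MinimalLagrangian

open MinimalLagrangian

/-! The equation is used only through concavity. Since `u` is convex, the eigenvalues of `D²u` are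
nonnegative, and `arctan` is concave on the half-line. Freeze an eigenframe `e` and the weights `aᵢ
= 1/(1+μᵢ²)` at a point `x`. Among all points of `Ω`, which share the angle `c`, the weighted trace
`∑ aᵢ ∂ᵢ∂ᵢu` is then smallest at `x` (`sum_weighted_hess_ge`). The first and second order conditions
at this minimum are `L(∂_w u) = 0` and `L(∂_w∂_w u) ≥ 0` for `L = ∑ aᵢ ∂ᵢ∂ᵢ`
(`IsSolution.linearized`), so no calculus of matrix functions is needed. As `aᵢ ≤ 1` and `aᵢμᵢ² ≤
1`, first derivatives of `h`, and first derivatives of `h'` composed with `∇u`, have bounded `L`.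

The operator may degenerate, but its trace does not. The map `∇u` has bounded image, so some
eigenvalue is controlled somewhere. This keeps `c` away from `nπ/2`, hence some eigenvalue is
controlled at every point (`exists_trace_bound`). A uniformly convex defining function `h` therefore
satisfies `Lh ≥ θτ` and serves as a barrier (`exists_barrier_bound`).

Let `b = ∇h'(∇u)` and `χ = ⟨∇h, b⟩`. On the boundary `h' ∘ ∇u` vanishes, so `D²u b = s ∇h` with `s ≥
0`, and the barrier bounds `s` (`exists_normal_bound`). At a boundary minimum of `χ` the barrier
gives `∂_b χ ≤ C χ`, while direct differentiation gives `∂_b χ ≥ θγ²`; so `χ` is bounded below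
(`exists_obliqueness_bound`).

Let `M` be the largest tangential second derivative on the boundary, attained at `x` in the unit
direction `z`. Every vector at the boundary splits into a tangential part and a multiple of `b`, and
the two parts are `D²u`-orthogonal. This bounds `∂_z∂_z u` on the boundary by a combination of
controlled functions that equals `M` at `x`. The barrier gives `∂_b∂_z∂_z u ≥ -C(M+1)` at `x`.
Differentiating `h' ∘ ∇u = 0` twice along the boundary gives `θM² + ∂_b∂_z∂_z u ≤ C`, and the two
together bound `M` (`exists_tangential_bound`). The splitting then bounds all of `D²u` on the
boundary, and the maximum principle for `∂_w∂_w u` carries the bound inside.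

A given boundary defining function is a barrier with explicit constants. For arbitrary domains a
barrier is built from local defining functions; it is convex only near the boundary, which suffices
because the comparison argument needs convexity only there. -/

namespace MinimalLagrangian

open Filter Topology

section

/-! ### Two-jets of functions of one variable -/

/-- `g` is differentiable near `0`, with first and second derivatives `d₁`, `d₂` at `0`. -/
def HasJet (g : ℝ → ℝ) (d₁ d₂ : ℝ) : Prop :=
  ∃ φ : ℝ → ℝ, (∀ᶠ t in 𝓝 0, HasDerivAt g (φ t) t) ∧ φ 0 = d₁ ∧ HasDerivAt φ d₂ 0

namespace HasJet

variable {f g : ℝ → ℝ} {a₁ a₂ b₁ b₂ : ℝ}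

theorem hasDerivAt (hf : HasJet f a₁ a₂) : HasDerivAt f a₁ 0 := by
  obtain ⟨φ, h, rfl, -⟩ := hf
  exact h.self_of_nhds

theorem const (c : ℝ) : HasJet (fun _ => c) 0 0 :=
  ⟨fun _ => 0, Eventually.of_forall fun t => hasDerivAt_const t c, rfl, hasDerivAt_const 0 0⟩

theorem add (hf : HasJet f a₁ a₂) (hg : HasJet g b₁ b₂) :
    HasJet (fun t => f t + g t) (a₁ + b₁) (a₂ + b₂) := by
  obtain ⟨φ, h, rfl, h'⟩ := hf
  obtain ⟨χ, k, rfl, k'⟩ := hg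
  exact ⟨fun t => φ t + χ t, by filter_upwards [h, k] with t h k using h.add k, rfl, h'.add k'⟩

theorem const_mul (c : ℝ) (hf : HasJet f a₁ a₂) : HasJet (fun t => c * f t) (c * a₁) (c * a₂) := by
  obtain ⟨φ, h, rfl, h'⟩ := hf
  exact ⟨fun t => c * φ t, by filter_upwards [h] with t h using h.const_mul c, rfl,
    h'.const_mul c⟩

theorem neg (hf : HasJet f a₁ a₂) : HasJet (fun t => -f t) (-a₁) (-a₂) := by
  simpa using hf.const_mul (-1)

theorem sum {ι : Type*} (s : Finset ι) {f : ι → ℝ → ℝ} {a b : ι → ℝ}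
    (h : ∀ i ∈ s, HasJet (f i) (a i) (b i)) :
    HasJet (fun t => ∑ i ∈ s, f i t) (∑ i ∈ s, a i) (∑ i ∈ s, b i) := by
  classical
  induction s using Finset.induction_on with
  | empty => simpa using const 0
  | insert i s hi ih =>
    simp only [Finset.sum_insert hi]
    exact (h i (by simp)).add (ih fun j hj => h j (by simp [hj]))

theorem comp_neg (hf : HasJet f a₁ a₂) : HasJet (fun t => f (-t)) (-a₁) a₂ := by
  obtain ⟨φ, h, rfl, h'⟩ := hf
  have hn : ∀ t : ℝ, HasDerivAt (fun t : ℝ => -t) (-1) t := fun t => hasDerivAt_neg t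
  have ht : Tendsto (fun t : ℝ => -t) (𝓝 0) (𝓝 0) := by
    simpa using (continuous_neg (G := ℝ)).tendsto 0
  refine ⟨fun t => -φ (-t), ?_, by simp, ?_⟩
  · filter_upwards [ht.eventually h] with t h
    exact (h.comp t (hn t)).congr_deriv (by simp)
  · have : HasDerivAt φ a₂ (-0) := by simpa using h'
    exact (this.comp 0 (hn 0)).neg.congr_deriv (by simp)

theorem eq_zero_of_isLocalMin (hf : HasJet f a₁ a₂) (h : IsLocalMin f 0) : a₁ = 0 :=
  h.hasDerivAt_eq_zero hf.hasDerivAt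

/-- If `a₂` were negative, the second derivative test would make `0` a local maximum as well, so `f`
would be constant nearby and `a₂` would vanish. -/
theorem nonneg_of_isLocalMin (hf : HasJet f a₁ a₂) (h : IsLocalMin f 0) : 0 ≤ a₂ := by
  have h0 := hf.eq_zero_of_isLocalMin h
  have hfd := hf.hasDerivAt
  obtain ⟨φ, h1, h2, h'⟩ := hf
  have hd : deriv f =ᶠ[𝓝 0] φ := by filter_upwards [h1] with t h1 using h1.deriv
  by_contra! hneg
  have hmax : IsLocalMax f 0 := by
    refine isLocalMax_of_deriv_deriv_neg ?_ ?_ hfd.continuousAt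
    · rwa [hd.deriv_eq, h'.deriv]
    · rw [hd.self_of_nhds, h2, h0]
  have hc : f =ᶠ[𝓝 0] fun _ => f 0 := by
    filter_upwards [h, hmax] with t h3 h4 using le_antisymm h4 h3
  have hφ : φ =ᶠ[𝓝 0] fun _ => 0 := by
    filter_upwards [hd, hc.eventually_nhds] with t h3 h4
    rw [← h3, Filter.EventuallyEq.deriv_eq h4]; simp
  have := h'.unique ((hasDerivAt_const (0:ℝ) (0:ℝ)).congr_of_eventuallyEq hφ)
  linarith

theorem nonpos_of_isLocalMax (hf : HasJet f a₁ a₂) (h : IsLocalMax f 0) : a₂ ≤ 0 := by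
  have := hf.neg.nonneg_of_isLocalMin h.neg
  linarith

/-- The symmetrization `f t + f (-t)` has a local minimum at `0` and second derivative `2 a₂` there.
-/
theorem nonneg_of_convex (hf : HasJet f a₁ a₂)
    (h : ∀ᶠ t in 𝓝 0, 2 * f 0 ≤ f t + f (-t)) : 0 ≤ a₂ := by
  have h1 := (hf.add hf.comp_neg).nonneg_of_isLocalMin (by
    filter_upwards [h] with t ht
    simpa [two_mul] using ht)
  linarith

end HasJet

/-! ### Directional derivatives within a set -/

variable {n : ℕ} {F : Type*} [NormedAddCommGroup F] [NormedSpace ℝ F]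

/-- The derivative of `f` within `S` in the direction `v`. -/
noncomputable def pd (S : Set (E n)) (v : E n) (f : E n → F) (x : E n) : F :=
  fderivWithin ℝ f S x v

/-- Sets on which functions smooth up to the boundary have well-behaved derivatives. -/
structure IsRegular (S : Set (E n)) : Prop where
  uniqueDiffOn : UniqueDiffOn ℝ S
  subset_closure : S ⊆ closure (interior S)

variable {S S' : Set (E n)}

theorem differentiableWithinAt_of_smooth {f : E n → F} (hf : ContDiffOn ℝ ∞ f S) {x : E n}
    (hx : x ∈ S) : DifferentiableWithinAt ℝ f S x :=
  (hf x hx).differentiableWithinAt (by simp)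

theorem contDiffOn_fderivWithin (hS : IsRegular S) {f : E n → F} (hf : ContDiffOn ℝ ∞ f S) :
    ContDiffOn ℝ ∞ (fderivWithin ℝ f S) S :=
  hf.fderivWithin hS.uniqueDiffOn (by simp)

theorem contDiffOn_pd (hS : IsRegular S) {f : E n → F} (hf : ContDiffOn ℝ ∞ f S) (v : E n) :
    ContDiffOn ℝ ∞ (pd S v f) S :=
  (contDiffOn_fderivWithin hS hf).clm_apply contDiffOn_const

theorem pd_smul (c : ℝ) (v : E n) (f : E n → F) (x : E n) : pd S (c • v) f x = c • pd S v f x := by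
  simp [pd]

theorem pd_vadd (v w : E n) (f : E n → F) (x : E n) :
    pd S (v + w) f x = pd S v f x + pd S w f x := by
  simp [pd]

theorem pd_pd_eq (hS : IsRegular S) {f : E n → F} (hf : ContDiffOn ℝ ∞ f S) {x : E n}
    (hx : x ∈ S) (v w : E n) :
    pd S v (pd S w f) x = fderivWithin ℝ (fderivWithin ℝ f S) S x v w := by
  have h := fderivWithin_clm_apply (hS.uniqueDiffOn x hx)
    (differentiableWithinAt_of_smooth (contDiffOn_fderivWithin hS hf) hx)
    (differentiableWithinAt_const (c := w))
  change fderivWithin ℝ (fun y => fderivWithin ℝ f S y w) S x v = _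
  rw [h]; simp

theorem pd_comm (hS : IsRegular S) {f : E n → F} (hf : ContDiffOn ℝ ∞ f S) {x : E n}
    (hx : x ∈ S) (v w : E n) : pd S v (pd S w f) x = pd S w (pd S v f) x := by
  rw [pd_pd_eq hS hf hx, pd_pd_eq hS hf hx]
  exact (hf x hx).isSymmSndFDerivWithinAt (by
    simp only [minSmoothness_of_isRCLikeNormedField]; exact WithTop.coe_le_coe.2 (le_top : (2 : ℕ∞) ≤ ⊤)) hS.uniqueDiffOn (hS.subset_closure hx) hx v w

theorem pd_congr {f g : E n → F} {x : E n} (hx : x ∈ S) (h : ∀ y ∈ S, f y = g y) (v : E n) :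
    pd S v f x = pd S v g x := by
  rw [pd, pd, fderivWithin_congr h (h x hx)]

theorem pd_add (hS : IsRegular S) {f g : E n → F} (hf : ContDiffOn ℝ ∞ f S)
    (hg : ContDiffOn ℝ ∞ g S) {x : E n} (hx : x ∈ S) (v : E n) :
    pd S v (fun y => f y + g y) x = pd S v f x + pd S v g x := by
  simp [pd, fderivWithin_fun_add (hS.uniqueDiffOn x hx) (differentiableWithinAt_of_smooth hf hx)
    (differentiableWithinAt_of_smooth hg hx)]

theorem pd_sub (hS : IsRegular S) {f g : E n → F} (hf : ContDiffOn ℝ ∞ f S)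
    (hg : ContDiffOn ℝ ∞ g S) {x : E n} (hx : x ∈ S) (v : E n) :
    pd S v (fun y => f y - g y) x = pd S v f x - pd S v g x := by
  simp [pd, fderivWithin_fun_sub (hS.uniqueDiffOn x hx) (differentiableWithinAt_of_smooth hf hx)
    (differentiableWithinAt_of_smooth hg hx)]

theorem pd_sum (hS : IsRegular S) {ι : Type*} (s : Finset ι) {f : ι → E n → F}
    (hf : ∀ i, ContDiffOn ℝ ∞ (f i) S) {x : E n} (hx : x ∈ S) (v : E n) :
    pd S v (fun y => ∑ i ∈ s, f i y) x = ∑ i ∈ s, pd S v (f i) x := by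
  rw [pd, fderivWithin_fun_sum (hS.uniqueDiffOn x hx)
    fun i _ => differentiableWithinAt_of_smooth (hf i) hx]
  simp [pd]

theorem pd_mul (hS : IsRegular S) {f g : E n → ℝ} (hf : ContDiffOn ℝ ∞ f S)
    (hg : ContDiffOn ℝ ∞ g S) {x : E n} (hx : x ∈ S) (v : E n) :
    pd S v (fun y => f y * g y) x = f x * pd S v g x + g x * pd S v f x := by
  simp [pd, fderivWithin_fun_mul (hS.uniqueDiffOn x hx) (differentiableWithinAt_of_smooth hf hx)
    (differentiableWithinAt_of_smooth hg hx)]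

theorem pd_const_mul (hS : IsRegular S) (c : ℝ) {f : E n → ℝ} (hf : ContDiffOn ℝ ∞ f S)
    {x : E n} (hx : x ∈ S) (v : E n) :
    pd S v (fun y => c * f y) x = c * pd S v f x := by
  simp [pd, fderivWithin_const_mul (hS.uniqueDiffOn x hx) (differentiableWithinAt_of_smooth hf hx)]

theorem pd_const (c : F) (v x : E n) : pd S v (fun _ => c) x = 0 := by simp [pd]

theorem pd_clm {G : Type*} [NormedAddCommGroup G] [NormedSpace ℝ G] (hS : IsRegular S)
    (ℓ : F →L[ℝ] G) {f : E n → F} (hf : ContDiffOn ℝ ∞ f S) {x : E n} (hx : x ∈ S) (v : E n) :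
    pd S v (fun y => ℓ (f y)) x = ℓ (pd S v f x) := by
  have h := (ℓ.hasFDerivAt (x := f x)).comp_hasFDerivWithinAt x
    (differentiableWithinAt_of_smooth hf hx).hasFDerivWithinAt
  have h2 := h.fderivWithin (hS.uniqueDiffOn x hx)
  change fderivWithin ℝ (⇑ℓ ∘ f) S x v = _
  rw [h2]; rfl

theorem pd_comp (hS : IsRegular S) {p : E n → E n} (hp : ContDiffOn ℝ ∞ p S) (hm : MapsTo p S S')
    {k : E n → F} (hk : ContDiffOn ℝ ∞ k S') {x : E n} (hx : x ∈ S) (v : E n) :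
    pd S v (fun y => k (p y)) x = pd S' (pd S v p x) k (p x) := by
  have h := (differentiableWithinAt_of_smooth hk (hm hx)).hasFDerivWithinAt.comp x
    (differentiableWithinAt_of_smooth hp hx).hasFDerivWithinAt hm
  have h2 := h.fderivWithin (hS.uniqueDiffOn x hx)
  change fderivWithin ℝ (k ∘ p) S x v = _
  rw [h2]; rfl

/-- Meant for `p = ∇u`. The last term carries the third derivatives of `u`: the linearized equation
removes it in the interior, and the tangential estimate isolates it at the boundary. -/
theorem pd_pd_comp (hS : IsRegular S) (hS' : IsRegular S') {p : E n → E n}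
    (hp : ContDiffOn ℝ ∞ p S) (hm : MapsTo p S S')
    {k : E n → F} (hk : ContDiffOn ℝ ∞ k S') {x : E n} (hx : x ∈ S) (v w : E n) :
    pd S w (pd S v (fun y => k (p y))) x =
      pd S' (pd S w p x) (pd S' (pd S v p x) k) (p x) + pd S' (pd S w (pd S v p) x) k (p x) := by
  have hk' := contDiffOn_fderivWithin hS' hk
  have hkp : ContDiffOn ℝ ∞ (fun y => fderivWithin ℝ k S' (p y)) S := hk'.comp hp hm
  have h1 : pd S w (pd S v (fun y => k (p y))) x =
      pd S w (fun y => fderivWithin ℝ k S' (p y) (pd S v p y)) x :=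
    pd_congr hx (fun y hy => pd_comp hS hp hm hk hy v) w
  have h2 := fderivWithin_clm_apply (hS.uniqueDiffOn x hx)
    (differentiableWithinAt_of_smooth hkp hx)
    (differentiableWithinAt_of_smooth (contDiffOn_pd hS hp v) hx)
  have h3 := pd_comp hS hp hm hk' hx w
  rw [h1, pd, h2]
  rw [pd_pd_eq hS' hk (hm hx)]
  simp only [pd] at h3
  simp [pd, h3, add_comm]

theorem hasJet_line (hS : IsRegular S) {f : E n → ℝ} (hf : ContDiffOn ℝ ∞ f S) {x : E n}
    (hx : x ∈ interior S) (v : E n) :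
    HasJet (fun t => f (x + t • v)) (pd S v f x) (pd S v (pd S v f) x) := by
  have hlin : ∀ t : ℝ, HasDerivAt (fun t : ℝ => x + t • v) v t := fun t => by
    simpa using ((hasDerivAt_id t).smul_const v).const_add x
  have key : ∀ g : E n → ℝ, ContDiffOn ℝ ∞ g S → ∀ t : ℝ, x + t • v ∈ interior S →
      HasDerivAt (fun t : ℝ => g (x + t • v)) (pd S v g (x + t • v)) t := by
    intro g hg t ht
    have h1 := ((differentiableWithinAt_of_smooth hg (interior_subset ht)).hasFDerivWithinAt).hasFDerivAt
      (mem_interior_iff_mem_nhds.1 ht)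
    exact h1.comp_hasDerivAt t (hlin t)
  refine ⟨fun t => pd S v f (x + t • v), ?_, by simp, ?_⟩
  · have hc : ContinuousAt (fun t : ℝ => x + t • v) 0 := (hlin 0).continuousAt
    have : ∀ᶠ t in 𝓝 (0:ℝ), x + t • v ∈ interior S :=
      hc.eventually (isOpen_interior.mem_nhds (by simpa using hx))
    filter_upwards [this] with t ht using key f hf t ht
  · simpa using key _ (contDiffOn_pd hS hf v) 0 (by simpa using hx)

end

section
variable {n : ℕ} {S S' Ω Ω' : Set (E n)}

/-! ### Domains -/

namespace IsUniformlyConvexDomain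

theorem interior_closure (hΩ : IsUniformlyConvexDomain Ω) : interior (closure Ω) = Ω := by
  rw [hΩ.convex.interior_closure_eq_interior_of_nonempty_interior
    (by rw [hΩ.isOpen.interior_eq]; exact hΩ.nonempty), hΩ.isOpen.interior_eq]

theorem isRegular (hΩ : IsUniformlyConvexDomain Ω) : IsRegular (closure Ω) where
  uniqueDiffOn := uniqueDiffOn_convex hΩ.convex.closure
    (by rw [hΩ.interior_closure]; exact hΩ.nonempty)
  subset_closure := by rw [hΩ.interior_closure]

theorem isCompact_closure (hΩ : IsUniformlyConvexDomain Ω) : IsCompact (closure Ω) :=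
  hΩ.isBounded.isCompact_closure

theorem isCompact_frontier (hΩ : IsUniformlyConvexDomain Ω) : IsCompact (frontier Ω) :=
  hΩ.isCompact_closure.of_isClosed_subset isClosed_frontier frontier_subset_closure

theorem mem_or_mem_frontier (hΩ : IsUniformlyConvexDomain Ω) {x : E n} (hx : x ∈ closure Ω) :
    x ∈ Ω ∨ x ∈ frontier Ω := by
  rw [hΩ.isOpen.frontier_eq]
  by_cases h : x ∈ Ω
  · exact Or.inl h
  · exact Or.inr ⟨hx, h⟩

theorem notMem_of_mem_frontier (hΩ : IsUniformlyConvexDomain Ω) {x : E n} (hx : x ∈ frontier Ω) :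
    x ∉ Ω := by
  rw [hΩ.isOpen.frontier_eq] at hx
  exact hx.2

end IsUniformlyConvexDomain

/-! ### Hessians -/

theorem euclidean_eq_sum (w : E n) : w = ∑ k, w k • EuclideanSpace.single k (1 : ℝ) := by
  ext j
  simp [Finset.sum_apply, Pi.single_apply]

theorem hessMatrix_apply (hS : IsRegular S) {f : E n → ℝ} (hf : ContDiffOn ℝ ∞ f S) {x : E n}
    (hx : x ∈ S) (k l : Fin n) :
    hessMatrix f S x k l =
      pd S (EuclideanSpace.single k 1) (pd S (EuclideanSpace.single l 1) f) x := by
  rw [pd_pd_eq hS hf hx, hessMatrix, Matrix.of_apply,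
    iteratedFDerivWithin_two_apply' f hS.uniqueDiffOn hx]

theorem pd_pd_eq_sum (hS : IsRegular S) {f : E n → ℝ} (hf : ContDiffOn ℝ ∞ f S) {x : E n}
    (hx : x ∈ S) (v w : E n) :
    pd S v (pd S w f) x = ∑ k, ∑ l, hessMatrix f S x k l * v k * w l := by
  conv_lhs => rw [pd_pd_eq hS hf hx, euclidean_eq_sum v, euclidean_eq_sum w]
  simp only [hessMatrix_apply hS hf hx, pd_pd_eq hS hf hx, map_sum, map_smul,
    _root_.sum_apply, _root_.smul_apply, smul_eq_mul, Finset.mul_sum]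
  rw [Finset.sum_comm]
  refine Finset.sum_congr rfl fun k _ => Finset.sum_congr rfl fun l _ => ?_
  ring

theorem hessForm_eq (hS : IsRegular S) {f : E n → ℝ} (hf : ContDiffOn ℝ ∞ f S) {x : E n}
    (hx : x ∈ S) (w : E n) : hessForm f S x w = pd S w (pd S w f) x :=
  (pd_pd_eq_sum hS hf hx w w).symm

theorem isHermitian_hessMatrix (hS : IsRegular S) {f : E n → ℝ} (hf : ContDiffOn ℝ ∞ f S)
    {x : E n} (hx : x ∈ S) : (hessMatrix f S x).IsHermitian := by
  ext k l
  rw [Matrix.conjTranspose_apply, hessMatrix_apply hS hf hx, hessMatrix_apply hS hf hx,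
    pd_comm hS hf hx]
  simp

/-- `e` is an orthonormal basis of eigenvectors of the Hessian of `u` at `x`, with eigenvalues
`μ`. -/
def IsEigenframe (u : E n → ℝ) (S : Set (E n)) (x : E n) (e : OrthonormalBasis (Fin n) ℝ (E n))
    (μ : Fin n → ℝ) : Prop :=
  ∀ i v, pd S v (pd S (e i) u) x = μ i * inner ℝ v (e i)

theorem exists_isEigenframe (hS : IsRegular S) {u : E n → ℝ} (hu : ContDiffOn ℝ ∞ u S) {x : E n}
    (hx : x ∈ S) : ∃ (e : OrthonormalBasis (Fin n) ℝ (E n)) (μ : Fin n → ℝ),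
      IsEigenframe u S x e μ ∧ lagrangianAngle (hessMatrix u S x) = ∑ i, Real.arctan (μ i) := by
  classical
  have hM := isHermitian_hessMatrix hS hu hx
  refine ⟨hM.eigenvectorBasis, hM.eigenvalues, fun i v => ?_, ?_⟩
  · rw [pd_pd_eq_sum hS hu hx]
    have h := hM.mulVec_eigenvectorBasis i
    have h2 : ∀ k, ∑ l, hessMatrix u S x k l * hM.eigenvectorBasis i l =
        hM.eigenvalues i * hM.eigenvectorBasis i k := fun k => by
      simpa [Matrix.mulVec, dotProduct] using congrFun h k
    have h3 : ∀ k, ∑ l, hessMatrix u S x k l * v k * hM.eigenvectorBasis i l =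
        hM.eigenvalues i * (hM.eigenvectorBasis i k * v k) := fun k => by
      rw [← mul_assoc, ← h2 k, Finset.sum_mul]
      exact Finset.sum_congr rfl fun l _ => by ring
    simp only [h3, ← Finset.mul_sum]
    congr 1
  · rw [lagrangianAngle, dif_pos hM]

/-! ### The supporting hyperplane inequality for the Lagrangian angle -/

/-- Concavity of `arctan` on the half-line, where its derivative decreases. -/
theorem arctan_le_tangent {a b : ℝ} (ha : 0 ≤ a) (hb : 0 ≤ b) :
    Real.arctan b ≤ Real.arctan a + (b - a) / (1 + a ^ 2) := by
  have hd : ∀ t, HasDerivAt Real.arctan (1 / (1 + t ^ 2)) t := Real.hasDerivAt_arctan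
  rcases lt_trichotomy a b with h | rfl | h
  · obtain ⟨ξ, hξ, he⟩ := exists_hasDerivAt_eq_slope Real.arctan _ h
      Real.continuous_arctan.continuousOn fun t _ => hd t
    have h1 : 1 / (1 + ξ ^ 2) ≤ 1 / (1 + a ^ 2) := by
      apply one_div_le_one_div_of_le (by positivity)
      nlinarith [hξ.1]
    rw [he, div_le_iff₀ (by linarith)] at h1
    have : (b - a) / (1 + a ^ 2) = 1 / (1 + a ^ 2) * (b - a) := by ring
    linarith
  · simp
  · obtain ⟨ξ, hξ, he⟩ := exists_hasDerivAt_eq_slope Real.arctan _ h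
      Real.continuous_arctan.continuousOn fun t _ => hd t
    have h1 : 1 / (1 + a ^ 2) ≤ 1 / (1 + ξ ^ 2) := by
      apply one_div_le_one_div_of_le (by nlinarith)
      nlinarith [hξ.1, hξ.2]
    rw [he, le_div_iff₀ (by linarith)] at h1
    have : (b - a) / (1 + a ^ 2) = -(1 / (1 + a ^ 2) * (a - b)) := by ring
    linarith

theorem sum_sq_inner (e : OrthonormalBasis (Fin n) ℝ (E n)) (v : E n) :
    ∑ i, inner ℝ v (e i) ^ 2 = ‖v‖ ^ 2 := by
  have := e.sum_sq_norm_inner_left v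
  simpa [sq_abs] using this

theorem pd_pd_eq_sum_frame (hS : IsRegular S) {u : E n → ℝ} (hu : ContDiffOn ℝ ∞ u S) {x : E n}
    (hx : x ∈ S) {e : OrthonormalBasis (Fin n) ℝ (E n)} {μ : Fin n → ℝ}
    (he : IsEigenframe u S x e μ) (v w : E n) :
    pd S v (pd S w u) x = ∑ i, μ i * (inner ℝ v (e i) * inner ℝ w (e i)) := by
  have h : fderivWithin ℝ (fderivWithin ℝ u S) S x v w =
      fderivWithin ℝ (fderivWithin ℝ u S) S x v (∑ i, e.repr w i • e i) := by rw [e.sum_repr]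
  rw [pd_pd_eq hS hu hx, h, map_sum]
  refine Finset.sum_congr rfl fun i _ => ?_
  rw [map_smul, ← pd_pd_eq hS hu hx, he, e.repr_apply_apply, real_inner_comm, smul_eq_mul]
  ring

/-- The trace of the Hessian at `y`, weighted by the linearized operator at `x`, is at least its
value at `x` if both points have the same Lagrangian angle. -/
theorem sum_weighted_hess_ge {u : E n → ℝ} (hS : IsRegular S) (hu : ContDiffOn ℝ ∞ u S)
    {y : E n} (hy : y ∈ S)
    {e e' : OrthonormalBasis (Fin n) ℝ (E n)} {μ μ' : Fin n → ℝ}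
    (he' : IsEigenframe u S y e' μ')
    (hμ : ∀ i, 0 ≤ μ i) (hμ' : ∀ i, 0 ≤ μ' i)
    (hc : ∑ i, Real.arctan (μ i) = ∑ i, Real.arctan (μ' i)) :
    ∑ i, (1 + μ i ^ 2)⁻¹ * μ i ≤
      ∑ i, (1 + μ i ^ 2)⁻¹ * pd S (e i) (pd S (e i) u) y := by
  -- The numbers `⟨e i, e' j⟩²` form a doubly stochastic matrix. Averaging the scalar tangent
  -- inequality for the pairs `(μ i, μ' j)` with these weights gives the matrix inequality without a
  -- common eigenbasis.
  have h1 : ∀ i j, inner ℝ (e i) (e' j) ^ 2 * Real.arctan (μ' j) ≤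
      inner ℝ (e i) (e' j) ^ 2 * (Real.arctan (μ i) - (1 + μ i ^ 2)⁻¹ * μ i)
        + (1 + μ i ^ 2)⁻¹ * (μ' j * (inner ℝ (e i) (e' j) * inner ℝ (e i) (e' j))) := by
    intro i j
    have := mul_le_mul_of_nonneg_left (arctan_le_tangent (hμ i) (hμ' j))
      (sq_nonneg (inner ℝ (e i) (e' j)))
    refine this.trans (le_of_eq ?_)
    rw [div_eq_mul_inv]; ring
  have h2 := Finset.sum_le_sum fun i (_ : i ∈ Finset.univ) =>
    Finset.sum_le_sum fun j (_ : j ∈ Finset.univ) => h1 i j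
  simp only [Finset.sum_add_distrib, ← Finset.mul_sum, ← Finset.sum_mul, sum_sq_inner,
    ← pd_pd_eq_sum_frame hS hu hy he'] at h2
  rw [Finset.sum_comm] at h2
  have h3 : ∀ j, ∑ i, inner ℝ (e i) (e' j) ^ 2 = 1 := fun j => by
    have := sum_sq_inner e (e' j)
    simpa [real_inner_comm] using this
  simp only [← Finset.sum_mul, h3, one_mul, OrthonormalBasis.norm_eq_one, one_pow,
    Finset.sum_sub_distrib] at h2
  linarith

/-! ### The gradient map -/

theorem inner_gradientWithin (u : E n → ℝ) (x w : E n) :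
    inner ℝ (gradientWithin u S x) w = pd S w u x := by
  simp [gradientWithin, pd]

theorem inner_pd_gradientWithin (hS : IsRegular S) {u : E n → ℝ}
    (hp : ContDiffOn ℝ ∞ (gradientWithin u S) S) {x : E n} (hx : x ∈ S) (v w : E n) :
    inner ℝ (pd S v (gradientWithin u S) x) w = pd S v (pd S w u) x := by
  have h := pd_clm hS (innerSL ℝ w) hp hx v
  simp only [innerSL_apply_apply] at h
  rw [real_inner_comm, ← h]
  exact pd_congr hx (fun y _ => by rw [real_inner_comm, inner_gradientWithin]) v

theorem inner_pd_pd_gradientWithin (hS : IsRegular S) {u : E n → ℝ}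
    (hp : ContDiffOn ℝ ∞ (gradientWithin u S) S) {x : E n} (hx : x ∈ S) (v v' w : E n) :
    inner ℝ (pd S v (pd S v' (gradientWithin u S)) x) w = pd S v (pd S v' (pd S w u)) x := by
  have h := pd_clm hS (innerSL ℝ w) (contDiffOn_pd hS hp v') hx v
  simp only [innerSL_apply_apply] at h
  rw [real_inner_comm, ← h]
  exact pd_congr hx (fun y hy => by
    rw [real_inner_comm, inner_pd_gradientWithin hS hp hy]) v

end

section
variable {n : ℕ} {S S' Ω Ω' : Set (E n)}

/-! ### Local invertibility -/

/-- In finite dimension an injective derivative is surjective, so `f` is open at `x`. -/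
theorem map_mem_interior {f : E n → E n} (hf : ContDiffOn ℝ ∞ f S)
    (hm : MapsTo f S S') {x : E n} (hx : x ∈ interior S)
    (hinj : ∀ v, pd S v f x = 0 → v = 0) : f x ∈ interior S' := by
  have hn : S ∈ 𝓝 x := mem_interior_iff_mem_nhds.1 hx
  have hcd : ContDiffAt ℝ ∞ f x := hf.contDiffAt hn
  have hst : HasStrictFDerivAt f (fderiv ℝ f x) x := hcd.hasStrictFDerivAt (by simp)
  have hfd : fderivWithin ℝ f S x = fderiv ℝ f x := fderivWithin_of_mem_nhds hn
  have hsurj : (fderiv ℝ f x : E n →ₗ[ℝ] E n).range = ⊤ := by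
    rw [LinearMap.range_eq_top]
    apply LinearMap.injective_iff_surjective.1
    rw [injective_iff_map_eq_zero]
    intro v hv
    exact hinj v (by rw [pd, hfd]; exact hv)
  rw [mem_interior_iff_mem_nhds, ← hst.map_nhds_eq_of_surj hsurj]
  exact mem_map.2 (mem_of_superset hn hm)

/-- Differentiate `g ∘ f = id` along `v`. -/
theorem pd_eq_zero_of_leftInvOn (hS : IsRegular S) {f g : E n → E n}
    (hf : ContDiffOn ℝ ∞ f S) (hm : MapsTo f S S') (hg : ContDiffOn ℝ ∞ g S')
    (hi : LeftInvOn g f S) {x v : E n} (hx : x ∈ S) (h : pd S v f x = 0) : v = 0 := by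
  have h1 := pd_comp hS hf hm hg hx v
  rw [h, pd_congr (g := fun y => y) hx hi v] at h1
  have h2 : pd S' (0 : E n) g (f x) = 0 := by simp [pd]
  rw [h2, pd, fderivWithin_fun_id (hS.uniqueDiffOn x hx)] at h1
  simpa using h1

namespace IsSolution

variable {u : E n → ℝ} {c : ℝ}

theorem pd_gradient_ne_zero (hs : IsSolution Ω Ω' u c) (hΩ : IsUniformlyConvexDomain Ω)
    {x v : E n} (hx : x ∈ closure Ω) (hv : v ≠ 0) :
    pd (closure Ω) v (gradientWithin u (closure Ω)) x ≠ 0 := by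
  obtain ⟨hp, hm, g, hg, hgm, hi⟩ := hs.diffeo
  exact fun h => hv (pd_eq_zero_of_leftInvOn hΩ.isRegular hp hm hg hi.1 hx h)

/-- Were the image an interior point, the inverse map would be open there and `x` would be interior.
-/
theorem gradient_mem_frontier (hs : IsSolution Ω Ω' u c) (hΩ : IsUniformlyConvexDomain Ω)
    (hΩ' : IsUniformlyConvexDomain Ω') {x : E n} (hx : x ∈ frontier Ω) :
    gradientWithin u (closure Ω) x ∈ frontier Ω' := by
  obtain ⟨hp, hm, g, hg, hgm, hi⟩ := hs.diffeo
  have hx' := frontier_subset_closure hx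
  refine (hΩ'.mem_or_mem_frontier (hm hx')).resolve_left fun h => ?_
  refine hΩ.notMem_of_mem_frontier hx ?_
  rw [← hΩ.interior_closure]
  have := map_mem_interior hg hgm (x := gradientWithin u (closure Ω) x)
    (by rwa [hΩ'.interior_closure])
    fun v hv => pd_eq_zero_of_leftInvOn hΩ'.isRegular hg hgm hp hi.2 (hm hx') hv
  rwa [hi.1 hx'] at this

theorem hess_nonneg_of_mem (hs : IsSolution Ω Ω' u c) (hΩ : IsUniformlyConvexDomain Ω)
    {x : E n} (hx : x ∈ Ω) (w : E n) :
    0 ≤ pd (closure Ω) w (pd (closure Ω) w u) x := by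
  refine (hasJet_line hΩ.isRegular hs.smooth (by rwa [hΩ.interior_closure]) w).nonneg_of_convex ?_
  have hc : Continuous fun t : ℝ => x + t • w := by fun_prop
  have hc' : Continuous fun t : ℝ => x + (-t) • w := by fun_prop
  have h0 : Ω ∈ 𝓝 (x + (0:ℝ) • w) := by simpa using hΩ.isOpen.mem_nhds hx
  have h0' : Ω ∈ 𝓝 (x + (-(0:ℝ)) • w) := by simpa using hΩ.isOpen.mem_nhds hx
  filter_upwards [hc.continuousAt.eventually h0, hc'.continuousAt.eventually h0'] with t h1 h2
  have := hs.convex.2 (subset_closure h1) (subset_closure h2)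
    (by norm_num : (0 : ℝ) ≤ 1 / 2) (by norm_num : (0 : ℝ) ≤ 1 / 2) (by norm_num)
  have e : (1/2 : ℝ) • (x + t • w) + (1/2 : ℝ) • (x + (-t) • w) = x := by module
  rw [e] at this
  simp only [smul_eq_mul] at this
  simp only [zero_smul, add_zero]
  linarith

theorem hess_nonneg (hs : IsSolution Ω Ω' u c) (hΩ : IsUniformlyConvexDomain Ω)
    {x : E n} (hx : x ∈ closure Ω) (w : E n) :
    0 ≤ pd (closure Ω) w (pd (closure Ω) w u) x := by
  have hc := (contDiffOn_pd hΩ.isRegular (contDiffOn_pd hΩ.isRegular hs.smooth w) w).continuousOn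
  have := (hc.mono subset_closure : ContinuousOn _ Ω)
  have h2 : MapsTo (pd (closure Ω) w (pd (closure Ω) w u)) (closure Ω) (closure (Ici 0)) :=
    MapsTo.closure_of_continuousOn (fun y hy => hs.hess_nonneg_of_mem hΩ hy w) hc
  simpa using h2 hx

theorem eigenvalue_nonneg (hs : IsSolution Ω Ω' u c) (hΩ : IsUniformlyConvexDomain Ω)
    {x : E n} (hx : x ∈ closure Ω) {e : OrthonormalBasis (Fin n) ℝ (E n)} {μ : Fin n → ℝ}
    (he : IsEigenframe u (closure Ω) x e μ) (i : Fin n) : 0 ≤ μ i := by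
  have := hs.hess_nonneg hΩ hx (e i)
  rw [he] at this
  simpa using this

/-- A null vector of a nonnegative form lies in its kernel, but `D²u` is the derivative of a
diffeomorphism and has no kernel. -/
theorem hess_pos (hs : IsSolution Ω Ω' u c) (hΩ : IsUniformlyConvexDomain Ω)
    {x : E n} (hx : x ∈ closure Ω) {w : E n} (hw : w ≠ 0) :
    0 < pd (closure Ω) w (pd (closure Ω) w u) x := by
  refine (hs.hess_nonneg hΩ hx w).lt_of_ne fun h0 => ?_
  obtain ⟨e, μ, he, -⟩ := exists_isEigenframe hΩ.isRegular hs.smooth hx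
  have hμ := hs.eigenvalue_nonneg hΩ hx he
  have hsum := pd_pd_eq_sum_frame hΩ.isRegular hs.smooth hx he
  rw [hsum] at h0
  have h1 := (Finset.sum_eq_zero_iff_of_nonneg fun i _ =>
    mul_nonneg (hμ i) (mul_self_nonneg (inner ℝ w (e i)))).1 h0.symm
  refine hs.pd_gradient_ne_zero hΩ hx hw (ext_inner_right ℝ fun v => ?_)
  rw [inner_pd_gradientWithin hΩ.isRegular hs.diffeo.1 hx, hsum, inner_zero_left]
  refine Finset.sum_eq_zero fun i hi => ?_
  have := h1 i hi
  rcases mul_eq_zero.1 this with h | h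
  · simp [h]
  · simp [mul_self_eq_zero.1 h]

/-! ### The linearized operator -/

/-- Frame and weights stay frozen at `x` while `y` varies, so the right-hand side is a smooth
function of `y` with a minimum at `x`. -/
theorem isLocalMin_weighted_hess (hs : IsSolution Ω Ω' u c) (hΩ : IsUniformlyConvexDomain Ω)
    {x : E n} (hx : x ∈ Ω) {e : OrthonormalBasis (Fin n) ℝ (E n)} {μ : Fin n → ℝ}
    (he : IsEigenframe u (closure Ω) x e μ) (hc : ∑ i, Real.arctan (μ i) = c) {y : E n}
    (hy : y ∈ Ω) :
    ∑ i, (1 + μ i ^ 2)⁻¹ * pd (closure Ω) (e i) (pd (closure Ω) (e i) u) x ≤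
      ∑ i, (1 + μ i ^ 2)⁻¹ * pd (closure Ω) (e i) (pd (closure Ω) (e i) u) y := by
  obtain ⟨e', μ', he', hang⟩ := exists_isEigenframe hΩ.isRegular hs.smooth (subset_closure hy)
  rw [hs.angle_eq y hy] at hang
  have := sum_weighted_hess_ge hΩ.isRegular hs.smooth (subset_closure hy) (e := e) he'
    (hs.eigenvalue_nonneg hΩ (subset_closure hx) he)
    (hs.eigenvalue_nonneg hΩ (subset_closure hy) he') (hc.trans hang)
  refine le_trans (le_of_eq ?_) this
  refine Finset.sum_congr rfl fun i _ => ?_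
  rw [he]
  simp

/-- These are the first and second order conditions, along the line in direction `w`, for the
minimum of the frozen weighted trace; the derivatives in `w` are then commuted inwards. -/
theorem linearized (hs : IsSolution Ω Ω' u c) (hΩ : IsUniformlyConvexDomain Ω)
    {x : E n} (hx : x ∈ Ω) {e : OrthonormalBasis (Fin n) ℝ (E n)} {μ : Fin n → ℝ}
    (he : IsEigenframe u (closure Ω) x e μ) (hc : ∑ i, Real.arctan (μ i) = c) (w : E n) :
    (∑ i, (1 + μ i ^ 2)⁻¹ *
      pd (closure Ω) (e i) (pd (closure Ω) (e i) (pd (closure Ω) w u)) x = 0) ∧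
    0 ≤ ∑ i, (1 + μ i ^ 2)⁻¹ * pd (closure Ω) (e i) (pd (closure Ω) (e i)
      (pd (closure Ω) w (pd (closure Ω) w u))) x := by
  have hS := hΩ.isRegular
  have hu := hs.smooth
  have hx' := subset_closure hx
  have hpd : ∀ {f : E n → ℝ} (v : E n), ContDiffOn ℝ ∞ f (closure Ω) →
      ContDiffOn ℝ ∞ (pd (closure Ω) v f) (closure Ω) := fun v hf => contDiffOn_pd hS hf v
  have hjet := HasJet.sum Finset.univ fun i (_ : i ∈ Finset.univ) =>
    (hasJet_line hS (hpd (e i) (hpd (e i) hu)) (x := x)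
      (by rwa [hΩ.interior_closure]) w).const_mul (1 + μ i ^ 2)⁻¹
  have hmin : IsLocalMin (fun t : ℝ => ∑ i, (1 + μ i ^ 2)⁻¹ *
      pd (closure Ω) (e i) (pd (closure Ω) (e i) u) (x + t • w)) 0 := by
    have hcont : Continuous fun t : ℝ => x + t • w := by fun_prop
    have h0 : Ω ∈ 𝓝 (x + (0:ℝ) • w) := by simpa using hΩ.isOpen.mem_nhds hx
    filter_upwards [hcont.continuousAt.eventually h0] with t ht
    simpa using hs.isLocalMin_weighted_hess hΩ hx he hc ht
  have h1 := hjet.eq_zero_of_isLocalMin hmin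
  have h2 := hjet.nonneg_of_isLocalMin hmin
  have hswap : ∀ (f : E n → ℝ), ContDiffOn ℝ ∞ f (closure Ω) → ∀ v : E n, ∀ y ∈ closure Ω,
      pd (closure Ω) w (pd (closure Ω) v (pd (closure Ω) v f)) y =
        pd (closure Ω) v (pd (closure Ω) v (pd (closure Ω) w f)) y := by
    intro f hf v y hy
    rw [pd_comm hS (hpd v hf) hy]
    exact pd_congr hy (fun z hz => pd_comm hS hf hz w v) v
  constructor
  · rw [← h1]
    exact Finset.sum_congr rfl fun i _ => by rw [hswap u hu (e i) x hx']
  · refine h2.trans (le_of_eq ?_)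
    refine Finset.sum_congr rfl fun i _ => ?_
    rw [pd_congr hx' (hswap u hu (e i)) w, hswap _ (hpd w hu) (e i) x hx']

end IsSolution

end

section
variable {n : ℕ} {S S' Ω Ω' : Set (E n)}

/-! ### The linearized operator in an eigenframe -/

/-- The linearized operator `∑ᵢⱼ aᵢⱼ ∂ᵢ∂ⱼ f` with `a = (1 + (D²u)²)⁻¹`, in an eigenframe of
`D²u`. -/
noncomputable def linOp (S : Set (E n)) (e : OrthonormalBasis (Fin n) ℝ (E n)) (μ : Fin n → ℝ)
    (f : E n → ℝ) (x : E n) : ℝ :=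
  ∑ i, (1 + μ i ^ 2)⁻¹ * pd S (e i) (pd S (e i) f) x

/-- The bilinear form `∑ᵢⱼ aᵢⱼ ∂ᵢf ∂ⱼg` in an eigenframe of `D²u`. -/
noncomputable def gradForm (S : Set (E n)) (e : OrthonormalBasis (Fin n) ℝ (E n)) (μ : Fin n → ℝ)
    (f g : E n → ℝ) (x : E n) : ℝ :=
  ∑ i, (1 + μ i ^ 2)⁻¹ * (pd S (e i) f x * pd S (e i) g x)

/-- An eigenframe at `x` whose eigenvalues have Lagrangian angle `c`. -/
structure IsFrame (S : Set (E n)) (u : E n → ℝ) (c : ℝ) (x : E n)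
    (e : OrthonormalBasis (Fin n) ℝ (E n)) (μ : Fin n → ℝ) : Prop where
  isEigenframe : IsEigenframe u S x e μ
  angle : ∑ i, Real.arctan (μ i) = c

variable {e : OrthonormalBasis (Fin n) ℝ (E n)} {μ : Fin n → ℝ} {f g : E n → ℝ} {x : E n}

theorem weight_pos (μ : ℝ) : 0 < (1 + μ ^ 2)⁻¹ := by positivity

theorem weight_le_one (μ : ℝ) : (1 + μ ^ 2)⁻¹ ≤ 1 :=
  inv_le_one_of_one_le₀ (by nlinarith [sq_nonneg μ])

theorem weight_mul_sq_le_one (μ : ℝ) : (1 + μ ^ 2)⁻¹ * μ ^ 2 ≤ 1 := by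
  rw [inv_mul_le_iff₀ (by positivity)]
  linarith

theorem linOp_add (hS : IsRegular S) (hf : ContDiffOn ℝ ∞ f S) (hg : ContDiffOn ℝ ∞ g S)
    (hx : x ∈ S) : linOp S e μ (fun y => f y + g y) x = linOp S e μ f x + linOp S e μ g x := by
  simp only [linOp, ← Finset.sum_add_distrib]
  refine Finset.sum_congr rfl fun i _ => ?_
  rw [pd_congr hx (fun y hy => pd_add hS hf hg hy (e i)),
    pd_add hS (contDiffOn_pd hS hf _) (contDiffOn_pd hS hg _) hx]
  ring

theorem linOp_const_mul (hS : IsRegular S) (c : ℝ) (hf : ContDiffOn ℝ ∞ f S)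
    (hx : x ∈ S) : linOp S e μ (fun y => c * f y) x = c * linOp S e μ f x := by
  simp only [linOp, Finset.mul_sum]
  refine Finset.sum_congr rfl fun i _ => ?_
  rw [pd_congr hx (fun y hy => pd_const_mul hS c hf hy (e i)),
    pd_const_mul hS c (contDiffOn_pd hS hf _) hx]
  ring

theorem linOp_sub (hS : IsRegular S) (hf : ContDiffOn ℝ ∞ f S) (hg : ContDiffOn ℝ ∞ g S)
    (hx : x ∈ S) : linOp S e μ (fun y => f y - g y) x = linOp S e μ f x - linOp S e μ g x := by
  simp only [linOp, ← Finset.sum_sub_distrib]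
  refine Finset.sum_congr rfl fun i _ => ?_
  rw [pd_congr hx (fun y hy => pd_sub hS hf hg hy (e i)),
    pd_sub hS (contDiffOn_pd hS hf _) (contDiffOn_pd hS hg _) hx]
  ring

theorem linOp_mul (hS : IsRegular S) (hf : ContDiffOn ℝ ∞ f S) (hg : ContDiffOn ℝ ∞ g S)
    (hx : x ∈ S) : linOp S e μ (fun y => f y * g y) x =
      f x * linOp S e μ g x + g x * linOp S e μ f x + 2 * gradForm S e μ f g x := by
  simp only [linOp, gradForm, Finset.mul_sum, ← Finset.sum_add_distrib]
  refine Finset.sum_congr rfl fun i _ => ?_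
  have hf' := contDiffOn_pd hS hf (e i)
  have hg' := contDiffOn_pd hS hg (e i)
  rw [pd_congr hx (fun y hy => pd_mul hS hf hg hy (e i)),
    pd_add hS (hf.mul hg') (hg.mul hf') hx, pd_mul hS hf hg' hx, pd_mul hS hg hf' hx]
  ring

theorem linOp_const (c : ℝ) : linOp S e μ (fun _ => c) x = 0 := by
  have h : ∀ i, pd S (e i) (fun _ : E n => c) = fun _ => 0 := fun i => funext fun y => pd_const _ _ _
  simp [linOp, h, pd_const]

theorem pd_comp_real (hS : IsRegular S) {η : ℝ → ℝ} (hη : ContDiff ℝ ∞ η)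
    (hf : ContDiffOn ℝ ∞ f S) (hx : x ∈ S) (v : E n) :
    pd S v (fun y => η (f y)) x = deriv η (f x) * pd S v f x := by
  have h := (hη.differentiable (by simp) (f x)).hasDerivAt.comp_hasFDerivWithinAt x
    (differentiableWithinAt_of_smooth hf hx).hasFDerivWithinAt
  have h2 := h.fderivWithin (hS.uniqueDiffOn x hx)
  change fderivWithin ℝ (η ∘ f) S x v = _
  rw [h2]; rfl

theorem linOp_comp (hS : IsRegular S) {η : ℝ → ℝ} (hη : ContDiff ℝ ∞ η)
    (hf : ContDiffOn ℝ ∞ f S) (hx : x ∈ S) :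
    linOp S e μ (fun y => η (f y)) x =
      deriv (deriv η) (f x) * gradForm S e μ f f x + deriv η (f x) * linOp S e μ f x := by
  have hη' : ContDiff ℝ ∞ (deriv η) := (contDiff_infty_iff_deriv.1 hη).2
  simp only [linOp, gradForm, Finset.mul_sum, ← Finset.sum_add_distrib]
  refine Finset.sum_congr rfl fun i _ => ?_
  have hf' := contDiffOn_pd hS hf (e i)
  rw [pd_congr hx (fun y hy => pd_comp_real hS hη hf hy (e i)),
    pd_mul hS (f := fun y => deriv η (f y)) (hη'.comp_contDiffOn hf) hf' hx, pd_comp_real hS hη' hf hx]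
  ring

theorem pd_gradient_frame (hS : IsRegular S) {u : E n → ℝ}
    (hp : ContDiffOn ℝ ∞ (gradientWithin u S) S) (he : IsEigenframe u S x e μ) (hx : x ∈ S)
    (hu : ContDiffOn ℝ ∞ u S) (i : Fin n) :
    pd S (e i) (gradientWithin u S) x = μ i • e i := by
  refine ext_inner_right ℝ fun v => ?_
  rw [inner_pd_gradientWithin hS hp hx, pd_comm hS hu hx, he, inner_smul_left, real_inner_comm]
  simp

theorem pd_comp_gradient (hS : IsRegular S) {u : E n → ℝ}
    (hp : ContDiffOn ℝ ∞ (gradientWithin u S) S) (he : IsEigenframe u S x e μ) (hx : x ∈ S)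
    (hu : ContDiffOn ℝ ∞ u S) (hm : MapsTo (gradientWithin u S) S S') {k : E n → ℝ}
    (hk : ContDiffOn ℝ ∞ k S') (i : Fin n) :
    pd S (e i) (fun y => k (gradientWithin u S y)) x =
      μ i * pd S' (e i) k (gradientWithin u S x) := by
  rw [pd_comp hS hp hm hk hx, pd_gradient_frame hS hp he hx hu, pd_smul, smul_eq_mul]

namespace IsSolution

variable {u : E n → ℝ} {c : ℝ}

theorem exists_isFrame (hs : IsSolution Ω Ω' u c) (hΩ : IsUniformlyConvexDomain Ω) (hx : x ∈ Ω) :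
    ∃ e μ, IsFrame (closure Ω) u c x e μ := by
  obtain ⟨e, μ, he, h⟩ := exists_isEigenframe hΩ.isRegular hs.smooth (subset_closure hx)
  exact ⟨e, μ, he, by rw [← h, hs.angle_eq x hx]⟩

/-- In the chain rule the third derivatives of `u` combine to the derivative of `k` along `∑ aᵢ
∂ᵢ∂ᵢ∇u`, which vanishes by the linearized equation. The remaining weights `aᵢμᵢ²` are at most one,
so the result is bounded independently of `u`. -/
theorem linOp_comp_gradient (hs : IsSolution Ω Ω' u c) (hΩ : IsUniformlyConvexDomain Ω)
    (hΩ' : IsUniformlyConvexDomain Ω') (hx : x ∈ Ω) (he : IsFrame (closure Ω) u c x e μ)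
    {k : E n → ℝ} (hk : ContDiffOn ℝ ∞ k (closure Ω')) :
    linOp (closure Ω) e μ (fun y => k (gradientWithin u (closure Ω) y)) x =
      ∑ i, (1 + μ i ^ 2)⁻¹ * μ i ^ 2 * pd (closure Ω') (e i) (pd (closure Ω') (e i) k)
        (gradientWithin u (closure Ω) x) := by
  have hS := hΩ.isRegular
  have hS' := hΩ'.isRegular
  have hp := hs.diffeo.1
  have hx' := subset_closure hx
  have hzero : ∑ i, (1 + μ i ^ 2)⁻¹ •
      pd (closure Ω) (e i) (pd (closure Ω) (e i) (gradientWithin u (closure Ω))) x = 0 := by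
    refine ext_inner_right ℝ fun w => ?_
    rw [sum_inner, inner_zero_left, ← (hs.linearized hΩ hx he.isEigenframe he.angle w).1]
    refine Finset.sum_congr rfl fun i _ => ?_
    rw [inner_smul_left, inner_pd_pd_gradientWithin hS hp hx']
    simp
  have h0 : ∑ i, (1 + μ i ^ 2)⁻¹ * pd (closure Ω') (pd (closure Ω) (e i) (pd (closure Ω) (e i)
      (gradientWithin u (closure Ω))) x) k (gradientWithin u (closure Ω) x) = 0 := by
    have := congrArg (fderivWithin ℝ k (closure Ω') (gradientWithin u (closure Ω) x)) hzero
    simp only [map_sum, map_smul, map_zero, smul_eq_mul] at this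
    exact this
  rw [linOp, ← add_zero (∑ i, _ * pd (closure Ω') (e i) _ _), ← h0, ← Finset.sum_add_distrib]
  refine Finset.sum_congr rfl fun i _ => ?_
  rw [pd_pd_comp hS hS' hp hs.diffeo.2.1 hk hx',
    pd_gradient_frame hS hp he.isEigenframe hx' hs.smooth, pd_smul]
  have h2 : pd (closure Ω') (e i) (pd (closure Ω') (μ i • e i) k)
      (gradientWithin u (closure Ω) x) =
      μ i * pd (closure Ω') (e i) (pd (closure Ω') (e i) k) (gradientWithin u (closure Ω) x) := by
    have hm := hs.diffeo.2.1 hx'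
    rw [pd_pd_eq hS' hk hm, pd_pd_eq hS' hk hm, map_smul, smul_eq_mul]
  rw [h2, smul_eq_mul]
  ring

end IsSolution

/-! ### The maximum principle -/

/-- At an interior maximum all pure second derivatives are nonpositive, which contradicts `0 <
linOp` for any frame with positive weights. Frame and weights may thus change from point to point,
and the inequality is needed only where `f` exceeds `m`. -/
theorem IsUniformlyConvexDomain.le_of_subsolution (hΩ : IsUniformlyConvexDomain Ω)
    (hf : ContDiffOn ℝ ∞ f (closure Ω)) {m : ℝ} (hb : ∀ x ∈ frontier Ω, f x ≤ m)
    (hint : ∀ x ∈ Ω, m < f x → ∃ e μ, 0 < linOp (closure Ω) e μ f x) :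
    ∀ x ∈ closure Ω, f x ≤ m := by
  obtain ⟨x₀, hx₀, hmax⟩ := hΩ.isCompact_closure.exists_isMaxOn
    (hΩ.nonempty.mono subset_closure) hf.continuousOn
  intro x hx
  refine (hmax hx).trans ?_
  by_contra! hlt
  rcases hΩ.mem_or_mem_frontier hx₀ with h | h
  · obtain ⟨e, μ, hpos⟩ := hint x₀ h hlt
    refine hpos.not_ge (Finset.sum_nonpos fun i _ => ?_)
    refine mul_nonpos_of_nonneg_of_nonpos (weight_pos _).le ?_
    refine (hasJet_line hΩ.isRegular hf (by rwa [hΩ.interior_closure]) (e i)).nonpos_of_isLocalMax ?_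
    have hcont : Continuous fun t : ℝ => x₀ + t • e i := by fun_prop
    have h0 : Ω ∈ 𝓝 (x₀ + (0:ℝ) • e i) := by simpa using hΩ.isOpen.mem_nhds h
    filter_upwards [hcont.continuousAt.eventually h0] with t ht
    simpa using hmax (subset_closure ht)
  · exact absurd (hb x₀ h) (not_le.2 hlt)

/-! ### Functions that are controlled by the linearized operator -/

/-- `f`, the linearized operator applied to `f`, and the gradient of `f` measured by the linearized
operator are bounded in terms of `B`. -/
structure IsControlled (Ω : Set (E n)) (u : E n → ℝ) (c : ℝ) (f : E n → ℝ) (B : ℝ) : Prop where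
  smooth : ContDiffOn ℝ ∞ f (closure Ω)
  bound : ∀ x ∈ closure Ω, |f x| ≤ B
  linOp_le : ∀ x ∈ Ω, ∀ e μ, IsFrame (closure Ω) u c x e μ → |linOp (closure Ω) e μ f x| ≤ B
  gradForm_le : ∀ x ∈ Ω, ∀ e μ, IsFrame (closure Ω) u c x e μ →
    gradForm (closure Ω) e μ f f x ≤ B ^ 2

theorem gradForm_self_nonneg : 0 ≤ gradForm S e μ f f x :=
  Finset.sum_nonneg fun _ _ => mul_nonneg (weight_pos _).le (mul_self_nonneg _)

/-- Cauchy–Schwarz, with each weight split into two square roots. -/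
theorem abs_gradForm_le {A B : ℝ} (hA : 0 ≤ A) (hB : 0 ≤ B) (hf : gradForm S e μ f f x ≤ A ^ 2)
    (hg : gradForm S e μ g g x ≤ B ^ 2) : |gradForm S e μ f g x| ≤ A * B := by
  refine abs_le_of_sq_le_sq ?_ (by positivity)
  have h := Finset.sum_mul_sq_le_sq_mul_sq Finset.univ
    (fun i => Real.sqrt (1 + μ i ^ 2)⁻¹ * pd S (e i) f x)
    (fun i => Real.sqrt (1 + μ i ^ 2)⁻¹ * pd S (e i) g x)
  have h1 : ∀ i, Real.sqrt (1 + μ i ^ 2)⁻¹ * Real.sqrt (1 + μ i ^ 2)⁻¹ = (1 + μ i ^ 2)⁻¹ :=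
    fun i => Real.mul_self_sqrt (weight_pos _).le
  have h2 : ∀ a b : Fin n → ℝ, ∀ i, Real.sqrt (1 + μ i ^ 2)⁻¹ * a i *
      (Real.sqrt (1 + μ i ^ 2)⁻¹ * b i) = (1 + μ i ^ 2)⁻¹ * (a i * b i) := fun a b i => by
    linear_combination (a i * b i) * h1 i
  simp only [sq (Real.sqrt _ * _), h2 (fun i => pd S (e i) f x) (fun i => pd S (e i) g x),
    h2 (fun i => pd S (e i) f x) (fun i => pd S (e i) f x),
    h2 (fun i => pd S (e i) g x) (fun i => pd S (e i) g x)] at h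
  refine h.trans ?_
  rw [mul_pow]
  exact mul_le_mul hf hg gradForm_self_nonneg (by positivity)

namespace IsControlled

variable {u : E n → ℝ} {c A B : ℝ}

theorem nonneg (hΩ : IsUniformlyConvexDomain Ω) (hf : IsControlled Ω u c f A) : 0 ≤ A := by
  obtain ⟨x, hx⟩ := hΩ.nonempty
  exact (abs_nonneg _).trans (hf.bound x (subset_closure hx))

theorem mono (hf : IsControlled Ω u c f A) (hA : 0 ≤ A) (h : A ≤ B) : IsControlled Ω u c f B where
  smooth := hf.smooth
  bound x hx := (hf.bound x hx).trans h
  linOp_le x hx e μ he := (hf.linOp_le x hx e μ he).trans h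
  gradForm_le x hx e μ he := (hf.gradForm_le x hx e μ he).trans (by gcongr)

theorem gradForm_add (hS : IsRegular S) (hf : ContDiffOn ℝ ∞ f S) (hg : ContDiffOn ℝ ∞ g S)
    (hx : x ∈ S) : gradForm S e μ (fun y => f y + g y) (fun y => f y + g y) x =
      gradForm S e μ f f x + 2 * gradForm S e μ f g x + gradForm S e μ g g x := by
  simp only [gradForm, Finset.mul_sum, ← Finset.sum_add_distrib]
  refine Finset.sum_congr rfl fun i _ => ?_
  rw [pd_add hS hf hg hx]
  ring

theorem gradForm_mul (hS : IsRegular S) (hf : ContDiffOn ℝ ∞ f S) (hg : ContDiffOn ℝ ∞ g S)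
    (hx : x ∈ S) : gradForm S e μ (fun y => f y * g y) (fun y => f y * g y) x =
      f x ^ 2 * gradForm S e μ g g x + 2 * (f x * g x * gradForm S e μ f g x) +
        g x ^ 2 * gradForm S e μ f f x := by
  simp only [gradForm, Finset.mul_sum, ← Finset.sum_add_distrib]
  refine Finset.sum_congr rfl fun i _ => ?_
  rw [pd_mul hS hf hg hx]
  ring

theorem gradForm_comp (hS : IsRegular S) {η : ℝ → ℝ} (hη : ContDiff ℝ ∞ η)
    (hf : ContDiffOn ℝ ∞ f S) (hx : x ∈ S) :
    gradForm S e μ (fun y => η (f y)) (fun y => η (f y)) x =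
      deriv η (f x) ^ 2 * gradForm S e μ f f x := by
  simp only [gradForm, Finset.mul_sum]
  refine Finset.sum_congr rfl fun i _ => ?_
  rw [pd_comp_real hS hη hf hx]
  ring

theorem add (hΩ : IsUniformlyConvexDomain Ω) (hf : IsControlled Ω u c f A)
    (hg : IsControlled Ω u c g B) : IsControlled Ω u c (fun y => f y + g y) (A + B) where
  smooth := hf.smooth.add hg.smooth
  bound x hx := (abs_add_le _ _).trans (add_le_add (hf.bound x hx) (hg.bound x hx))
  linOp_le x hx e μ he := by
    rw [linOp_add hΩ.isRegular hf.smooth hg.smooth (subset_closure hx)]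
    exact (abs_add_le _ _).trans (add_le_add (hf.linOp_le x hx e μ he) (hg.linOp_le x hx e μ he))
  gradForm_le x hx e μ he := by
    rw [gradForm_add hΩ.isRegular hf.smooth hg.smooth (subset_closure hx)]
    have h1 := hf.gradForm_le x hx e μ he
    have h2 := hg.gradForm_le x hx e μ he
    have h3 := le_of_abs_le (abs_gradForm_le (hf.nonneg hΩ) (hg.nonneg hΩ) h1 h2)
    linarith

theorem const (a : ℝ) : IsControlled Ω u c (fun _ => a) |a| where
  smooth := contDiffOn_const
  bound x hx := le_rfl
  linOp_le x hx e μ he := by rw [linOp_const]; simp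
  gradForm_le x hx e μ he := by simpa [gradForm, pd_const] using sq_nonneg a

/-- The product rule for the operator produces `2 * gradForm f g`, which is why control includes a
gradient bound. The terms contribute `AB + AB + 2AB`, whence the factor `4`. -/
theorem mul (hΩ : IsUniformlyConvexDomain Ω) (hf : IsControlled Ω u c f A)
    (hg : IsControlled Ω u c g B) : IsControlled Ω u c (fun y => f y * g y) (4 * (A * B)) := by
  have hA := hf.nonneg hΩ
  have hB := hg.nonneg hΩ
  refine ⟨hf.smooth.mul hg.smooth, fun x hx => ?_, fun x hx e μ he => ?_, fun x hx e μ he => ?_⟩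
  · rw [abs_mul]
    have := mul_le_mul (hf.bound x hx) (hg.bound x hx) (abs_nonneg _) hA
    nlinarith [mul_nonneg hA hB]
  · have hx' := subset_closure hx
    rw [linOp_mul hΩ.isRegular hf.smooth hg.smooth hx']
    have h1 := abs_gradForm_le hA hB (hf.gradForm_le x hx e μ he) (hg.gradForm_le x hx e μ he)
    have h2 := mul_le_mul (hf.bound x hx') (hg.linOp_le x hx e μ he) (abs_nonneg _) hA
    have h3 := mul_le_mul (hg.bound x hx') (hf.linOp_le x hx e μ he) (abs_nonneg _) hB
    rw [← abs_mul] at h2 h3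
    refine (abs_add_three _ _ _).trans ?_
    rw [abs_mul 2, abs_two]
    linarith
  · have hx' := subset_closure hx
    rw [gradForm_mul hΩ.isRegular hf.smooth hg.smooth hx']
    have h1 := abs_gradForm_le hA hB (hf.gradForm_le x hx e μ he) (hg.gradForm_le x hx e μ he)
    have h2 : f x ^ 2 ≤ A ^ 2 := sq_le_sq' (abs_le.1 (hf.bound x hx')).1 (abs_le.1 (hf.bound x hx')).2
    have h3 : g x ^ 2 ≤ B ^ 2 := sq_le_sq' (abs_le.1 (hg.bound x hx')).1 (abs_le.1 (hg.bound x hx')).2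
    have h4 := mul_le_mul h2 (hg.gradForm_le x hx e μ he) gradForm_self_nonneg (sq_nonneg A)
    have h5 := mul_le_mul h3 (hf.gradForm_le x hx e μ he) gradForm_self_nonneg (sq_nonneg B)
    have h6 : f x * g x * gradForm (closure Ω) e μ f g x ≤ A * B * (A * B) := by
      refine (le_abs_self _).trans ?_
      rw [abs_mul, abs_mul]
      gcongr
      exacts [hf.bound x hx', hg.bound x hx']
    nlinarith [mul_nonneg hA hB, sq_nonneg (A * B)]

theorem sum (hΩ : IsUniformlyConvexDomain Ω) {ι : Type*} (s : Finset ι) {f : ι → E n → ℝ}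
    (hf : ∀ i, IsControlled Ω u c (f i) A) :
    IsControlled Ω u c (fun y => ∑ i ∈ s, f i y) (s.card * A) := by
  classical
  induction s using Finset.induction_on with
  | empty => simpa using const (Ω := Ω) (u := u) (c := c) 0
  | insert i s hi ih =>
    simp only [Finset.sum_insert hi, Finset.card_insert_of_notMem hi]
    convert! (hf i).add hΩ ih using 1
    push_cast; ring

theorem comp (hΩ : IsUniformlyConvexDomain Ω) {η : ℝ → ℝ} (hη : ContDiff ℝ ∞ η) {N : ℝ}
    (h0 : ∀ s ∈ Icc (-A) A, |η s| ≤ N) (h1 : ∀ s ∈ Icc (-A) A, |deriv η s| ≤ N)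
    (h2 : ∀ s ∈ Icc (-A) A, |deriv (deriv η) s| ≤ N) (hf : IsControlled Ω u c f A) :
    IsControlled Ω u c (fun y => η (f y)) (N * (1 + A + A ^ 2)) := by
  have hA := hf.nonneg hΩ
  have hN : 0 ≤ N := (abs_nonneg _).trans (h0 0 ⟨by linarith, hA⟩)
  have hmem : ∀ x ∈ closure Ω, f x ∈ Icc (-A) A := fun x hx => abs_le.1 (hf.bound x hx)
  refine ⟨hη.comp_contDiffOn hf.smooth, fun x hx => ?_, fun x hx e μ he => ?_,
    fun x hx e μ he => ?_⟩
  · refine (h0 _ (hmem x hx)).trans ?_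
    nlinarith [mul_nonneg hN hA, mul_nonneg hN (sq_nonneg A)]
  · have hx' := subset_closure hx
    rw [linOp_comp hΩ.isRegular hη hf.smooth hx']
    refine (abs_add_le _ _).trans ?_
    rw [abs_mul, abs_mul, abs_of_nonneg gradForm_self_nonneg]
    have h3 := mul_le_mul (h2 _ (hmem x hx')) (hf.gradForm_le x hx e μ he) gradForm_self_nonneg hN
    have h4 := mul_le_mul (h1 _ (hmem x hx')) (hf.linOp_le x hx e μ he) (abs_nonneg _) hN
    nlinarith
  · have hx' := subset_closure hx
    rw [gradForm_comp hΩ.isRegular hη hf.smooth hx']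
    have h3 : deriv η (f x) ^ 2 ≤ N ^ 2 :=
      sq_le_sq' (abs_le.1 (h1 _ (hmem x hx'))).1 (abs_le.1 (h1 _ (hmem x hx'))).2
    have h4 := mul_le_mul h3 (hf.gradForm_le x hx e μ he) gradForm_self_nonneg (sq_nonneg N)
    refine h4.trans ?_
    rw [← mul_pow]
    have : N * A ≤ N * (1 + A + A ^ 2) := by gcongr; nlinarith [sq_nonneg A]
    gcongr

end IsControlled

end

section
variable {n : ℕ} {S S' Ω Ω' : Set (E n)}
variable {e : OrthonormalBasis (Fin n) ℝ (E n)} {μ : Fin n → ℝ} {f g : E n → ℝ} {x : E n}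

/-! ### First-order conditions at the boundary -/

theorem pd_nonpos_of_isMaxOn {v : E n} (hmax : ∀ y ∈ S, f y ≤ f x)
    (hv : ∀ᶠ t : ℝ in 𝓝[>] 0, x + t • v ∈ S) : pd S v f x ≤ 0 := by
  have h : IsLocalMaxOn f S x := by
    filter_upwards [self_mem_nhdsWithin] with y hy using hmax y hy
  exact h.fderivWithin_nonpos (mem_posTangentConeAt_of_frequently_mem hv.frequently)

/-- A Lagrange multiplier rule. By a limit `ℓ ≤ 0` holds on the kernel of `m` too, so by linearity
`ℓ` vanishes there and is a multiple of `m`; the value at `v₀` fixes the sign. -/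
theorem exists_nonneg_smul_of_halfspace {ℓ m : E n →L[ℝ] ℝ} {v₀ : E n} (h₀ : m v₀ < 0)
    (h : ∀ v, m v < 0 → ℓ v ≤ 0) : ∃ s : ℝ, 0 ≤ s ∧ ∀ v, ℓ v = s * m v := by
  have hker : ∀ w, m w = 0 → ℓ w ≤ 0 := by
    intro w hw
    by_contra! hpos
    -- The tilt towards `v₀` is so small that it changes `ℓ w` by at most half of its value.
    have h1 := h (w + (ℓ w / (2 * (|ℓ v₀| + 1))) • v₀) (by
      rw [map_add, map_smul, hw, zero_add, smul_eq_mul]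
      exact mul_neg_of_pos_of_neg (by positivity) h₀)
    rw [map_add, map_smul, smul_eq_mul] at h1
    have h2 : ℓ w / (2 * (|ℓ v₀| + 1)) * -ℓ v₀ ≤ ℓ w / (2 * (|ℓ v₀| + 1)) * (|ℓ v₀| + 1) := by
      gcongr
      linarith [neg_abs_le (ℓ v₀)]
    have h3 : ℓ w / (2 * (|ℓ v₀| + 1)) * (|ℓ v₀| + 1) = ℓ w / 2 := by
      field_simp
    linarith
  refine ⟨ℓ v₀ / m v₀, div_nonneg_of_nonpos (h v₀ h₀) h₀.le, fun v => ?_⟩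
  have hw : m (v - (m v / m v₀) • v₀) = 0 := by
    rw [map_sub, map_smul, smul_eq_mul, div_mul_cancel₀ _ h₀.ne, sub_self]
  have h1 := hker _ hw
  have h2 := hker (-(v - (m v / m v₀) • v₀)) (by rw [map_neg, hw, neg_zero])
  rw [map_neg] at h2
  have h3 : ℓ (v - (m v / m v₀) • v₀) = 0 := by linarith
  rw [map_sub, map_smul, smul_eq_mul, sub_eq_zero] at h3
  rw [h3]
  ring

/-! ### Barriers -/

/-- A boundary defining function with quantitative bounds which is uniformly convex near the
boundary. -/
structure IsBarrier (Ω : Set (E n)) (h : E n → ℝ) (θ K γ δ : ℝ) : Prop where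
  smooth : ContDiffOn ℝ ∞ h (closure Ω)
  eq_zero : ∀ x ∈ frontier Ω, h x = 0
  nonpos : ∀ x ∈ closure Ω, h x ≤ 0
  neg_le : ∀ x ∈ closure Ω, -K ≤ h x
  pd_le : ∀ x ∈ closure Ω, ∀ v, |pd (closure Ω) v h x| ≤ K * ‖v‖
  pd_pd_le : ∀ x ∈ closure Ω, ∀ v w,
    |pd (closure Ω) v (pd (closure Ω) w h) x| ≤ K * ‖v‖ * ‖w‖
  pd_pd_pd_le : ∀ x ∈ closure Ω, ∀ v w,
    |pd (closure Ω) v (pd (closure Ω) v (pd (closure Ω) w h)) x| ≤ K * ‖v‖ ^ 2 * ‖w‖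
  hess_ge : ∀ x ∈ closure Ω, -δ < h x → ∀ w,
    θ * ‖w‖ ^ 2 ≤ pd (closure Ω) w (pd (closure Ω) w h) x
  gradient_ge : ∀ x ∈ frontier Ω, γ ≤ ‖gradientWithin h (closure Ω) x‖
  inward : ∀ x ∈ frontier Ω, ∀ v, pd (closure Ω) v h x < 0 → ∀ᶠ t : ℝ in 𝓝[>] 0, x + t • v ∈ Ω
  tangent : ∀ x ∈ frontier Ω, ∀ w ∈ boundaryTangentSpace Ω x, pd (closure Ω) w h x = 0

/-- The quantities on which the constants in the estimates depend. -/
structure Bounds where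
  (θ K γ δ D r : ℝ)
  θ_pos : 0 < θ
  K_pos : 0 < K
  γ_pos : 0 < γ
  δ_pos : 0 < δ
  D_pos : 0 < D
  r_pos : 0 < r

/-- A solution of `(⋆)` together with barriers for both domains. -/
structure IsConfiguration (P : Bounds) (Ω Ω' : Set (E n)) (h h' u : E n → ℝ) (c : ℝ) : Prop where
  dom : IsUniformlyConvexDomain Ω
  dom' : IsUniformlyConvexDomain Ω'
  bar : IsBarrier Ω h P.θ P.K P.γ P.δ
  bar' : IsBarrier Ω' h' P.θ P.K P.γ P.δ
  sol : IsSolution Ω Ω' u c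
  norm_sub_le : ∀ x ∈ closure Ω, ∀ y ∈ closure Ω, ‖x - y‖ ≤ P.D
  norm_sub_le' : ∀ x ∈ closure Ω', ∀ y ∈ closure Ω', ‖x - y‖ ≤ P.D
  le_norm_sub : ∃ x ∈ Ω, ∃ y ∈ Ω, P.r ≤ ‖x - y‖

theorem exists_mvt (hΩ : IsUniformlyConvexDomain Ω) (hf : ContDiffOn ℝ ∞ f (closure Ω)) {x y : E n}
    (hx : x ∈ Ω) (hy : y ∈ Ω) : ∃ z ∈ Ω, f y - f x = pd (closure Ω) (y - x) f z := by
  obtain ⟨z, hz, h⟩ := domain_mvt (s := Ω) (f' := fun z => fderivWithin ℝ f (closure Ω) z)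
    (fun z hz => (differentiableWithinAt_of_smooth hf
      (subset_closure hz)).hasFDerivWithinAt.mono subset_closure) hΩ.convex hx hy
  exact ⟨z, hΩ.convex.segment_subset hx hy hz, h⟩

variable {P : Bounds} {h h' u : E n → ℝ} {c : ℝ}

namespace IsConfiguration

theorem dim_pos (H : IsConfiguration P Ω Ω' h h' u c) : 0 < n := by
  rcases Nat.eq_zero_or_pos n with rfl | hn
  · have := H.sol.const_mem
    simp at this
  · exact hn

theorem mapsTo (H : IsConfiguration P Ω Ω' h h' u c) :
    MapsTo (gradientWithin u (closure Ω)) (closure Ω) (closure Ω') := H.sol.diffeo.2.1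

/-- Somewhere in the domain the Hessian has a controlled eigenvalue. -/
theorem exists_eigenvalue_le (H : IsConfiguration P Ω Ω' h h' u c) :
    ∃ x ∈ Ω, ∃ e μ, IsFrame (closure Ω) u c x e μ ∧ ∃ i, μ i ≤ P.D / P.r + 1 := by
  by_contra! hcon
  -- If all eigenvalues exceeded `D/r + 1` everywhere, `∇u` would move the endpoints of a segment of
  -- length at least `r` further apart than the diameter bound `D` of the target allows.
  obtain ⟨x, hx, y, hy, hxy⟩ := H.le_norm_sub
  have hS := H.dom.isRegular
  obtain ⟨z, hz, hmvt⟩ := exists_mvt H.dom (contDiffOn_pd hS H.sol.smooth (x - y)) hy hx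
  obtain ⟨e, μ, he⟩ := H.sol.exists_isFrame H.dom hz
  have h1 : (P.D / P.r + 1) * ‖x - y‖ ^ 2 ≤
      pd (closure Ω) (x - y) (pd (closure Ω) (x - y) u) z := by
    rw [pd_pd_eq_sum_frame hS H.sol.smooth (subset_closure hz) he.isEigenframe, ← sum_sq_inner e,
      Finset.mul_sum]
    refine Finset.sum_le_sum fun i _ => ?_
    rw [← sq]
    exact mul_le_mul_of_nonneg_right (hcon z hz e μ he i).le (sq_nonneg _)
  rw [← hmvt, ← inner_gradientWithin, ← inner_gradientWithin, ← inner_sub_left] at h1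
  have h2 := h1.trans (real_inner_le_norm _ _)
  have h3 := H.norm_sub_le' _ (H.mapsTo (subset_closure hx)) _ (H.mapsTo (subset_closure hy))
  have hpos : 0 < ‖x - y‖ := P.r_pos.trans_le hxy
  have h4 : (P.D / P.r + 1) * ‖x - y‖ ≤ P.D := by
    have : (P.D / P.r + 1) * ‖x - y‖ * ‖x - y‖ ≤ P.D * ‖x - y‖ := by nlinarith
    exact le_of_mul_le_mul_right this hpos
  have h5 : (P.D / P.r + 1) * P.r ≤ (P.D / P.r + 1) * ‖x - y‖ := by
    have := P.D_pos; have := P.r_pos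
    gcongr
  have h6 : (P.D / P.r + 1) * P.r = P.D + P.r := by
    have := P.r_pos.ne'
    field_simp
  linarith [P.r_pos]

end IsConfiguration

/-- One controlled eigenvalue at one point keeps the constant `c` a definite amount below `nπ/2`.
Since `c` is the same everywhere, each point must then have a controlled eigenvalue, and its weight
bounds the trace from below. -/
theorem exists_trace_bound (n : ℕ) (P : Bounds) : ∃ τ : ℝ, 0 < τ ∧
    ∀ {Ω Ω' : Set (E n)} {h h' u : E n → ℝ} {c : ℝ}, IsConfiguration P Ω Ω' h h' u c →
      ∀ x ∈ Ω, ∀ e μ, IsFrame (closure Ω) u c x e μ → τ ≤ ∑ i, (1 + μ i ^ 2)⁻¹ := by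
  set R := P.D / P.r + 1 with hR
  -- The gap below `nπ/2`, shared equally among the `n` eigenvalues.
  set β := (π / 2 - Real.arctan R) / n with hβ
  refine ⟨(1 + Real.tan (π / 2 - β) ^ 2)⁻¹, weight_pos _, ?_⟩
  intro Ω Ω' h h' u c H x hx e μ he
  have hn : (0:ℝ) < n := Nat.cast_pos.2 H.dim_pos
  have hn1 : (1:ℝ) ≤ n := Nat.one_le_cast.2 H.dim_pos
  have hRpos : 0 < R := by have := P.D_pos; have := P.r_pos; positivity
  have hat : 0 < Real.arctan R := by simpa using Real.arctan_strictMono hRpos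
  have hat' := Real.arctan_lt_pi_div_two R
  have hβ0 : 0 < β := div_pos (by linarith) hn
  have hβ1 : β ≤ π / 2 - Real.arctan R := div_le_self (by linarith) hn1
  obtain ⟨y, hy, e', μ', he', j, hj⟩ := H.exists_eigenvalue_le
  have hc : c ≤ n * (π / 2 - β) := by
    have h1 : c ≤ ∑ i : Fin n, if i = j then Real.arctan R else π / 2 := by
      rw [← he'.angle]
      refine Finset.sum_le_sum fun i _ => ?_
      split_ifs with hi
      · exact Real.arctan_strictMono.monotone (hi ▸ hj)
      · exact (Real.arctan_lt_pi_div_two _).le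
    have h2 : (∑ i : Fin n, if i = j then Real.arctan R else π / 2) =
        n * (π / 2) - (π / 2 - Real.arctan R) := by
      have : ∀ i : Fin n, (if i = j then Real.arctan R else π / 2) =
          π / 2 - if i = j then (π / 2 - Real.arctan R) else 0 := fun i => by
        split_ifs <;> ring
      simp [this, Finset.sum_sub_distrib]
    have h3 : n * β = π / 2 - Real.arctan R := by rw [hβ]; field_simp
    rw [mul_sub, h3]
    linarith
  -- Some summand is at most the average `c / n`.
  obtain ⟨i, -, hi⟩ : ∃ i ∈ Finset.univ, Real.arctan (μ i) ≤ π / 2 - β := by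
    apply Finset.exists_le_of_sum_le
    · exact ⟨⟨0, H.dim_pos⟩, Finset.mem_univ _⟩
    · rw [he.angle, Finset.sum_const, Finset.card_univ, Fintype.card_fin, nsmul_eq_mul]
      exact hc
  have hμ0 := H.sol.eigenvalue_nonneg H.dom (subset_closure hx) he.isEigenframe i
  have hμ : μ i ≤ Real.tan (π / 2 - β) := by
    rw [← Real.arctan_strictMono.le_iff_le, Real.arctan_tan (by linarith) (by linarith)]
    exact hi
  calc (1 + Real.tan (π / 2 - β) ^ 2)⁻¹ ≤ (1 + μ i ^ 2)⁻¹ := by gcongr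
    _ ≤ _ := Finset.single_le_sum (fun j _ => (weight_pos (μ j)).le) (Finset.mem_univ i)

/-- Functions that are almost subsolutions are bounded by a multiple of the barrier. -/
theorem exists_barrier_bound (n : ℕ) (P : Bounds) : ∃ C : ℝ, 0 < C ∧
    ∀ {Ω Ω' : Set (E n)} {h h' u : E n → ℝ} {c : ℝ}, IsConfiguration P Ω Ω' h h' u c →
      ∀ (f : E n → ℝ) (N : ℝ), 0 < N → ContDiffOn ℝ ∞ f (closure Ω) → (∀ x ∈ frontier Ω, f x ≤ 0) →
      (∀ x ∈ Ω, f x ≤ N) →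
      (∀ x ∈ Ω, ∀ e μ, IsFrame (closure Ω) u c x e μ → -N ≤ linOp (closure Ω) e μ f x) →
      ∀ x ∈ closure Ω, f x + C * N * h x ≤ 0 := by
  obtain ⟨τ, hτ, Hτ⟩ := exists_trace_bound n P
  have hθ := P.θ_pos
  have hδ := P.δ_pos
  -- The first summand makes `C N Lh ≥ 2N` outweigh `Lf ≥ -N`; the second makes `Cδ ≥ 1`.
  refine ⟨2 / (P.θ * τ) + 1 / P.δ, by positivity, ?_⟩
  set C := 2 / (P.θ * τ) + 1 / P.δ with hC
  have hC0 : 0 < C := by positivity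
  have hC1 : 2 ≤ C * (P.θ * τ) := by
    have : C * (P.θ * τ) = 2 + P.θ * τ / P.δ := by rw [hC]; field_simp
    rw [this]; linarith [show 0 < P.θ * τ / P.δ by positivity]
  have hC2 : 1 ≤ C * P.δ := by
    have : C * P.δ = 2 * P.δ / (P.θ * τ) + 1 := by rw [hC]; field_simp
    rw [this]; linarith [show 0 < 2 * P.δ / (P.θ * τ) by positivity]
  intro Ω Ω' h h' u c H f N hN hf hb hfN hL
  have hS := H.dom.isRegular
  have hh : ContDiffOn ℝ ∞ (fun y => C * N * h y) (closure Ω) := contDiffOn_const.mul H.bar.smooth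
  refine H.dom.le_of_subsolution (hf.add hh) (fun x hx => ?_) (fun x hx hpos => ?_)
  · rw [H.bar.eq_zero x hx]; simpa using hb x hx
  · obtain ⟨e, μ, he⟩ := H.sol.exists_isFrame H.dom hx
    have hx' := subset_closure hx
    refine ⟨e, μ, ?_⟩
    rw [linOp_add hS hf hh hx', linOp_const_mul hS _ H.bar.smooth hx']
    -- Where `f + C N h > 0`, the bound `f ≤ N` forces `h` above `-δ`, into the region where `h` is
    -- uniformly convex. Elsewhere nothing has to be checked.
    have h1 : -P.δ < h x := by
      have h2 := hfN x hx
      by_contra! h3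
      have : C * N * h x ≤ C * N * (-P.δ) := by gcongr
      nlinarith
    have h2 : P.θ * τ ≤ linOp (closure Ω) e μ h x := by
      calc P.θ * τ ≤ P.θ * ∑ i, (1 + μ i ^ 2)⁻¹ := by gcongr; exact Hτ H x hx e μ he
        _ ≤ _ := by
          rw [Finset.mul_sum]
          refine Finset.sum_le_sum fun i _ => ?_
          have := H.bar.hess_ge x hx' h1 (e i)
          rw [e.norm_eq_one] at this
          rw [mul_comm]
          refine mul_le_mul_of_nonneg_left ?_ (weight_pos _).le
          linarith
    have h3 := hL x hx e μ he
    have h4 : C * N * (P.θ * τ) ≤ C * N * linOp (closure Ω) e μ h x := by gcongr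
    nlinarith

/-! ### The basic controlled functions -/

/-- As `n ≥ 1`, the sum `n B²` is at most `(n B)²`, so a single constant serves for all three bounds
of `IsControlled`. -/
theorem gradForm_le_of_pd_le {B : ℝ} (hn : 0 < n)
    (hb : ∀ i, (1 + μ i ^ 2)⁻¹ * (pd S (e i) f x) ^ 2 ≤ B ^ 2) :
    gradForm S e μ f f x ≤ (n * B) ^ 2 := by
  calc gradForm S e μ f f x ≤ ∑ _i : Fin n, B ^ 2 :=
        Finset.sum_le_sum fun i _ => by rw [← sq]; exact hb i
    _ = n * B ^ 2 := by simp
    _ ≤ _ := by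
      have hn1 : (1:ℝ) ≤ n := Nat.one_le_cast.2 hn
      rw [mul_pow]
      exact mul_le_mul_of_nonneg_right (by nlinarith) (sq_nonneg B)

theorem abs_sum_le_card_mul {B : ℝ} {F : Fin n → ℝ} (hF : ∀ i, |F i| ≤ B) :
    |∑ i, F i| ≤ n * B := by
  refine (Finset.abs_sum_le_sum_abs _ _).trans ?_
  calc ∑ i, |F i| ≤ ∑ _i : Fin n, B := Finset.sum_le_sum fun i _ => hF i
    _ = n * B := by simp

namespace IsConfiguration

theorem controlled_pd (H : IsConfiguration P Ω Ω' h h' u c) {w : E n} (hw : ‖w‖ = 1) :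
    IsControlled Ω u c (pd (closure Ω) w h) (n * P.K) := by
  have hS := H.dom.isRegular
  have hK := P.K_pos
  have hn1 : (1:ℝ) ≤ n := Nat.one_le_cast.2 H.dim_pos
  refine ⟨contDiffOn_pd hS H.bar.smooth w, fun x hx => ?_, fun x hx e μ he => ?_,
    fun x hx e μ he => gradForm_le_of_pd_le H.dim_pos fun i => ?_⟩
  · refine (H.bar.pd_le x hx w).trans ?_
    rw [hw]; nlinarith
  · refine abs_sum_le_card_mul fun i => ?_
    have := H.bar.pd_pd_pd_le x (subset_closure hx) (e i) w
    rw [hw, e.norm_eq_one] at this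
    rw [abs_mul, abs_of_pos (weight_pos _)]
    have := mul_le_mul (weight_le_one (μ i)) this (abs_nonneg _) zero_le_one
    simpa using this
  · have := H.bar.pd_pd_le x (subset_closure hx) (e i) w
    rw [hw, e.norm_eq_one] at this
    have h2 : (pd (closure Ω) (e i) (pd (closure Ω) w h) x) ^ 2 ≤ P.K ^ 2 := by
      refine sq_le_sq' ?_ ?_ <;> linarith [abs_le.1 this]
    have := mul_le_mul (weight_le_one (μ i)) h2 (sq_nonneg _) zero_le_one
    simpa using this

/-- Each derivative of `∇u` along `e i` costs a factor `μ i`. Both the operator and the gradient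
form contain two of them, and `aᵢμᵢ² ≤ 1` absorbs these. -/
theorem controlled_pd_comp (H : IsConfiguration P Ω Ω' h h' u c) {w : E n} (hw : ‖w‖ = 1) :
    IsControlled Ω u c (fun y => pd (closure Ω') w h' (gradientWithin u (closure Ω) y))
      (n * P.K) := by
  have hS := H.dom.isRegular
  have hS' := H.dom'.isRegular
  have hK := P.K_pos
  have hn1 : (1:ℝ) ≤ n := Nat.one_le_cast.2 H.dim_pos
  have hk := contDiffOn_pd hS' H.bar'.smooth w
  have hp := H.sol.diffeo.1
  refine ⟨hk.comp hp H.mapsTo, fun x hx => ?_, fun x hx e μ he => ?_,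
    fun x hx e μ he => gradForm_le_of_pd_le H.dim_pos fun i => ?_⟩
  · refine (H.bar'.pd_le _ (H.mapsTo hx) w).trans ?_
    rw [hw]; nlinarith
  · rw [H.sol.linOp_comp_gradient H.dom H.dom' hx he hk]
    refine abs_sum_le_card_mul fun i => ?_
    have := H.bar'.pd_pd_pd_le _ (H.mapsTo (subset_closure hx)) (e i) w
    rw [hw, e.norm_eq_one] at this
    rw [abs_mul, abs_of_nonneg (mul_nonneg (weight_pos _).le (sq_nonneg _))]
    have := mul_le_mul (weight_mul_sq_le_one (μ i)) this (abs_nonneg _) zero_le_one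
    simpa using this
  · have := H.bar'.pd_pd_le _ (H.mapsTo (subset_closure hx)) (e i) w
    rw [hw, e.norm_eq_one] at this
    rw [pd_comp_gradient hS hp he.isEigenframe (subset_closure hx) H.sol.smooth H.mapsTo hk,
      mul_pow, ← mul_assoc]
    have h2 : (pd (closure Ω') (e i) (pd (closure Ω') w h')
        (gradientWithin u (closure Ω) x)) ^ 2 ≤ P.K ^ 2 := by
      refine sq_le_sq' ?_ ?_ <;> linarith [abs_le.1 this]
    have := mul_le_mul (weight_mul_sq_le_one (μ i)) h2 (sq_nonneg _) zero_le_one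
    simpa using this

end IsConfiguration

end

section
variable {n : ℕ} {S S' Ω Ω' : Set (E n)}
variable {e : OrthonormalBasis (Fin n) ℝ (E n)} {μ : Fin n → ℝ} {f g : E n → ℝ} {x : E n}
variable {P : Bounds} {h h' u : E n → ℝ} {c : ℝ}

/-! ### The boundary condition -/

/-- The composition of the defining function of the target with the gradient map. -/
noncomputable def targetDefining (Ω : Set (E n)) (h' u : E n → ℝ) (x : E n) : ℝ :=
  h' (gradientWithin u (closure Ω) x)

/-- The gradient of the defining function of the target at the image point. -/
noncomputable def targetNormal (Ω Ω' : Set (E n)) (h' u : E n → ℝ) (x : E n) : E n :=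
  gradientWithin h' (closure Ω') (gradientWithin u (closure Ω) x)

/-- The `k`-th component of the gradient of the defining function of the target at the image
point. -/
noncomputable def targetNormalComp (Ω Ω' : Set (E n)) (h' u : E n → ℝ) (w x : E n) : ℝ :=
  pd (closure Ω') w h' (gradientWithin u (closure Ω) x)

/-- The inner product of the gradients of both defining functions. -/
noncomputable def obliqueness (Ω Ω' : Set (E n)) (h h' u : E n → ℝ) (x : E n) : ℝ :=
  ∑ k, pd (closure Ω) (EuclideanSpace.single k 1) h x *
    targetNormalComp Ω Ω' h' u (EuclideanSpace.single k 1) x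

theorem inner_targetNormal (w x : E n) :
    inner ℝ (targetNormal Ω Ω' h' u x) w = targetNormalComp Ω Ω' h' u w x :=
  inner_gradientWithin _ _ _

theorem pd_eq_sum_single (v : E n) (f : E n → ℝ) (x : E n) :
    pd S v f x = ∑ k, v k * pd S (EuclideanSpace.single k 1) f x := by
  conv_lhs => rw [pd, euclidean_eq_sum v]
  simp [map_sum, pd]

theorem targetNormal_apply (x : E n) (k : Fin n) :
    targetNormal Ω Ω' h' u x k = targetNormalComp Ω Ω' h' u (EuclideanSpace.single k 1) x := by
  rw [← inner_targetNormal]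
  simp [EuclideanSpace.inner_single_right]

theorem pd_targetNormal (x : E n) :
    pd (closure Ω) (targetNormal Ω Ω' h' u x) h x = obliqueness Ω Ω' h h' u x := by
  rw [pd_eq_sum_single, obliqueness]
  exact Finset.sum_congr rfl fun k _ => by rw [targetNormal_apply, mul_comm]

theorem norm_single_one (k : Fin n) : ‖(EuclideanSpace.single k 1 : E n)‖ = 1 := by simp

namespace IsConfiguration

theorem contDiffOn_targetDefining (H : IsConfiguration P Ω Ω' h h' u c) :
    ContDiffOn ℝ ∞ (targetDefining Ω h' u) (closure Ω) :=
  H.bar'.smooth.comp H.sol.diffeo.1 H.mapsTo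

theorem contDiffOn_targetNormalComp (H : IsConfiguration P Ω Ω' h h' u c) (w : E n) :
    ContDiffOn ℝ ∞ (targetNormalComp Ω Ω' h' u w) (closure Ω) :=
  (contDiffOn_pd H.dom'.isRegular H.bar'.smooth w).comp H.sol.diffeo.1 H.mapsTo

theorem contDiffOn_obliqueness (H : IsConfiguration P Ω Ω' h h' u c) :
    ContDiffOn ℝ ∞ (obliqueness Ω Ω' h h' u) (closure Ω) :=
  ContDiffOn.sum fun _ _ => (contDiffOn_pd H.dom.isRegular H.bar.smooth _).mul
    (H.contDiffOn_targetNormalComp _)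

theorem targetDefining_eq_zero (H : IsConfiguration P Ω Ω' h h' u c) (hx : x ∈ frontier Ω) :
    targetDefining Ω h' u x = 0 :=
  H.bar'.eq_zero _ (H.sol.gradient_mem_frontier H.dom H.dom' hx)

theorem targetDefining_nonpos (H : IsConfiguration P Ω Ω' h h' u c) (hx : x ∈ closure Ω) :
    targetDefining Ω h' u x ≤ 0 := H.bar'.nonpos _ (H.mapsTo hx)

/-- Chain rule: `d(h' ∘ ∇u) = D²u(·, b)`, where the vector `b` is held fixed at its value at `x`.
This links the boundary condition to the Hessian. -/
theorem pd_targetDefining (H : IsConfiguration P Ω Ω' h h' u c) (hx : x ∈ closure Ω) (w : E n) :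
    pd (closure Ω) w (targetDefining Ω h' u) x =
      pd (closure Ω) w (pd (closure Ω) (targetNormal Ω Ω' h' u x) u) x := by
  have hS := H.dom.isRegular
  have hp := H.sol.diffeo.1
  rw [← inner_pd_gradientWithin hS hp hx, real_inner_comm, inner_targetNormal]
  exact pd_comp hS hp H.mapsTo H.bar'.smooth hx w

theorem norm_targetNormal_le (H : IsConfiguration P Ω Ω' h h' u c) (hx : x ∈ closure Ω) :
    ‖targetNormal Ω Ω' h' u x‖ ≤ P.K := by
  have := H.bar'.pd_le _ (H.mapsTo hx) (targetNormal Ω Ω' h' u x)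
  rw [← inner_gradientWithin] at this
  change |inner ℝ (targetNormal Ω Ω' h' u x) (targetNormal Ω Ω' h' u x)| ≤ _ at this
  rw [real_inner_self_eq_norm_sq, abs_of_nonneg (sq_nonneg _)] at this
  by_contra! hlt
  nlinarith [P.K_pos]

theorem le_norm_targetNormal (H : IsConfiguration P Ω Ω' h h' u c) (hx : x ∈ frontier Ω) :
    P.γ ≤ ‖targetNormal Ω Ω' h' u x‖ :=
  H.bar'.gradient_ge _ (H.sol.gradient_mem_frontier H.dom H.dom' hx)

theorem controlled_obliqueness (H : IsConfiguration P Ω Ω' h h' u c) :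
    IsControlled Ω u c (obliqueness Ω Ω' h h' u) (n * (4 * (n * P.K * (n * P.K)))) := by
  have := IsControlled.sum H.dom Finset.univ fun k =>
    (H.controlled_pd (norm_single_one k)).mul H.dom (H.controlled_pd_comp (norm_single_one k))
  simp only [Finset.card_univ, Fintype.card_fin] at this
  exact this

theorem exists_pd_neg (H : IsConfiguration P Ω Ω' h h' u c) (hx : x ∈ frontier Ω) :
    ∃ v, pd (closure Ω) v h x < 0 := by
  refine ⟨-gradientWithin h (closure Ω) x, ?_⟩
  rw [← inner_gradientWithin, inner_neg_right, real_inner_self_eq_norm_sq]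
  have := H.bar.gradient_ge x hx
  nlinarith [P.γ_pos]

theorem inward_closure (H : IsConfiguration P Ω Ω' h h' u c) (hx : x ∈ frontier Ω) {v : E n}
    (hv : pd (closure Ω) v h x < 0) : ∀ᶠ t : ℝ in 𝓝[>] 0, x + t • v ∈ closure Ω := by
  filter_upwards [H.bar.inward x hx v hv] with t ht using subset_closure ht

end IsConfiguration

/-- The normal derivative of `h' ∘ ∇u` is bounded. -/
theorem exists_normal_bound (n : ℕ) (P : Bounds) : ∃ C : ℝ, 0 < C ∧
    ∀ {Ω Ω' : Set (E n)} {h h' u : E n → ℝ} {c : ℝ}, IsConfiguration P Ω Ω' h h' u c →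
      ∀ x ∈ frontier Ω, ∃ s, 0 ≤ s ∧ s ≤ C ∧
        ∀ v, pd (closure Ω) v (targetDefining Ω h' u) x = s * pd (closure Ω) v h x := by
  obtain ⟨C, hC, HC⟩ := exists_barrier_bound n P
  have hK := P.K_pos
  refine ⟨C * ((n + 1) * P.K), by positivity, ?_⟩
  intro Ω Ω' h h' u c H x hx
  have hS := H.dom.isRegular
  have hx' := frontier_subset_closure hx
  have hT := H.contDiffOn_targetDefining
  obtain ⟨v₀, hv₀⟩ := H.exists_pd_neg hx
  -- `h' ∘ ∇u` is nonpositive and vanishes at `x`, so its derivative is nonpositive in every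
  -- direction where `h` decreases, since such directions enter the domain.
  obtain ⟨s, hs, hsv⟩ := exists_nonneg_smul_of_halfspace
    (ℓ := fderivWithin ℝ (targetDefining Ω h' u) (closure Ω) x)
    (m := fderivWithin ℝ h (closure Ω) x) hv₀ fun v hv =>
      pd_nonpos_of_isMaxOn (fun y hy => by
        rw [H.targetDefining_eq_zero hx]; exact H.targetDefining_nonpos hy) (H.inward_closure hx hv)
  refine ⟨s, hs, ?_, hsv⟩
  have hneg : ContDiffOn ℝ ∞ (fun y => -1 * targetDefining Ω h' u y) (closure Ω) :=
    contDiffOn_const.mul hT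
  -- The barrier dominates `-h' ∘ ∇u`, and both vanish at `x`; comparing their inward derivatives
  -- bounds `s`. The constant `(n + 1) K` covers both the bound `K` on the function and the bound `n
  -- K` on its `L`.
  have hbd := HC H (fun y => -1 * targetDefining Ω h' u y) ((n + 1) * P.K) (by positivity) hneg
    (fun y hy => by rw [H.targetDefining_eq_zero hy]; simp)
    (fun y hy => by
      have := H.bar'.neg_le _ (H.mapsTo (subset_closure hy))
      have hn : (0:ℝ) ≤ n * P.K := by positivity
      simp only [targetDefining]
      linarith)
    (fun y hy e μ he => by
      rw [linOp_const_mul hS _ hT (subset_closure hy)]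
      have h1 : |linOp (closure Ω) e μ (targetDefining Ω h' u) y| ≤ n * P.K := by
        have := H.sol.linOp_comp_gradient H.dom H.dom' hy he H.bar'.smooth
        change |linOp (closure Ω) e μ (fun y => h' (gradientWithin u (closure Ω) y)) y| ≤ n * P.K
        rw [this]
        refine abs_sum_le_card_mul fun i => ?_
        have := H.bar'.pd_pd_le _ (H.mapsTo (subset_closure hy)) (e i) (e i)
        rw [e.norm_eq_one] at this
        rw [abs_mul, abs_of_nonneg (mul_nonneg (weight_pos _).le (sq_nonneg _))]
        have := mul_le_mul (weight_mul_sq_le_one (μ i)) this (abs_nonneg _) zero_le_one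
        simpa using this
      linarith [le_of_abs_le h1])
  have hh : ContDiffOn ℝ ∞ (fun y => C * ((n + 1) * P.K) * h y) (closure Ω) :=
    contDiffOn_const.mul H.bar.smooth
  have h2 := pd_nonpos_of_isMaxOn (x := x) (fun y hy => by
    refine (hbd y hy).trans ?_
    rw [H.targetDefining_eq_zero hx, H.bar.eq_zero x hx]; simp) (H.inward_closure hx hv₀)
  rw [pd_add hS hneg hh hx', pd_const_mul hS _ hT hx', pd_const_mul hS _ H.bar.smooth hx'] at h2
  have h3 : pd (closure Ω) v₀ (targetDefining Ω h' u) x = s * pd (closure Ω) v₀ h x := hsv v₀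
  rw [h3] at h2
  by_contra! hlt
  nlinarith

namespace IsConfiguration

/-- Evaluating the multiplier rule at `b` gives `s χ = D²u(b, b)`, which is positive. -/
theorem obliqueness_pos (H : IsConfiguration P Ω Ω' h h' u c) (hx : x ∈ frontier Ω) {s : ℝ}
    (hs : 0 ≤ s)
    (hsv : ∀ v, pd (closure Ω) v (targetDefining Ω h' u) x = s * pd (closure Ω) v h x) :
    0 < obliqueness Ω Ω' h h' u x := by
  have hx' := frontier_subset_closure hx
  have hb : targetNormal Ω Ω' h' u x ≠ 0 := by
    rw [← norm_pos_iff]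
    exact P.γ_pos.trans_le (H.le_norm_targetNormal hx)
  have := H.sol.hess_pos H.dom hx' hb
  rw [← H.pd_targetDefining hx', hsv, pd_targetNormal] at this
  exact pos_of_mul_pos_right this hs

/-- By symmetry of `D²u` the multiplier rule reads `D²u b = s ∇h`: along `b` the gradient map moves
in a known direction. -/
theorem pd_targetNormal_gradient (H : IsConfiguration P Ω Ω' h h' u c) (hx : x ∈ closure Ω) {s : ℝ}
    (hsv : ∀ v, pd (closure Ω) v (targetDefining Ω h' u) x = s * pd (closure Ω) v h x) :
    pd (closure Ω) (targetNormal Ω Ω' h' u x) (gradientWithin u (closure Ω)) x =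
      s • gradientWithin h (closure Ω) x := by
  refine ext_inner_right ℝ fun w => ?_
  rw [inner_pd_gradientWithin H.dom.isRegular H.sol.diffeo.1 hx, pd_comm H.dom.isRegular
    H.sol.smooth hx, ← H.pd_targetDefining hx, hsv, inner_smul_left, inner_gradientWithin]
  simp

theorem pd_targetNormalComp (H : IsConfiguration P Ω Ω' h h' u c) (hx : x ∈ closure Ω) (v w : E n) :
    pd (closure Ω) v (targetNormalComp Ω Ω' h' u w) x =
      pd (closure Ω') (pd (closure Ω) v (gradientWithin u (closure Ω)) x) (pd (closure Ω') w h')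
        (gradientWithin u (closure Ω) x) :=
  pd_comp H.dom.isRegular H.sol.diffeo.1 H.mapsTo
    (contDiffOn_pd H.dom'.isRegular H.bar'.smooth w) hx v

/-- The derivative of the obliqueness in the direction of the target normal. -/
theorem pd_obliqueness (H : IsConfiguration P Ω Ω' h h' u c) (hx : x ∈ frontier Ω) {s : ℝ}
    (hs : 0 ≤ s)
    (hsv : ∀ v, pd (closure Ω) v (targetDefining Ω h' u) x = s * pd (closure Ω) v h x) :
    P.θ * P.γ ^ 2 ≤
      pd (closure Ω) (targetNormal Ω Ω' h' u x) (obliqueness Ω Ω' h h' u) x := by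
  have hS := H.dom.isRegular
  have hS' := H.dom'.isRegular
  have hx' := frontier_subset_closure hx
  have hpx := H.sol.gradient_mem_frontier H.dom H.dom' hx
  have hpx' := frontier_subset_closure hpx
  set b := targetNormal Ω Ω' h' u x with hb
  set a := gradientWithin h (closure Ω) x with ha
  have hak : ∀ k, a k = pd (closure Ω) (EuclideanSpace.single k 1) h x := fun k => by
    rw [← inner_gradientWithin, EuclideanSpace.inner_single_right]; simp [ha]
  -- Differentiating the factor `∇h` yields `D²h(b, b)`. Differentiating the factor `∇h'(∇u)` yields
  -- `s D²h'(a, a)`, because `∇u` moves by `s a`. The second is nonnegative and the first is at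
  -- least `θγ²`.
  have e1 : pd (closure Ω) b (obliqueness Ω Ω' h h' u) x =
      pd (closure Ω') (s • a) (pd (closure Ω') a h') (gradientWithin u (closure Ω) x) +
        pd (closure Ω) b (pd (closure Ω) b h) x := by
    change pd (closure Ω) b (fun x => ∑ k, pd (closure Ω) (EuclideanSpace.single k 1) h x *
      targetNormalComp Ω Ω' h' u (EuclideanSpace.single k 1) x) x = _
    rw [pd_sum hS _ (fun k => (contDiffOn_pd hS H.bar.smooth _).mul
      (H.contDiffOn_targetNormalComp _)) hx']
    have hsum : ∀ k, pd (closure Ω) b (fun x => pd (closure Ω) (EuclideanSpace.single k 1) h x *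
        targetNormalComp Ω Ω' h' u (EuclideanSpace.single k 1) x) x =
        a k * pd (closure Ω') (s • a) (pd (closure Ω') (EuclideanSpace.single k 1) h')
          (gradientWithin u (closure Ω) x) +
        b k * pd (closure Ω) b (pd (closure Ω) (EuclideanSpace.single k 1) h) x := fun k => by
      rw [pd_mul hS (contDiffOn_pd hS H.bar.smooth _) (H.contDiffOn_targetNormalComp _) hx',
        H.pd_targetNormalComp hx', H.pd_targetNormal_gradient hx' hsv, hak, hb,
        targetNormal_apply]
    have hexp : ∀ {T : Set (E n)} {k : E n → ℝ} {y : E n} (_ : IsRegular T)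
        (_ : ContDiffOn ℝ ∞ k T) (_ : y ∈ T) (v w : E n), pd T v (pd T w k) y =
          ∑ j, w j * pd T v (pd T (EuclideanSpace.single j 1) k) y := by
      intro T k y hT hk hy v w
      simp only [pd_pd_eq hT hk hy]
      conv_lhs => rw [euclidean_eq_sum w]
      simp [map_sum]
    simp only [hsum, Finset.sum_add_distrib]
    rw [hexp hS' H.bar'.smooth hpx' (s • a) a, hexp hS H.bar.smooth hx' b b]
  rw [e1, pd_smul, smul_eq_mul]
  have h1 := H.bar.hess_ge x hx' (by rw [H.bar.eq_zero x hx]; linarith [P.δ_pos]) b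
  have h2 := H.bar'.hess_ge _ hpx' (by rw [H.bar'.eq_zero _ hpx]; linarith [P.δ_pos]) a
  have h3 : P.γ ≤ ‖b‖ := H.le_norm_targetNormal hx
  have h4 : P.θ * P.γ ^ 2 ≤ P.θ * ‖b‖ ^ 2 := by
    have := P.γ_pos; have := P.θ_pos
    gcongr
  have h5 : 0 ≤ s * pd (closure Ω') a (pd (closure Ω') a h') (gradientWithin u (closure Ω) x) :=
    mul_nonneg hs (le_trans (by have := P.θ_pos; positivity) h2)
  linarith

end IsConfiguration

/-- The boundary condition is uniformly oblique. -/
theorem exists_obliqueness_bound (n : ℕ) (P : Bounds) : ∃ κ : ℝ, 0 < κ ∧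
    ∀ {Ω Ω' : Set (E n)} {h h' u : E n → ℝ} {c : ℝ}, IsConfiguration P Ω Ω' h h' u c →
      ∀ x ∈ frontier Ω, κ ≤ obliqueness Ω Ω' h h' u x := by
  obtain ⟨C, hC, HC⟩ := exists_barrier_bound n P
  obtain ⟨C', -, HC'⟩ := exists_normal_bound n P
  have hK := P.K_pos
  have hθ := P.θ_pos
  have hγ := P.γ_pos
  set B : ℝ := n * (4 * (n * P.K * (n * P.K))) with hB
  have hB0 : 0 ≤ B := by positivity
  refine ⟨P.θ * P.γ ^ 2 / (C * (2 * B + 1)), by positivity, ?_⟩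
  intro Ω Ω' h h' u c H x hx
  have hS := H.dom.isRegular
  have hob := H.contDiffOn_obliqueness
  have hctrl := H.controlled_obliqueness
  obtain ⟨x₀, hx₀, hmin⟩ := H.dom.isCompact_frontier.exists_isMinOn ⟨x, hx⟩
    (hob.continuousOn.mono frontier_subset_closure)
  refine le_trans ?_ (hmin hx)
  have hx₀' := frontier_subset_closure hx₀
  set m := obliqueness Ω Ω' h h' u x₀ with hm
  obtain ⟨s, hs, -, hsv⟩ := HC' H x₀ hx₀
  have hpos := H.obliqueness_pos hx₀ hs hsv
  have hderiv := H.pd_obliqueness hx₀ hs hsv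
  have hfs : ContDiffOn ℝ ∞ (fun y => m - obliqueness Ω Ω' h h' u y) (closure Ω) :=
    contDiffOn_const.sub hob
  -- `m - χ` is nonpositive on the boundary with equality at the minimum point `x₀`. Both `m` and
  -- `χ` are at most `B` in absolute value; the extra `1` only ensures positivity.
  have hbd := HC H (fun y => m - obliqueness Ω Ω' h h' u y) (2 * B + 1) (by positivity) hfs
    (fun y hy => sub_nonpos.2 (hmin hy))
    (fun y hy => by
      have h1 := abs_le.1 (hctrl.bound y (subset_closure hy))
      have h2 := abs_le.1 (hctrl.bound x₀ hx₀')
      linarith)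
    (fun y hy e μ he => by
      rw [linOp_sub hS contDiffOn_const hob (subset_closure hy), linOp_const]
      have h1 := abs_le.1 (hctrl.linOp_le y hy e μ he)
      linarith)
  have hh : ContDiffOn ℝ ∞ (fun y => C * (2 * B + 1) * h y) (closure Ω) :=
    contDiffOn_const.mul H.bar.smooth
  have hnb : ∀ f : E n → ℝ, pd (closure Ω) (-targetNormal Ω Ω' h' u x₀) f x₀ =
      -pd (closure Ω) (targetNormal Ω Ω' h' u x₀) f x₀ := fun f => by simp [pd]
  -- Since `χ(x₀) > 0`, the vector `-b` points inward. The comparison reads `∂_b χ ≤ C(2B + 1) χ` at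
  -- `x₀`, and the left side is at least `θγ²`.
  have h2 := pd_nonpos_of_isMaxOn (x := x₀) (fun y hy => by
      refine (hbd y hy).trans ?_
      rw [H.bar.eq_zero x₀ hx₀]; simp [hm])
    (H.inward_closure hx₀ (v := -targetNormal Ω Ω' h' u x₀) (by
      rw [hnb, pd_targetNormal]; linarith))
  rw [pd_add hS hfs hh hx₀', pd_sub hS contDiffOn_const hob hx₀', pd_const,
    pd_const_mul hS _ H.bar.smooth hx₀', hnb, hnb, pd_targetNormal (h := h)] at h2
  rw [div_le_iff₀ (by positivity)]
  linarith

end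

section
variable {n : ℕ} {S S' Ω Ω' : Set (E n)}
variable {e : OrthonormalBasis (Fin n) ℝ (E n)} {μ : Fin n → ℝ} {f g : E n → ℝ} {x : E n}
variable {P : Bounds} {h h' u : E n → ℝ} {c : ℝ}

/-! ### Interior estimates by boundary estimates -/

theorem pd_normSq (hS : IsRegular S) (x₀ v : E n) {y : E n} (hy : y ∈ S) :
    pd S v (fun y => ‖y - x₀‖ ^ 2) y = 2 * inner ℝ (y - x₀) v := by
  have h := ((hasFDerivWithinAt_id y S).sub_const x₀).norm_sq
  have h2 := h.fderivWithin (hS.uniqueDiffOn y hy)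
  rw [pd]
  simp only [id] at h2
  rw [h2]
  simp [inner_sub_left]

theorem pd_pd_normSq (hS : IsRegular S) (x₀ v : E n) {y : E n} (hy : y ∈ S) :
    pd S v (pd S v (fun y => ‖y - x₀‖ ^ 2)) y = 2 * ‖v‖ ^ 2 := by
  rw [pd_congr hy fun z hz => pd_normSq hS x₀ v hz,
    pd_const_mul hS 2 (f := fun z => inner ℝ (z - x₀) v)
      (by exact (contDiff_id.sub contDiff_const).inner ℝ contDiff_const |>.contDiffOn) hy]
  have h1 := pd_clm hS (innerSL ℝ v) (f := fun z => z - x₀) (by fun_prop) hy v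
  have h2 : pd S v (fun z => z - x₀) y = v := by
    rw [pd, fderivWithin_sub_const, fderivWithin_fun_id (hS.uniqueDiffOn y hy)]; rfl
  rw [h2] at h1
  simp only [innerSL_apply_apply, real_inner_self_eq_norm_sq] at h1
  rw [← h1]
  congr 1
  exact pd_congr hy (fun z _ => real_inner_comm _ _) v

namespace IsConfiguration

/-- `L(∂_w∂_w u) ≥ 0` is not strict, so `‖y - x₀‖²` is added to make the maximum principle
applicable; this costs `D²`. -/
theorem hess_le_of_frontier (H : IsConfiguration P Ω Ω' h h' u c) {w : E n} {m : ℝ}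
    (hm : ∀ x ∈ frontier Ω, pd (closure Ω) w (pd (closure Ω) w u) x ≤ m) :
    ∀ x ∈ closure Ω, pd (closure Ω) w (pd (closure Ω) w u) x ≤ m + P.D ^ 2 := by
  have hS := H.dom.isRegular
  obtain ⟨x₀, hx₀⟩ := H.dom.nonempty
  have hf := contDiffOn_pd hS (contDiffOn_pd hS H.sol.smooth w) w
  have hq : ContDiffOn ℝ ∞ (fun y : E n => ‖y - x₀‖ ^ 2) (closure Ω) :=
    (contDiff_id.sub contDiff_const).norm_sq ℝ |>.contDiffOn
  have hD : ∀ x ∈ closure Ω, ‖x - x₀‖ ^ 2 ≤ P.D ^ 2 := fun x hx => by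
    have := H.norm_sub_le x hx x₀ (subset_closure hx₀)
    gcongr
  have key := H.dom.le_of_subsolution (hf.add hq) (m := m + P.D ^ 2)
    (fun x hx => add_le_add (hm x hx) (hD x (frontier_subset_closure hx)))
    (fun x hx _ => by
      obtain ⟨e, μ, he⟩ := H.sol.exists_isFrame H.dom hx
      refine ⟨e, μ, ?_⟩
      rw [linOp_add hS hf hq (subset_closure hx)]
      refine add_pos_of_nonneg_of_pos
        (H.sol.linearized H.dom hx he.isEigenframe he.angle w).2 ?_
      refine Finset.sum_pos (fun i _ => ?_) ⟨⟨0, H.dim_pos⟩, Finset.mem_univ _⟩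
      rw [pd_pd_normSq hS _ _ (subset_closure hx), e.norm_eq_one]
      have := weight_pos (μ i)
      positivity)
  intro x hx
  have := key x hx
  have := sq_nonneg ‖x - x₀‖
  linarith

/-! ### Tangential derivatives -/

/-- Tilting `z` slightly inward leads into `Ω` and tilting it slightly outward leads out of the
closure, so the boundary is crossed in between; letting the tilt tend to zero exhibits `z` as
tangent. This allows tangential differentiation without parametrizing the boundary. -/
theorem mem_tangentConeAt_frontier (H : IsConfiguration P Ω Ω' h h' u c) (hx : x ∈ frontier Ω)
    {z : E n} (hz : pd (closure Ω) z h x = 0) : z ∈ tangentConeAt ℝ (frontier Ω) x := by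
  obtain ⟨v, hv⟩ := H.exists_pd_neg hx
  have hlin : ∀ r : ℝ, pd (closure Ω) (z + r • v) h x = r * pd (closure Ω) v h x := fun r => by
    rw [pd_vadd, pd_smul, hz, zero_add, smul_eq_mul]
  have key : ∀ ε : ℝ, 0 < ε → ∃ t : ℝ, 0 < t ∧ t < ε ∧ ∃ r : ℝ, |r| ≤ ε ∧
      x + t • (z + r • v) ∈ frontier Ω := by
    intro ε hε
    have h1 : ∀ᶠ t : ℝ in 𝓝[>] 0, x + t • (z + ε • v) ∈ Ω :=
      H.bar.inward x hx _ (by rw [hlin]; exact mul_neg_of_pos_of_neg hε hv)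
    have h2 : ∀ᶠ t : ℝ in 𝓝[>] 0, x + t • (z + (-ε) • v) ∉ closure Ω := by
      by_contra hcon
      -- Otherwise `h`, which is nonpositive on the closure, would increase to first order from its
      -- value `0` at `x` along points of the closure.
      have hfr : ∃ᶠ t : ℝ in 𝓝[>] 0, x + t • (z + (-ε) • v) ∈ closure Ω := by
        rw [Filter.Frequently]; simpa using hcon
      have hmax : IsLocalMaxOn h (closure Ω) x := by
        filter_upwards [self_mem_nhdsWithin] with y hy
        rw [H.bar.eq_zero x hx]; exact H.bar.nonpos y hy
      have := hmax.fderivWithin_nonpos (mem_posTangentConeAt_of_frequently_mem hfr)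
      have h3 := hlin (-ε)
      rw [pd] at h3
      rw [h3] at this
      nlinarith
    have h3 : ∀ᶠ t : ℝ in 𝓝[>] 0, t ∈ Ioo 0 ε := Ioo_mem_nhdsGT hε
    obtain ⟨t, ht1, ht2, ht3⟩ := (h1.and (h2.and h3)).exists
    refine ⟨t, ht3.1, ht3.2, ?_⟩
    by_contra! hno
    have hcont : Continuous fun r : ℝ => x + t • (z + r • v) := by fun_prop
    -- A segment that avoided the boundary would be split by the open sets `Ω` and `(closure Ω)ᶜ`.
    have hpre := (isPreconnected_Icc (a := -ε) (b := ε)).image _ hcont.continuousOn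
    obtain ⟨y, -, hy1, hy2⟩ := hpre Ω (closure Ω)ᶜ H.dom.isOpen isClosed_closure.isOpen_compl
      (by
        rintro _ ⟨r, hr, rfl⟩
        by_cases hc : x + t • (z + r • v) ∈ closure Ω
        · exact Or.inl ((H.dom.mem_or_mem_frontier hc).resolve_right (hno r (abs_le.2 hr)))
        · exact Or.inr hc)
      ⟨_, ⟨ε, ⟨by linarith, le_rfl⟩, rfl⟩, ht1⟩
      ⟨_, ⟨-ε, ⟨le_rfl, by linarith⟩, rfl⟩, ht2⟩
    exact hy2 (subset_closure hy1)
  have hpos : ∀ k : ℕ, (0:ℝ) < 1 / (k + 1) := fun k => by positivity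
  choose t ht0 ht1 r hr hmem using fun k : ℕ => key _ (hpos k)
  have hlim := tendsto_one_div_add_atTop_nhds_zero_nat (𝕜 := ℝ)
  have htl : Tendsto t atTop (𝓝 0) :=
    squeeze_zero (fun k => (ht0 k).le) (fun k => (ht1 k).le) hlim
  have hrl : Tendsto r atTop (𝓝 0) := squeeze_zero_norm (fun k => hr k) hlim
  have hzr : Tendsto (fun k => z + r k • v) atTop (𝓝 z) := by
    simpa using (hrl.smul_const v).const_add z
  refine mem_tangentConeAt_of_seq atTop (fun k => (t k)⁻¹) (fun k => t k • (z + r k • v)) ?_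
    (Eventually.of_forall hmem) ?_
  · simpa using htl.smul hzr
  · refine hzr.congr fun k => ?_
    rw [smul_smul, inv_mul_cancel₀ (ht0 k).ne', one_smul]

theorem pd_eq_zero_of_frontier (H : IsConfiguration P Ω Ω' h h' u c)
    (hf : ContDiffOn ℝ ∞ f (closure Ω)) (hf0 : ∀ y ∈ frontier Ω, f y = 0) (hx : x ∈ frontier Ω)
    {z : E n} (hz : pd (closure Ω) z h x = 0) : pd (closure Ω) z f x = 0 := by
  have h1 := (differentiableWithinAt_of_smooth hf (frontier_subset_closure hx)).hasFDerivWithinAt.mono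
    frontier_subset_closure
  have h2 : HasFDerivWithinAt f (0 : E n →L[ℝ] ℝ) (frontier Ω) x :=
    (hasFDerivWithinAt_const (0:ℝ) x (frontier Ω)).congr hf0 (hf0 x hx)
  exact h1.unique_on h2 (H.mem_tangentConeAt_frontier hx hz)

/-- The second tangential derivatives of `h' ∘ ∇u` on the boundary. -/
theorem pd_pd_targetDefining (H : IsConfiguration P Ω Ω' h h' u c) {C : ℝ}
    (hC : ∀ x ∈ frontier Ω, ∃ s, 0 ≤ s ∧ s ≤ C ∧
        ∀ v, pd (closure Ω) v (targetDefining Ω h' u) x = s * pd (closure Ω) v h x)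
    (hx : x ∈ frontier Ω) {z : E n} (hz : pd (closure Ω) z h x = 0) (hz1 : ‖z‖ = 1) :
    pd (closure Ω) z (pd (closure Ω) z (targetDefining Ω h' u)) x ≤ C * P.K := by
  have hS := H.dom.isRegular
  have hx' := frontier_subset_closure hx
  have hh := H.bar.smooth
  have hT := H.contDiffOn_targetDefining
  have hpd : ∀ {k : E n → ℝ} (v : E n), ContDiffOn ℝ ∞ k (closure Ω) →
      ContDiffOn ℝ ∞ (pd (closure Ω) v k) (closure Ω) := fun v hk => contDiffOn_pd hS hk v
  obtain ⟨v, hv⟩ := H.exists_pd_neg hx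
  obtain ⟨s, hs, hsC, hsv⟩ := hC x hx
  -- At every boundary point `d(h' ∘ ∇u) = s dh` with `s` depending on the point. This determinant
  -- eliminates `s`, so the identity can be differentiated along the boundary although no regularity
  -- of `s` is known.
  have h0 := H.pd_eq_zero_of_frontier (f := fun y =>
      pd (closure Ω) z (targetDefining Ω h' u) y * pd (closure Ω) v h y -
      pd (closure Ω) z h y * pd (closure Ω) v (targetDefining Ω h' u) y)
    (((hpd z hT).mul (hpd v hh)).sub ((hpd z hh).mul (hpd v hT)))
    (fun y hy => by
      obtain ⟨s, -, -, hsv⟩ := hC y hy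
      rw [hsv, hsv]; ring) hx hz
  rw [pd_sub hS ((hpd z hT).mul (hpd v hh)) ((hpd z hh).mul (hpd v hT)) hx',
    pd_mul hS (hpd z hT) (hpd v hh) hx', pd_mul hS (hpd z hh) (hpd v hT) hx', hsv, hsv, hz] at h0
  have h1 : pd (closure Ω) v h x * (pd (closure Ω) z (pd (closure Ω) z (targetDefining Ω h' u)) x -
      s * pd (closure Ω) z (pd (closure Ω) z h) x) = 0 := by linarith
  have h2 : pd (closure Ω) z (pd (closure Ω) z (targetDefining Ω h' u)) x =
      s * pd (closure Ω) z (pd (closure Ω) z h) x := by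
    rcases mul_eq_zero.1 h1 with h3 | h3
    · exact absurd h3 hv.ne
    · linarith
  rw [h2]
  have h3 := le_of_abs_le (H.bar.pd_pd_le x hx' z z)
  rw [hz1, mul_one, mul_one] at h3
  calc s * _ ≤ s * P.K := by gcongr
    _ ≤ C * P.K := by have := P.K_pos; gcongr

/-- The Hessian on the boundary in terms of its tangential part. -/
theorem hess_frontier_le (H : IsConfiguration P Ω Ω' h h' u c) (hx : x ∈ frontier Ω) {s C κ M : ℝ}
    (hs : 0 ≤ s) (hsC : s ≤ C) (hκ : 0 < κ)
    (hsv : ∀ v, pd (closure Ω) v (targetDefining Ω h' u) x = s * pd (closure Ω) v h x)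
    (hob : κ ≤ obliqueness Ω Ω' h h' u x) (hM : 0 ≤ M)
    (htan : ∀ τ, pd (closure Ω) τ h x = 0 →
      pd (closure Ω) τ (pd (closure Ω) τ u) x ≤ M * ‖τ‖ ^ 2) {w : E n} (hw : ‖w‖ = 1) :
    pd (closure Ω) w (pd (closure Ω) w u) x ≤
      M - 2 * M * ((obliqueness Ω Ω' h h' u x)⁻¹ *
          (pd (closure Ω) w h x * targetNormalComp Ω Ω' h' u w x)) +
        (P.K ^ 2 / κ ^ 2 + C / κ) * (M + 1) * (pd (closure Ω) w h x * pd (closure Ω) w h x) := by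
  have hS := H.dom.isRegular
  have hx' := frontier_subset_closure hx
  have hu := H.sol.smooth
  set χ := obliqueness Ω Ω' h h' u x with hχ
  have hχ0 : 0 < χ := hκ.trans_le hob
  set b := targetNormal Ω Ω' h' u x with hb
  set aw := pd (closure Ω) w h x with haw
  set bw := targetNormalComp Ω Ω' h' u w x with hbw
  -- The tangential part is taken along `b` rather than along the normal. Since `D²u(τ, b) = s dh(τ)
  -- = 0`, the Hessian then has no mixed term.
  set τ := w - (aw / χ) • b with hτ
  have hbh : pd (closure Ω) b h x = χ := pd_targetNormal x
  have hτ0 : pd (closure Ω) τ h x = 0 := by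
    have : pd (closure Ω) τ h x = aw - aw / χ * χ := by
      rw [hτ, pd, map_sub, map_smul, smul_eq_mul]
      change aw - aw / χ * pd (closure Ω) b h x = _
      rw [hbh]
    rw [this, div_mul_cancel₀ _ hχ0.ne', sub_self]
  have hτb : pd (closure Ω) τ (pd (closure Ω) b u) x = 0 := by
    rw [← H.pd_targetDefining hx', hsv, hτ0, mul_zero]
  have hbb : pd (closure Ω) b (pd (closure Ω) b u) x = s * χ := by
    rw [← H.pd_targetDefining hx', hsv, hbh]
  have hww : pd (closure Ω) w (pd (closure Ω) w u) x =
      pd (closure Ω) τ (pd (closure Ω) τ u) x + (aw / χ) ^ 2 * (s * χ) := by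
    have hbτ : pd (closure Ω) b (pd (closure Ω) τ u) x = 0 := by
      rw [pd_comm hS hu hx']; exact hτb
    have hwe : w = τ + (aw / χ) • b := by rw [hτ]; abel
    rw [pd_pd_eq hS hu hx'] at hτb hbb hbτ ⊢
    rw [pd_pd_eq hS hu hx']
    conv_lhs => rw [hwe]
    simp only [map_add, map_smul, _root_.add_apply, _root_.smul_apply, hτb, hbb, hbτ, smul_eq_mul]
    ring
  -- The linear term is kept exactly, as only the terms quadratic in `aw` may be estimated: these
  -- vanish to second order where `w` is tangential.
  have hnorm : ‖τ‖ ^ 2 = 1 - 2 * (aw / χ * bw) + (aw / χ) ^ 2 * ‖b‖ ^ 2 := by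
    rw [hτ, norm_sub_sq_real, hw, inner_smul_right, norm_smul, real_inner_comm,
      inner_targetNormal, mul_pow, Real.norm_eq_abs, sq_abs, one_pow]
  have hbK : ‖b‖ ^ 2 ≤ P.K ^ 2 := by
    have := H.norm_targetNormal_le hx'
    gcongr
  have h1 := htan τ hτ0
  rw [hnorm] at h1
  rw [hww]
  have hC : 0 ≤ C := hs.trans hsC
  have haw2 := mul_self_nonneg aw
  have h2 : (aw / χ) ^ 2 ≤ aw * aw / κ ^ 2 := by
    rw [div_pow, sq aw]
    gcongr
  have h3 : (aw / χ) ^ 2 * (s * χ) ≤ C / κ * (aw * aw) := by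
    have : (aw / χ) ^ 2 * (s * χ) = s / χ * (aw * aw) := by field_simp
    rw [this]
    gcongr
  have h4 : (aw / χ) ^ 2 * ‖b‖ ^ 2 ≤ aw * aw / κ ^ 2 * P.K ^ 2 :=
    mul_le_mul h2 hbK (sq_nonneg _) (by positivity)
  have h5 : M * ((aw / χ) ^ 2 * ‖b‖ ^ 2) ≤ M * (aw * aw / κ ^ 2 * P.K ^ 2) := by gcongr
  have h6 : 0 ≤ P.K ^ 2 / κ ^ 2 * (aw * aw) := mul_nonneg (by positivity) (mul_self_nonneg aw)
  have h7 : 0 ≤ M * (C / κ * (aw * aw)) :=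
    mul_nonneg hM (mul_nonneg (by positivity) (mul_self_nonneg aw))
  have h8 : aw * aw / κ ^ 2 * P.K ^ 2 = P.K ^ 2 / κ ^ 2 * (aw * aw) := by ring
  have h9 : aw / χ * bw = χ⁻¹ * (aw * bw) := by ring
  rw [h8] at h5
  rw [h9] at h1
  nlinarith

end IsConfiguration

/-- A smooth function on the line which equals `s⁻¹` for `s ≥ κ`. -/
theorem exists_smooth_inv {κ : ℝ} (hκ : 0 < κ) :
    ∃ η : ℝ → ℝ, ContDiff ℝ ∞ η ∧ ∀ s, κ ≤ s → η s = s⁻¹ := by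
  -- The transition runs from `s = κ/2` to `s = κ` and thus cuts off the singularity at `0`.
  refine ⟨fun s => Real.smoothTransition (2 * s / κ - 1) * s⁻¹, ?_, fun s hs => ?_⟩
  · rw [contDiff_iff_contDiffAt]
    intro s
    rcases lt_or_ge s (κ / 2) with h | h
    · have : (fun s => Real.smoothTransition (2 * s / κ - 1) * s⁻¹) =ᶠ[𝓝 s] fun _ => 0 := by
        filter_upwards [Iio_mem_nhds h] with t ht
        rw [Real.smoothTransition.zero_of_nonpos, zero_mul]
        rw [sub_nonpos, div_le_one hκ]
        have : t < κ / 2 := ht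
        linarith
      exact contDiffAt_const.congr_of_eventuallyEq this
    · refine ContDiffAt.mul ?_ (contDiffAt_inv ℝ (show s ≠ 0 by linarith))
      exact Real.smoothTransition.contDiffAt.comp s (by fun_prop)
  · have : 1 ≤ 2 * s / κ - 1 := by
      rw [le_sub_iff_add_le, le_div_iff₀ hκ]
      linarith
    simp only [Real.smoothTransition.one_of_one_le this, one_mul]

theorem exists_derivative_bound {η : ℝ → ℝ} (hη : ContDiff ℝ ∞ η) (A : ℝ) :
    ∃ N : ℝ, 0 < N ∧ (∀ s ∈ Icc (-A) A, |η s| ≤ N) ∧ (∀ s ∈ Icc (-A) A, |deriv η s| ≤ N) ∧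
      ∀ s ∈ Icc (-A) A, |deriv (deriv η) s| ≤ N := by
  have hη' : ContDiff ℝ ∞ (deriv η) := (contDiff_infty_iff_deriv.1 hη).2
  have hη'' : ContDiff ℝ ∞ (deriv (deriv η)) := (contDiff_infty_iff_deriv.1 hη').2
  obtain ⟨N₀, h₀⟩ := isCompact_Icc.exists_bound_of_continuousOn
    (s := Icc (-A) A) hη.continuous.continuousOn
  obtain ⟨N₁, h₁⟩ := isCompact_Icc.exists_bound_of_continuousOn
    (s := Icc (-A) A) hη'.continuous.continuousOn
  obtain ⟨N₂, h₂⟩ := isCompact_Icc.exists_bound_of_continuousOn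
    (s := Icc (-A) A) hη''.continuous.continuousOn
  refine ⟨|N₀| + |N₁| + |N₂| + 1, by positivity, fun s hs => ?_, fun s hs => ?_, fun s hs => ?_⟩
  · have := h₀ s hs; rw [Real.norm_eq_abs] at this
    linarith [le_abs_self N₀, abs_nonneg N₁, abs_nonneg N₂]
  · have := h₁ s hs; rw [Real.norm_eq_abs] at this
    linarith [le_abs_self N₁, abs_nonneg N₀, abs_nonneg N₂]
  · have := h₂ s hs; rw [Real.norm_eq_abs] at this
    linarith [le_abs_self N₂, abs_nonneg N₁, abs_nonneg N₀]

end

section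
variable {n : ℕ} {S S' Ω Ω' : Set (E n)}
variable {e : OrthonormalBasis (Fin n) ℝ (E n)} {μ : Fin n → ℝ} {f g : E n → ℝ} {x : E n}
variable {P : Bounds} {h h' u : E n → ℝ} {c : ℝ}

/-! ### The tangential estimate -/

namespace IsControlled

theorem const_mul {A : ℝ} (hΩ : IsUniformlyConvexDomain Ω) (a : ℝ) (hf : IsControlled Ω u c f A) :
    IsControlled Ω u c (fun y => a * f y) (4 * (|a| * A)) := (const a).mul hΩ hf

end IsControlled

/-- The correction that turns a pure second derivative of `u` into a function which is nonpositive
on the boundary. -/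
noncomputable def correction (Ω Ω' : Set (E n)) (h h' u : E n → ℝ) (η : ℝ → ℝ) (M C : ℝ) (z : E n)
    (y : E n) : ℝ :=
  -M + 2 * M * (η (obliqueness Ω Ω' h h' u y) *
      (pd (closure Ω) z h y * targetNormalComp Ω Ω' h' u z y)) +
    -(C * (M + 1)) * (pd (closure Ω) z h y * pd (closure Ω) z h y)

/-- The correction is affine in `M`, with coefficients built from controlled functions by products
and composition with `η`. The linear growth in `M` is essential: it is finally played off against
`M²`. -/
theorem exists_correction_bound (n : ℕ) (P : Bounds) {η : ℝ → ℝ} (hη : ContDiff ℝ ∞ η) {C : ℝ}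
    (hC : 0 < C) : ∃ B : ℝ, 0 < B ∧
      ∀ {Ω Ω' : Set (E n)} {h h' u : E n → ℝ} {c : ℝ}, IsConfiguration P Ω Ω' h h' u c →
        ∀ M, 0 ≤ M → ∀ z, ‖z‖ = 1 →
          IsControlled Ω u c (correction Ω Ω' h h' u η M C z) ((M + 1) * B) := by
  have hK := P.K_pos
  set A : ℝ := n * (4 * (n * P.K * (n * P.K))) with hA
  have hA0 : 0 ≤ A := by positivity
  obtain ⟨N, hN, h0, h1, h2⟩ := exists_derivative_bound hη A
  set K₁ : ℝ := n * P.K with hK₁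
  have hK₁0 : 0 ≤ K₁ := by positivity
  set B₁ : ℝ := 4 * (N * (1 + A + A ^ 2) * (4 * (K₁ * K₁))) with hB₁
  set B₂ : ℝ := 4 * (K₁ * K₁) with hB₂
  have hB₁0 : 0 ≤ B₁ := by positivity
  have hB₂0 : 0 ≤ B₂ := by positivity
  refine ⟨1 + 8 * B₁ + 4 * C * B₂, by positivity, ?_⟩
  intro Ω Ω' h h' u c H M hM z hz
  have ha := H.controlled_pd hz
  have hb := H.controlled_pd_comp hz
  have hχ := H.controlled_obliqueness
  have hηχ := hχ.comp H.dom hη h0 h1 h2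
  have h3 := ((IsControlled.const (Ω := Ω) (u := u) (c := c) (-M)).add H.dom
    ((hηχ.mul H.dom (ha.mul H.dom hb)).const_mul H.dom (2 * M))).add H.dom
    ((ha.mul H.dom ha).const_mul H.dom (-(C * (M + 1))))
  refine IsControlled.mono h3 (h3.nonneg H.dom) ?_
  rw [abs_neg, abs_neg, abs_of_nonneg hM, abs_of_nonneg (show 0 ≤ 2 * M by positivity),
    abs_of_nonneg (show 0 ≤ C * (M + 1) by positivity), ← hB₁, ← hB₂]
  nlinarith

namespace IsConfiguration

/-- The derivative of the correction at a boundary point where `z` is tangential. -/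
theorem pd_correction (H : IsConfiguration P Ω Ω' h h' u c) {η : ℝ → ℝ} (hη : ContDiff ℝ ∞ η)
    (hx : x ∈ closure Ω) {M C : ℝ} {z : E n} (hz : pd (closure Ω) z h x = 0) (v : E n) :
    pd (closure Ω) v (correction Ω Ω' h h' u η M C z) x =
      2 * M * (η (obliqueness Ω Ω' h h' u x) * (targetNormalComp Ω Ω' h' u z x *
        pd (closure Ω) v (pd (closure Ω) z h) x)) := by
  have hS := H.dom.isRegular
  have h1 := contDiffOn_pd hS H.bar.smooth z
  have h2 := H.contDiffOn_targetNormalComp z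
  have h3 : ContDiffOn ℝ ∞ (fun y => η (obliqueness Ω Ω' h h' u y)) (closure Ω) :=
    hη.comp_contDiffOn H.contDiffOn_obliqueness
  have h4 : ContDiffOn ℝ ∞ (fun y => η (obliqueness Ω Ω' h h' u y) *
      (pd (closure Ω) z h y * targetNormalComp Ω Ω' h' u z y)) (closure Ω) := h3.mul (h1.mul h2)
  have h5 : ContDiffOn ℝ ∞ (fun y => pd (closure Ω) z h y * pd (closure Ω) z h y) (closure Ω) :=
    h1.mul h1
  change pd (closure Ω) v (fun y => -M + 2 * M * (η (obliqueness Ω Ω' h h' u y) *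
      (pd (closure Ω) z h y * targetNormalComp Ω Ω' h' u z y)) +
    -(C * (M + 1)) * (pd (closure Ω) z h y * pd (closure Ω) z h y)) x = _
  rw [pd_add hS (contDiffOn_const.add (contDiffOn_const.mul h4)) (contDiffOn_const.mul h5) hx,
    pd_add hS contDiffOn_const (contDiffOn_const.mul h4) hx, pd_const, pd_const_mul hS _ h4 hx,
    pd_const_mul hS _ h5 hx, pd_mul hS h3 (h1.mul h2) hx, pd_mul hS h1 h2 hx, pd_mul hS h1 h1 hx, hz]
  ring

/-- Two tangential derivatives of `h' ∘ ∇u` equal `D²h'(D²u z, D²u z) + ∂_b∂_z∂_z u`. The sum is at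
most `C K`, and uniform convexity of the target makes the first term at least `θ ‖D²u z‖² ≥ θ M²`.
-/
theorem hess_bilinear_sq_le (H : IsConfiguration P Ω Ω' h h' u c) {C M N : ℝ}
    (hC : ∀ x ∈ frontier Ω, ∃ s, 0 ≤ s ∧ s ≤ C ∧
        ∀ v, pd (closure Ω) v (targetDefining Ω h' u) x = s * pd (closure Ω) v h x)
    (hx : x ∈ frontier Ω) {z : E n} (hz : pd (closure Ω) z h x = 0) (hz1 : ‖z‖ = 1)
    (hM : pd (closure Ω) z (pd (closure Ω) z u) x = M) (hM0 : 0 ≤ M)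
    (hN : -N ≤ pd (closure Ω) (targetNormal Ω Ω' h' u x)
      (pd (closure Ω) z (pd (closure Ω) z u)) x) :
    P.θ * M ^ 2 ≤ C * P.K + N := by
  have hS := H.dom.isRegular
  have hS' := H.dom'.isRegular
  have hx' := frontier_subset_closure hx
  have hu := H.sol.smooth
  have hp := H.sol.diffeo.1
  have hpx := H.sol.gradient_mem_frontier H.dom H.dom' hx
  have h1 := H.pd_pd_targetDefining hC hx hz hz1
  have h2 := pd_pd_comp hS hS' hp H.mapsTo H.bar'.smooth hx' z z
  change pd (closure Ω) z (pd (closure Ω) z (targetDefining Ω h' u)) x = _ at h2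
  rw [h2] at h1
  set b := targetNormal Ω Ω' h' u x with hb
  have h3 : pd (closure Ω') (pd (closure Ω) z (pd (closure Ω) z (gradientWithin u (closure Ω))) x) h'
      (gradientWithin u (closure Ω) x) =
      pd (closure Ω) b (pd (closure Ω) z (pd (closure Ω) z u)) x := by
    rw [← inner_gradientWithin, real_inner_comm]
    change inner ℝ _ b = _
    rw [inner_pd_pd_gradientWithin hS hp hx', pd_comm hS (contDiffOn_pd hS hu z) hx' b z]
    exact pd_congr hx' (fun y hy => pd_comm hS hu hy z b) z
  rw [h3] at h1
  have h4 := H.bar'.hess_ge _ (frontier_subset_closure hpx)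
    (by rw [H.bar'.eq_zero _ hpx]; linarith [P.δ_pos])
    (pd (closure Ω) z (gradientWithin u (closure Ω)) x)
  have h5 : M ≤ ‖pd (closure Ω) z (gradientWithin u (closure Ω)) x‖ := by
    rw [← hM, ← inner_pd_gradientWithin hS hp hx']
    refine (real_inner_le_norm _ _).trans ?_
    rw [hz1, mul_one]
  have h6 : P.θ * M ^ 2 ≤ P.θ * ‖pd (closure Ω) z (gradientWithin u (closure Ω)) x‖ ^ 2 := by
    have := P.θ_pos
    gcongr
  linarith

theorem hess_frontier_le_of_norm_eq_one (H : IsConfiguration P Ω Ω' h h' u c)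
    (hx : x ∈ frontier Ω) {s C κ M : ℝ} (hs : 0 ≤ s) (hsC : s ≤ C) (hκ : 0 < κ)
    (hsv : ∀ v, pd (closure Ω) v (targetDefining Ω h' u) x = s * pd (closure Ω) v h x)
    (hob : κ ≤ obliqueness Ω Ω' h h' u x) (hM : 0 ≤ M)
    (htan : ∀ τ, pd (closure Ω) τ h x = 0 →
      pd (closure Ω) τ (pd (closure Ω) τ u) x ≤ M * ‖τ‖ ^ 2) {z : E n} (hz1 : ‖z‖ = 1) :
    pd (closure Ω) z (pd (closure Ω) z u) x ≤
      (M + 1) * (2 * P.K ^ 2 / κ + (P.K ^ 2 / κ ^ 2 + C / κ) * P.K ^ 2 + 1) := by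
  have hx' := frontier_subset_closure hx
  have h1 := H.hess_frontier_le hx hs hsC hκ hsv hob hM htan hz1
  have hC : 0 ≤ C := hs.trans hsC
  have hK := P.K_pos
  set C₁ := P.K ^ 2 / κ ^ 2 + C / κ with hC₁
  have hC₁0 : 0 ≤ C₁ := by positivity
  have ha := H.bar.pd_le x hx' z
  have hb : |targetNormalComp Ω Ω' h' u z x| ≤ P.K * ‖z‖ := H.bar'.pd_le _ (H.mapsTo hx') z
  rw [hz1, mul_one] at ha hb
  have h2 : |(obliqueness Ω Ω' h h' u x)⁻¹ *
      (pd (closure Ω) z h x * targetNormalComp Ω Ω' h' u z x)| ≤ κ⁻¹ * (P.K * P.K) := by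
    rw [abs_mul, abs_mul, abs_of_pos (inv_pos.2 (hκ.trans_le hob))]
    gcongr
  have h3 : pd (closure Ω) z h x * pd (closure Ω) z h x ≤ P.K * P.K := by
    rw [← abs_mul_abs_self]
    gcongr
  have h4 := neg_le_of_abs_le h2
  have h5 : 2 * P.K ^ 2 / κ = 2 * (κ⁻¹ * (P.K * P.K)) := by ring
  have h6 : C₁ * (M + 1) * (pd (closure Ω) z h x * pd (closure Ω) z h x) ≤
      C₁ * (M + 1) * (P.K * P.K) := by gcongr
  have h7 : 2 * M * -(κ⁻¹ * (P.K * P.K)) ≤ 2 * M * ((obliqueness Ω Ω' h h' u x)⁻¹ *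
      (pd (closure Ω) z h x * targetNormalComp Ω Ω' h' u z x)) := by gcongr
  have h8 : 0 ≤ κ⁻¹ * (P.K * P.K) := by positivity
  rw [h5]
  nlinarith

theorem abs_pd_correction_le (H : IsConfiguration P Ω Ω' h h' u c) (hx : x ∈ frontier Ω) {κ : ℝ}
    (hκ : 0 < κ) (hob : κ ≤ obliqueness Ω Ω' h h' u x) {z : E n} (hz1 : ‖z‖ = 1) :
    |(obliqueness Ω Ω' h h' u x)⁻¹ * (targetNormalComp Ω Ω' h' u z x *
        pd (closure Ω) (targetNormal Ω Ω' h' u x) (pd (closure Ω) z h) x)| ≤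
      κ⁻¹ * (P.K * (P.K * P.K)) := by
  have hx' := frontier_subset_closure hx
  have hK := P.K_pos
  have hbK := H.norm_targetNormal_le hx'
  have hbz : |targetNormalComp Ω Ω' h' u z x| ≤ P.K * ‖z‖ := H.bar'.pd_le _ (H.mapsTo hx') z
  have hzz := H.bar.pd_pd_le x hx' (targetNormal Ω Ω' h' u x) z
  rw [hz1, mul_one] at hbz hzz
  have hzz' : |pd (closure Ω) (targetNormal Ω Ω' h' u x) (pd (closure Ω) z h) x| ≤ P.K * P.K :=
    hzz.trans (by gcongr)
  rw [abs_mul, abs_mul, abs_of_pos (inv_pos.2 (hκ.trans_le hob))]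
  gcongr

/-- The unit tangent vectors over the boundary form a compact set. The first alternative covers the
case that it is empty, as in dimension one. -/
theorem exists_max_tangential (H : IsConfiguration P Ω Ω' h h' u c) :
    (∀ x ∈ frontier Ω, ∀ w, pd (closure Ω) w h x = 0 → w = 0) ∨
    ∃ x ∈ frontier Ω, ∃ z, ‖z‖ = 1 ∧ pd (closure Ω) z h x = 0 ∧ ∀ y ∈ frontier Ω, ∀ w,
      pd (closure Ω) w h y = 0 → pd (closure Ω) w (pd (closure Ω) w u) y ≤
        pd (closure Ω) z (pd (closure Ω) z u) x * ‖w‖ ^ 2 := by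
  have hS := H.dom.isRegular
  have hu := H.sol.smooth
  have hc1 : ContinuousOn (fun q : E n × E n => pd (closure Ω) q.2 h q.1)
      (frontier Ω ×ˢ Metric.sphere 0 1) := by
    have h1 : ContinuousOn (fun q : E n × E n => fderivWithin ℝ h (closure Ω) q.1)
        (frontier Ω ×ˢ Metric.sphere 0 1) :=
      (contDiffOn_fderivWithin hS H.bar.smooth).continuousOn.comp continuousOn_fst
        fun q hq => frontier_subset_closure hq.1
    exact h1.clm_apply continuousOn_snd
  have hc2 : ContinuousOn (fun q : E n × E n =>
      fderivWithin ℝ (fderivWithin ℝ u (closure Ω)) (closure Ω) q.1 q.2 q.2)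
      (frontier Ω ×ˢ Metric.sphere 0 1) := by
    have h1 : ContinuousOn (fun q : E n × E n =>
        fderivWithin ℝ (fderivWithin ℝ u (closure Ω)) (closure Ω) q.1)
        (frontier Ω ×ˢ Metric.sphere 0 1) :=
      ((contDiffOn_fderivWithin hS hu).fderivWithin (m := ∞) hS.uniqueDiffOn
        (by simp)).continuousOn.comp continuousOn_fst
        fun q hq => frontier_subset_closure hq.1
    exact (h1.clm_apply continuousOn_snd).clm_apply continuousOn_snd
  have hcomp : IsCompact (frontier Ω ×ˢ Metric.sphere (0 : E n) 1) :=
    H.dom.isCompact_frontier.prod (isCompact_sphere _ _)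
  have hTc : IsCompact ((frontier Ω ×ˢ Metric.sphere (0 : E n) 1) ∩
      (fun q : E n × E n => pd (closure Ω) q.2 h q.1) ⁻¹' {0}) :=
    hcomp.of_isClosed_subset (hc1.preimage_isClosed_of_isClosed hcomp.isClosed isClosed_singleton)
      inter_subset_left
  have hscale : ∀ y ∈ frontier Ω, ∀ w, pd (closure Ω) w h y = 0 → w ≠ 0 →
      (y, ‖w‖⁻¹ • w) ∈ (frontier Ω ×ˢ Metric.sphere (0 : E n) 1) ∩
        (fun q : E n × E n => pd (closure Ω) q.2 h q.1) ⁻¹' {0} := by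
    intro y hy w hw hw0
    refine ⟨⟨hy, ?_⟩, ?_⟩
    · simp [norm_smul, inv_mul_cancel₀ (norm_ne_zero_iff.2 hw0)]
    · simp [pd_smul, hw]
  rcases ((frontier Ω ×ˢ Metric.sphere (0 : E n) 1) ∩
      (fun q : E n × E n => pd (closure Ω) q.2 h q.1) ⁻¹' {0}).eq_empty_or_nonempty with h0 | h0
  · left
    intro x hx w hw
    by_contra hw0
    have := hscale x hx w hw hw0
    rw [h0] at this
    exact this
  · right
    obtain ⟨⟨x, z⟩, ⟨⟨hx, hz⟩, hzt⟩, hmax⟩ :=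
      hTc.exists_isMaxOn h0 (hc2.mono inter_subset_left)
    refine ⟨x, hx, z, by simpa using hz, hzt, fun y hy w hw => ?_⟩
    rw [pd_pd_eq hS hu (frontier_subset_closure hy), pd_pd_eq hS hu (frontier_subset_closure hx)]
    by_cases hw0 : w = 0
    · simp [hw0]
    · have h1 := isMaxOn_iff.1 hmax _ (hscale y hy w hw hw0)
      simp only [map_smul, _root_.smul_apply, smul_eq_mul] at h1
      have hpos : 0 < ‖w‖ := norm_pos_iff.2 hw0
      rw [← mul_assoc, ← mul_inv, ← sq, inv_mul_le_iff₀ (by positivity)] at h1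
      linarith

end IsConfiguration

/-- At the maximizing pair `(x, z)` a barrier argument bounds `∂_b∂_z∂_z u` below by a multiple of
`-(M + 1)`, and `hess_bilinear_sq_le` turns this into a quadratic inequality for `M`. -/
theorem exists_tangential_bound (n : ℕ) (P : Bounds) : ∃ C : ℝ, 0 < C ∧
    ∀ {Ω Ω' : Set (E n)} {h h' u : E n → ℝ} {c : ℝ}, IsConfiguration P Ω Ω' h h' u c →
      ∀ x ∈ frontier Ω, ∀ w, pd (closure Ω) w h x = 0 →
        pd (closure Ω) w (pd (closure Ω) w u) x ≤ C * ‖w‖ ^ 2 := by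
  obtain ⟨Cb, hCb, HCb⟩ := exists_barrier_bound n P
  obtain ⟨Cs, hCs, HCs⟩ := exists_normal_bound n P
  obtain ⟨κ, hκ, Hκ⟩ := exists_obliqueness_bound n P
  have hK := P.K_pos
  have hθ := P.θ_pos
  have hD := P.D_pos
  obtain ⟨η, hη, hηinv⟩ := exists_smooth_inv hκ
  set C₁ := P.K ^ 2 / κ ^ 2 + Cs / κ with hC₁
  have hC₁0 : 0 < C₁ := by positivity
  obtain ⟨B, hB, HB⟩ := exists_correction_bound n P hη hC₁0
  -- The first three terms bound `∂_z∂_z u` on the boundary, `D²` is the loss in the maximum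
  -- principle, and `B` accounts for the correction; all are in units of `M + 1`.
  set C₃ := 2 * P.K ^ 2 / κ + C₁ * P.K ^ 2 + 1 + P.D ^ 2 + B with hC₃
  have hC₃0 : 0 < C₃ := by positivity
  -- In the same units, the first term comes from `∂_b` of the correction and the second from `∂_b`
  -- of the barrier, where `χ ≤ K²`.
  set C₅ := 2 * P.K ^ 3 / κ + Cb * C₃ * P.K ^ 2 with hC₅
  have hC₅0 : 0 < C₅ := by positivity
  set C₇ := (Cs * P.K + C₅) / P.θ with hC₇
  have hC₇0 : 0 < C₇ := by positivity
  refine ⟨1 + 2 * C₇, by positivity, ?_⟩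
  intro Ω Ω' h h' u c H
  have hS := H.dom.isRegular
  have hu := H.sol.smooth
  rcases H.exists_max_tangential with h0 | ⟨x, hx, z, hz1, hz, hmax⟩
  · intro x hx w hw
    rw [h0 x hx w hw, pd_pd_eq hS hu (frontier_subset_closure hx)]
    simp
  suffices hM : pd (closure Ω) z (pd (closure Ω) z u) x ≤ 1 + 2 * C₇ from
    fun y hy w hw => (hmax y hy w hw).trans (mul_le_mul_of_nonneg_right hM (sq_nonneg _))
  have hx' := frontier_subset_closure hx
  set M := pd (closure Ω) z (pd (closure Ω) z u) x with hM
  have hM0 : 0 ≤ M := H.sol.hess_nonneg H.dom hx' z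
  -- From here on `z` is a constant vector field, tangential at `x` but in general not at other
  -- boundary points; the correction compensates for its transversal part.
  set G := correction Ω Ω' h h' u η M C₁ z with hG
  have hGc := HB H M hM0 z hz1
  have hf := contDiffOn_pd hS (contDiffOn_pd hS hu z) z
  have hbdry : ∀ y ∈ frontier Ω, pd (closure Ω) z (pd (closure Ω) z u) y + G y ≤ 0 := by
    intro y hy
    obtain ⟨s, hs, hsC, hsv⟩ := HCs H y hy
    have := H.hess_frontier_le hy hs hsC hκ hsv (Hκ H y hy) hM0 (hmax y hy) hz1
    simp only [hG, correction, hηinv _ (Hκ H y hy)]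
    linarith
  have hfull : ∀ y ∈ frontier Ω, pd (closure Ω) z (pd (closure Ω) z u) y ≤
      (M + 1) * (2 * P.K ^ 2 / κ + C₁ * P.K ^ 2 + 1) := fun y hy => by
    obtain ⟨s, hs, hsC, hsv⟩ := HCs H y hy
    exact H.hess_frontier_le_of_norm_eq_one hy hs hsC hκ hsv (Hκ H y hy) hM0 (hmax y hy) hz1
  have hint := H.hess_le_of_frontier hfull
  have hMB : (M + 1) * B ≤ (M + 1) * C₃ := by
    gcongr
    have : 0 ≤ 2 * P.K ^ 2 / κ + C₁ * P.K ^ 2 + 1 + P.D ^ 2 := by positivity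
    linarith
  have hfG : ContDiffOn ℝ ∞ (fun y => pd (closure Ω) z (pd (closure Ω) z u) y + G y) (closure Ω) :=
    hf.add hGc.smooth
  have hbar := HCb H (fun y => pd (closure Ω) z (pd (closure Ω) z u) y + G y) ((M + 1) * C₃)
    (by positivity) hfG hbdry
    (fun y hy => by
      have h1 := hint y (subset_closure hy)
      have h2 := le_of_abs_le (hGc.bound y (subset_closure hy))
      have h3 : P.D ^ 2 ≤ (M + 1) * P.D ^ 2 := by nlinarith [sq_nonneg P.D]
      rw [hC₃]
      linarith)
    (fun y hy e μ he => by
      rw [linOp_add hS hf hGc.smooth (subset_closure hy)]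
      have h1 : 0 ≤ linOp (closure Ω) e μ (pd (closure Ω) z (pd (closure Ω) z u)) y :=
        (H.sol.linearized H.dom hy he.isEigenframe he.angle z).2
      have h2 := neg_le_of_abs_le (hGc.linOp_le y hy e μ he)
      linarith)
  set b := targetNormal Ω Ω' h' u x with hb
  have hnb : ∀ f : E n → ℝ, pd (closure Ω) (-b) f x = -pd (closure Ω) b f x :=
    fun f => by simp [pd]
  have hχ := Hκ H x hx
  have hbh : pd (closure Ω) b h x = obliqueness Ω Ω' h h' u x := pd_targetNormal x
  have hG0 : G x = -M := by simp [hG, correction, hz]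
  have hh : ContDiffOn ℝ ∞ (fun y => Cb * ((M + 1) * C₃) * h y) (closure Ω) :=
    contDiffOn_const.mul H.bar.smooth
  -- The comparison function vanishes at `x`, because the correction equals `-M` there, and it is
  -- nonpositive elsewhere; `-b` is an inward direction.
  have h2 := pd_nonpos_of_isMaxOn (x := x) (fun y hy => by
      refine (hbar y hy).trans ?_
      rw [H.bar.eq_zero x hx, hG0, hM]; simp)
    (H.inward_closure hx (v := -b) (by rw [hnb, hbh]; linarith))
  rw [pd_add hS hfG hh hx', pd_add hS hf hGc.smooth hx', pd_const_mul hS _ H.bar.smooth hx', hnb,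
    hnb, hnb, hbh, H.pd_correction hη hx' hz, hηinv _ hχ] at h2
  have hbK := H.norm_targetNormal_le hx'
  have hχK : obliqueness Ω Ω' h h' u x ≤ P.K * P.K := by
    rw [← hbh]
    refine (le_of_abs_le (H.bar.pd_le x hx' b)).trans ?_
    gcongr
  have h3 := H.abs_pd_correction_le hx hκ hχ hz1
  rw [← hb] at h3
  have h4 := H.hess_bilinear_sq_le (HCs H) hx hz hz1 hM.symm hM0 (N := (M + 1) * C₅) (by
    rw [← hb]
    have h5 := le_of_abs_le h3
    have h6 : 2 * M * ((obliqueness Ω Ω' h h' u x)⁻¹ * (targetNormalComp Ω Ω' h' u z x *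
        pd (closure Ω) b (pd (closure Ω) z h) x)) ≤
        2 * M * (κ⁻¹ * (P.K * (P.K * P.K))) := by gcongr
    have h7 : Cb * ((M + 1) * C₃) * obliqueness Ω Ω' h h' u x ≤
        Cb * ((M + 1) * C₃) * (P.K * P.K) := by gcongr
    have h8 : (M + 1) * C₅ = 2 * M * (κ⁻¹ * (P.K * (P.K * P.K))) +
        2 * (κ⁻¹ * (P.K * (P.K * P.K))) + Cb * ((M + 1) * C₃) * (P.K * P.K) := by
      rw [hC₅]; ring
    have h9 : 0 ≤ κ⁻¹ * (P.K * (P.K * P.K)) := by positivity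
    linarith)
  have h5 : M ^ 2 ≤ (M + 1) * C₇ := by
    rw [hC₇, mul_div_assoc', le_div_iff₀ hθ]
    have : 0 ≤ M * (Cs * P.K) := by positivity
    have h6 : (M + 1) * (Cs * P.K + C₅) = M * (Cs * P.K) + (Cs * P.K + (M + 1) * C₅) := by ring
    rw [h6, mul_comm]
    linarith
  -- For `M ≥ 1` the inequality `M² ≤ (M + 1) C₇` gives `M ≤ 2 C₇`.
  by_contra! hlt
  nlinarith

/-- The Hessian of a solution is bounded in terms of the bounds on the barriers. -/
theorem exists_hessian_bounds (n : ℕ) (P : Bounds) : ∃ C₉ : ℝ, 0 < C₉ ∧ ∃ C₁₀ : ℝ, 0 < C₁₀ ∧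
    ∀ {Ω Ω' : Set (E n)} {h h' u : E n → ℝ} {c : ℝ}, IsConfiguration P Ω Ω' h h' u c →
      HessianBounds Ω u C₉ C₁₀ := by
  obtain ⟨M, hM, HM⟩ := exists_tangential_bound n P
  obtain ⟨Cs, hCs, HCs⟩ := exists_normal_bound n P
  obtain ⟨κ, hκ, Hκ⟩ := exists_obliqueness_bound n P
  have hK := P.K_pos
  have hD := P.D_pos
  set C₁ := P.K ^ 2 / κ ^ 2 + Cs / κ with hC₁
  have hC₁0 : 0 < C₁ := by positivity
  set m := (M + 1) * (2 * P.K ^ 2 / κ + C₁ * P.K ^ 2 + 1) with hm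
  have hm0 : 0 < m := by positivity
  refine ⟨M, hM, m + P.D ^ 2, by positivity, ?_⟩
  intro Ω Ω' h h' u c H
  have hS := H.dom.isRegular
  have hu := H.sol.smooth
  have hunit : ∀ z : E n, ‖z‖ = 1 → ∀ y ∈ frontier Ω,
      pd (closure Ω) z (pd (closure Ω) z u) y ≤ m := by
    intro z hz1 y hy
    obtain ⟨s, hs, hsC, hsv⟩ := HCs H y hy
    exact H.hess_frontier_le_of_norm_eq_one hy hs hsC hκ hsv (Hκ H y hy) hM.le (HM H y hy) hz1
  -- The maximum principle bounds the Hessian on the whole closure at once, so one constant serves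
  -- on the boundary and inside.
  have hall : ∀ y ∈ closure Ω, ∀ w : E n, hessForm u (closure Ω) y w ≤ (m + P.D ^ 2) * ‖w‖ ^ 2 := by
    intro y hy w
    rw [hessForm_eq hS hu hy]
    by_cases hw : w = 0
    · rw [hw, pd_pd_eq hS hu hy]; simp
    · have hpos : 0 < ‖w‖ := norm_pos_iff.2 hw
      have h1 := H.hess_le_of_frontier (hunit (‖w‖⁻¹ • w)
        (by simp [norm_smul, inv_mul_cancel₀ hpos.ne'])) y hy
      rw [pd_pd_eq hS hu hy] at h1 ⊢
      simp only [map_smul, _root_.smul_apply, smul_eq_mul] at h1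
      rw [← mul_assoc, ← mul_inv, ← sq, inv_mul_le_iff₀ (by positivity)] at h1
      linarith
  refine ⟨fun x hx w hw => ?_, fun x hx w => hall x (frontier_subset_closure hx) w,
    fun x hx w => hall x (subset_closure hx) w⟩
  rw [hessForm_eq hS hu (frontier_subset_closure hx)]
  exact HM H x hx w (H.bar.tangent x hx w hw)

end

section
variable {n : ℕ} {S Ω Ω' : Set (E n)} {h : E n → ℝ} {x : E n}

/-! ### Local defining functions -/

namespace IsLocalDefiningFunction

variable {p : E n} {U : Set (E n)} {ρ : E n → ℝ}

theorem differentiableAt (hρ : IsLocalDefiningFunction Ω p U ρ) : DifferentiableAt ℝ ρ p :=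
  (hρ.smooth.contDiffAt (hρ.isOpen.mem_nhds hρ.mem)).differentiableAt (by simp)

theorem eventually_mem (hρ : IsLocalDefiningFunction Ω p U ρ) (hp : ρ p = 0) {v : E n}
    (hv : fderiv ℝ ρ p v < 0) : ∀ᶠ t : ℝ in 𝓝[>] 0, p + t • v ∈ Ω := by
  have hlin : HasDerivAt (fun t : ℝ => p + t • v) v 0 := by
    simpa using ((hasDerivAt_id (0:ℝ)).smul_const v).const_add p
  have hd : HasDerivAt (fun t : ℝ => ρ (p + t • v)) (fderiv ℝ ρ p v) 0 := by
    have h0 : HasFDerivAt ρ (fderiv ℝ ρ p) (p + (0:ℝ) • v) := by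
      simpa using hρ.differentiableAt.hasFDerivAt
    exact h0.comp_hasDerivAt 0 hlin
  have h1 := (hasDerivAt_iff_tendsto_slope_zero.1 hd).mono_left (nhdsGT_le_nhdsNE (0:ℝ))
  have h2 : ∀ᶠ t : ℝ in 𝓝[>] 0, p + t • v ∈ U := by
    have : U ∈ 𝓝 (p + (0:ℝ) • v) := by simpa using hρ.isOpen.mem_nhds hρ.mem
    exact nhdsWithin_le_nhds (hlin.continuousAt.eventually this)
  filter_upwards [h1.eventually (gt_mem_nhds hv), h2, self_mem_nhdsWithin] with t h3 h4 h5
  have ht : (0:ℝ) < t := h5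
  have h6 : ρ (p + t • v) < 0 := by
    simp only [zero_add, zero_smul, add_zero, hp, sub_zero, smul_eq_mul] at h3
    by_contra! h7
    have : 0 ≤ t⁻¹ * ρ (p + t • v) := by positivity
    linarith
  have : p + t • v ∈ Ω ∩ U := by
    rw [hρ.inter_eq]
    exact ⟨h4, h6⟩
  exact this.1

theorem eq_zero (hρ : IsLocalDefiningFunction Ω p U ρ) (hΩ : IsOpen Ω) (hp : p ∈ frontier Ω) :
    ρ p = 0 := by
  rw [hΩ.frontier_eq] at hp
  refine le_antisymm ?_ ?_
  · by_contra! hpos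
    have h1 : ∀ᶠ y in 𝓝 p, 0 < ρ y := hρ.differentiableAt.continuousAt.eventually (lt_mem_nhds hpos)
    obtain ⟨y, ⟨hy1, hy2⟩, hy3⟩ :=
      mem_closure_iff_nhds.1 hp.1 _ (h1.and (hρ.isOpen.mem_nhds hρ.mem))
    have : y ∈ Ω ∩ U := ⟨hy3, hy2⟩
    rw [hρ.inter_eq] at this
    exact absurd this.2 (not_lt.2 (le_of_lt hy1))
  · by_contra! hneg
    have : p ∈ Ω ∩ U := by
      rw [hρ.inter_eq]
      exact ⟨hρ.mem, hneg⟩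
    exact hp.2 this.1

/-- Directions with `dρ < 0` enter `Ω`, where `h` cannot exceed its value at `p`; the multiplier
rule applies. The factor may be zero, as `h` need not be a defining function. -/
theorem exists_smul (hρ : IsLocalDefiningFunction Ω p U ρ) (hp : ρ p = 0) {h' : E n →L[ℝ] ℝ}
    (hh : HasFDerivWithinAt h h' Ω p) (h0 : h p = 0) (hneg : ∀ᶠ y in 𝓝[Ω] p, h y ≤ 0) :
    ∃ c : ℝ, 0 ≤ c ∧ ∀ v, h' v = c * fderiv ℝ ρ p v := by
  obtain ⟨v, hv⟩ : ∃ v, fderiv ℝ ρ p v < 0 := by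
    obtain ⟨w, hw⟩ : ∃ w, fderiv ℝ ρ p w ≠ 0 := by
      by_contra! hcon
      exact hρ.fderiv_ne_zero (ContinuousLinearMap.ext hcon)
    rcases lt_or_gt_of_ne hw with hw | hw
    · exact ⟨w, hw⟩
    · exact ⟨-w, by rw [map_neg]; linarith⟩
  have hmax : IsLocalMaxOn h Ω p := by
    filter_upwards [hneg] with y hy
    rw [h0]; exact hy
  exact exists_nonneg_smul_of_halfspace hv fun v hv => hmax.hasFDerivWithinAt_nonpos hh
    (mem_posTangentConeAt_of_frequently_mem (hρ.eventually_mem hp hv).frequently)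

end IsLocalDefiningFunction

namespace IsUniformlyConvexDomain

theorem exists_smul_of_smooth (hΩ : IsUniformlyConvexDomain Ω) (hh : ContDiffOn ℝ ∞ h (closure Ω))
    (h0 : ∀ x ∈ frontier Ω, h x = 0) (hneg : ∀ x ∈ closure Ω, h x ≤ 0) {p : E n}
    (hp : p ∈ frontier Ω) {U : Set (E n)} {ρ : E n → ℝ} (hρ : IsLocalDefiningFunction Ω p U ρ) :
    ∃ c : ℝ, 0 ≤ c ∧ ∀ v, pd (closure Ω) v h p = c * fderiv ℝ ρ p v :=
  hρ.exists_smul (hρ.eq_zero hΩ.isOpen hp)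
    ((differentiableWithinAt_of_smooth hh (frontier_subset_closure hp)).hasFDerivWithinAt.mono
      subset_closure) (h0 p hp)
    (by filter_upwards [self_mem_nhdsWithin] with y hy using hneg y (subset_closure hy))

theorem eventually_mem_of_pd_neg (hΩ : IsUniformlyConvexDomain Ω)
    (hh : ContDiffOn ℝ ∞ h (closure Ω)) (h0 : ∀ x ∈ frontier Ω, h x = 0)
    (hneg : ∀ x ∈ closure Ω, h x ≤ 0) (hx : x ∈ frontier Ω) {v : E n}
    (hv : pd (closure Ω) v h x < 0) : ∀ᶠ t : ℝ in 𝓝[>] 0, x + t • v ∈ Ω := by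
  obtain ⟨U, ρ, hρ⟩ := hΩ.smoothBoundary x hx
  obtain ⟨c, hc, hcv⟩ := hΩ.exists_smul_of_smooth hh h0 hneg hx hρ
  refine hρ.eventually_mem (hρ.eq_zero hΩ.isOpen hx) ?_
  rw [hcv] at hv
  by_contra! hcon
  have := mul_nonneg hc hcon
  linarith

theorem pd_eq_zero_of_tangent (hΩ : IsUniformlyConvexDomain Ω)
    (hh : ContDiffOn ℝ ∞ h (closure Ω)) (h0 : ∀ x ∈ frontier Ω, h x = 0)
    (hneg : ∀ x ∈ closure Ω, h x ≤ 0) (hx : x ∈ frontier Ω) {w : E n}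
    (hw : w ∈ boundaryTangentSpace Ω x) : pd (closure Ω) w h x = 0 := by
  obtain ⟨U, ρ, hρ⟩ := hΩ.smoothBoundary x hx
  obtain ⟨c, -, hcv⟩ := hΩ.exists_smul_of_smooth hh h0 hneg hx hρ
  rw [hcv, hw U ρ hρ, mul_zero]

end IsUniformlyConvexDomain

theorem pd_pd_pd_eq (hS : IsRegular S) (hh : ContDiffOn ℝ ∞ h S) (hx : x ∈ S) (v v' w : E n) :
    pd S v (pd S v' (pd S w h)) x =
      fderivWithin ℝ (fderivWithin ℝ (fderivWithin ℝ h S) S) S x v v' w := by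
  have hD := contDiffOn_fderivWithin hS hh
  rw [← pd_pd_eq hS hD hx]
  have h1 := pd_clm hS (ContinuousLinearMap.apply ℝ ℝ w) (contDiffOn_pd hS hD v') hx v
  simp only [ContinuousLinearMap.apply_apply] at h1
  rw [← h1]
  exact pd_congr hx (fun y hy => pd_pd_eq hS hh hy v' w) v

theorem norm_gradientWithin (h : E n → ℝ) (x : E n) :
    ‖gradientWithin h S x‖ = ‖fderivWithin ℝ h S x‖ := by
  simp [gradientWithin]

/-! ### Barriers from boundary defining functions -/

/-- A set of positive volume contains points whose distance is bounded below. -/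
theorem exists_le_norm_sub {v : ℝ} (hn : 0 < n) (hv : 0 < v) : ∃ r : ℝ, 0 < r ∧
    ∀ Ω : Set (E n), volume.real Ω = v → ∃ x ∈ Ω, ∃ y ∈ Ω, r ≤ ‖x - y‖ := by
  set b := volume.real (Metric.ball (0 : E n) 1) with hb
  have hb0 : 0 ≤ b := measureReal_nonneg
  -- A ball of this radius has volume at most `v / 2`; the cap at `1` gives `r ^ n ≤ r`.
  set r := min 1 (v / (2 * (b + 1))) with hr
  have hr0 : 0 < r := lt_min one_pos (by positivity)
  refine ⟨r, hr0, fun Ω hΩ => ?_⟩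
  by_contra! hcon
  have hne : Ω.Nonempty := by
    rw [nonempty_iff_ne_empty]
    rintro rfl
    simp at hΩ
    linarith
  obtain ⟨x, hx⟩ := hne
  have hsub : Ω ⊆ Metric.ball x r := fun y hy => by
    rw [Metric.mem_ball, dist_eq_norm]
    exact hcon y hy x hx
  have h1 : v ≤ volume.real (Metric.ball x r) := by
    rw [← hΩ]
    exact measureReal_mono hsub (Metric.isBounded_ball.measure_lt_top).ne
  have h2 : volume.real (Metric.ball x r) = r ^ n * b := by
    rw [hb, Measure.real, Measure.addHaar_ball_of_pos _ _ hr0, ENNReal.toReal_mul,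
      ENNReal.toReal_ofReal (by positivity), finrank_euclideanSpace_fin]
    rfl
  have h3 : r ^ n ≤ r := pow_le_of_le_one hr0.le (min_le_left _ _) hn.ne'
  have h4 : r ^ n * b ≤ v / (2 * (b + 1)) * (b + 1) := by
    have := min_le_right 1 (v / (2 * (b + 1)))
    gcongr
    · exact h3.trans this
    · linarith
  have h5 : v / (2 * (b + 1)) * (b + 1) = v / 2 := by field_simp
  linarith

theorem IsUniformlyConvexDomain.frontier_nonempty (hΩ : IsUniformlyConvexDomain Ω) (hn : 0 < n) :
    (frontier Ω).Nonempty := by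
  have : Nonempty (Fin n) := ⟨⟨0, hn⟩⟩
  rw [nonempty_frontier_iff]
  refine ⟨hΩ.nonempty, fun h => ?_⟩
  have hc := hΩ.isCompact_closure
  rw [h, closure_univ] at hc
  have : NoncompactSpace (E n) := NormedSpace.noncompactSpace ℝ (E n)
  exact noncompact_univ (E n) hc

theorem exists_mvt_closure (hΩ : IsUniformlyConvexDomain Ω) {f : E n → ℝ}
    (hf : ContDiffOn ℝ ∞ f (closure Ω)) {x y : E n}
    (hx : x ∈ closure Ω) (hy : y ∈ closure Ω) :
    ∃ t ∈ Icc (0:ℝ) 1, x + t • (y - x) ∈ closure Ω ∧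
      f y - f x = pd (closure Ω) (y - x) f (x + t • (y - x)) := by
  obtain ⟨z, hz, h⟩ := domain_mvt (fun z hz =>
    (differentiableWithinAt_of_smooth hf hz).hasFDerivWithinAt) hΩ.convex.closure hx hy
  have hz' := hΩ.convex.closure.segment_subset hx hy hz
  rw [segment_eq_image'] at hz
  obtain ⟨t, ht, rfl⟩ := hz
  exact ⟨t, ht, hz', h⟩

namespace IsBoundaryDefiningFunction

variable {θ K : ℝ}

theorem pd_le (hb : IsBoundaryDefiningFunction Ω h θ K) (hΩ : IsUniformlyConvexDomain Ω)
    (hx : x ∈ closure Ω) (v : E n) : |pd (closure Ω) v h x| ≤ K * ‖v‖ := by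
  have h1 := hb.deriv_le 1 (by simp) x hx
  have h2 := (iteratedFDerivWithin ℝ 1 h (closure Ω) x).le_of_opNorm_le h1 ![v]
  rw [iteratedFDerivWithin_one_apply (hΩ.isRegular.uniqueDiffOn x hx)] at h2
  simpa [pd] using h2

theorem pd_pd_le (hb : IsBoundaryDefiningFunction Ω h θ K) (hΩ : IsUniformlyConvexDomain Ω)
    (hx : x ∈ closure Ω) (v w : E n) :
    |pd (closure Ω) v (pd (closure Ω) w h) x| ≤ K * ‖v‖ * ‖w‖ := by
  have h1 := hb.deriv_le 2 (by simp) x hx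
  have h2 := (iteratedFDerivWithin ℝ 2 h (closure Ω) x).le_of_opNorm_le h1 ![v, w]
  rw [iteratedFDerivWithin_two_apply' h hΩ.isRegular.uniqueDiffOn hx] at h2
  rw [pd_pd_eq hΩ.isRegular hb.smooth hx]
  simpa [Fin.prod_univ_succ, mul_assoc] using h2

theorem pd_pd_pd_le (hb : IsBoundaryDefiningFunction Ω h θ K) (hΩ : IsUniformlyConvexDomain Ω)
    (hx : x ∈ closure Ω) (v w : E n) :
    |pd (closure Ω) v (pd (closure Ω) v (pd (closure Ω) w h)) x| ≤ K * ‖v‖ ^ 2 * ‖w‖ := by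
  have h1 := hb.deriv_le 3 (by simp) x hx
  have h2 := (iteratedFDerivWithin ℝ 3 h (closure Ω) x).le_of_opNorm_le h1 ![v, v, w]
  have h3 : iteratedFDerivWithin ℝ 3 h (closure Ω) x ![v, v, w] =
      fderivWithin ℝ (fderivWithin ℝ (fderivWithin ℝ h (closure Ω)) (closure Ω)) (closure Ω)
        x v v w := by
    rw [iteratedFDerivWithin_succ_apply_right hΩ.isRegular.uniqueDiffOn hx,
      iteratedFDerivWithin_two_apply _ hΩ.isRegular.uniqueDiffOn hx]
    rfl
  rw [h3] at h2
  rw [pd_pd_pd_eq hΩ.isRegular hb.smooth hx]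
  simpa [Fin.prod_univ_succ, sq, mul_assoc] using h2

theorem hess_ge' (hb : IsBoundaryDefiningFunction Ω h θ K) (hΩ : IsUniformlyConvexDomain Ω)
    (hx : x ∈ closure Ω) (w : E n) :
    θ * ‖w‖ ^ 2 ≤ pd (closure Ω) w (pd (closure Ω) w h) x := by
  rw [← hessForm_eq hΩ.isRegular hb.smooth hx]
  exact hb.hess_ge x hx w

theorem nonpos (hb : IsBoundaryDefiningFunction Ω h θ K) (hΩ : IsUniformlyConvexDomain Ω)
    (hn : 0 < n) (hθ : 0 < θ) : ∀ x ∈ closure Ω, h x ≤ 0 := by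
  refine hΩ.le_of_subsolution hb.smooth (fun x hx => (hb.eq_zero x hx).le) fun x hx _ => ?_
  -- With all `μ i = 0` the weights are one and the operator is the Laplacian, which is positive on
  -- `h`.
  refine ⟨EuclideanSpace.basisFun (Fin n) ℝ, fun _ => 0,
    Finset.sum_pos (fun i _ => ?_) ⟨⟨0, hn⟩, Finset.mem_univ _⟩⟩
  have := hb.hess_ge' hΩ (subset_closure hx) (EuclideanSpace.basisFun (Fin n) ℝ i)
  rw [OrthonormalBasis.norm_eq_one] at this
  refine mul_pos (weight_pos _) ?_
  linarith

/-- Strong monotonicity of `∇h` gives `θ ‖x - y‖² ≤ ⟨∇h(x) - ∇h(y), x - y⟩ ≤ 2 |K| ‖x - y‖`. -/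
theorem norm_sub_le (hb : IsBoundaryDefiningFunction Ω h θ K) (hΩ : IsUniformlyConvexDomain Ω)
    (hθ : 0 < θ) : ∀ x ∈ closure Ω, ∀ y ∈ closure Ω, ‖x - y‖ ≤ 2 * |K| / θ := by
  intro x hx y hy
  obtain ⟨t, -, hz, h1⟩ := exists_mvt_closure hΩ
    (contDiffOn_pd hΩ.isRegular hb.smooth (x - y)) hy hx
  have h2 := hb.hess_ge' hΩ hz (x - y)
  rw [← h1] at h2
  have h3 := abs_le.1 (hb.pd_le hΩ hx (x - y))
  have h4 := abs_le.1 (hb.pd_le hΩ hy (x - y))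
  have h5 : K * ‖x - y‖ ≤ |K| * ‖x - y‖ := by gcongr; exact le_abs_self K
  rw [le_div_iff₀ hθ]
  rcases (norm_nonneg (x - y)).eq_or_lt with h0 | h0
  · rw [← h0]; simp
  · have : ‖x - y‖ * θ * ‖x - y‖ ≤ 2 * |K| * ‖x - y‖ := by nlinarith
    exact le_of_mul_le_mul_right this h0

/-- Along the segment `h - θ/2 ‖· - y‖²` is convex, so at `y` it lies above its tangent at `x`;
moreover `h x = 0` and `h y ≤ 0`. -/
theorem le_pd (hb : IsBoundaryDefiningFunction Ω h θ K) (hΩ : IsUniformlyConvexDomain Ω)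
    (hn : 0 < n) (hθ : 0 < θ) {x y : E n} (hx : x ∈ frontier Ω) (hy : y ∈ closure Ω) :
    θ / 2 * ‖x - y‖ ^ 2 ≤ pd (closure Ω) (x - y) h x := by
  have hS := hΩ.isRegular
  have hx' := frontier_subset_closure hx
  have hq : ContDiffOn ℝ ∞ (fun z : E n => ‖z - y‖ ^ 2) (closure Ω) :=
    (contDiff_id.sub contDiff_const).norm_sq ℝ |>.contDiffOn
  have hq' : ContDiffOn ℝ ∞ (fun z : E n => θ / 2 * ‖z - y‖ ^ 2) (closure Ω) :=
    contDiffOn_const.mul hq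
  have hk : ContDiffOn ℝ ∞ (fun z : E n => h z - θ / 2 * ‖z - y‖ ^ 2) (closure Ω) :=
    hb.smooth.sub hq'
  have hpd : ∀ v, ∀ z ∈ closure Ω, pd (closure Ω) v (fun z : E n => h z - θ / 2 * ‖z - y‖ ^ 2) z =
      pd (closure Ω) v h z - θ / 2 * pd (closure Ω) v (fun z : E n => ‖z - y‖ ^ 2) z := by
    intro v z hz
    rw [pd_sub hS hb.smooth hq' hz, pd_const_mul hS _ hq hz]
  obtain ⟨t, ht, hz, h1⟩ := exists_mvt_closure hΩ hk hx' hy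
  obtain ⟨t', -, hz', h2⟩ := exists_mvt_closure hΩ (contDiffOn_pd hS hk (y - x)) hx' hz
  have h3 : 0 ≤ pd (closure Ω) (y - x)
      (fun z : E n => h z - θ / 2 * ‖z - y‖ ^ 2) (x + t • (y - x)) -
      pd (closure Ω) (y - x) (fun z : E n => h z - θ / 2 * ‖z - y‖ ^ 2) x := by
    rw [h2]
    set z' := x + t' • (x + t • (y - x) - x)
    have e1 : x + t • (y - x) - x = t • (y - x) := by abel
    rw [e1, pd_smul, smul_eq_mul]
    refine mul_nonneg ht.1 ?_
    rw [pd_congr hz' (hpd (y - x)), pd_sub hS (contDiffOn_pd hS hb.smooth _)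
      (contDiffOn_const.mul (contDiffOn_pd hS hq _)) hz',
      pd_const_mul hS _ (contDiffOn_pd hS hq _) hz', pd_pd_normSq hS _ _ hz']
    have := hb.hess_ge' hΩ hz' (y - x)
    linarith
  rw [← h1, hpd _ x hx', pd_normSq hS _ _ hx', hb.eq_zero x hx] at h3
  have e2 : inner ℝ (x - y) (y - x) = -‖x - y‖ ^ 2 := by
    rw [← neg_sub x y, inner_neg_right, real_inner_self_eq_norm_sq]
  have e3 : pd (closure Ω) (y - x) h x = -pd (closure Ω) (x - y) h x := by
    rw [← neg_sub x y]; simp [pd]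
  rw [e2, e3] at h3
  have h4 := hb.nonpos hΩ hn hθ y hy
  simp only [sub_self, norm_zero] at h3
  nlinarith

/-- A boundary defining function is a barrier, if the domain is not too small. -/
theorem isBarrier (hb : IsBoundaryDefiningFunction Ω h θ K) (hΩ : IsUniformlyConvexDomain Ω)
    (hn : 0 < n) (hθ : 0 < θ) {r : ℝ} (hr : 0 < r) (hfar : ∃ x ∈ Ω, ∃ y ∈ Ω, r ≤ ‖x - y‖) :
    IsBarrier Ω h θ (|K| * (2 * |K| / θ) + |K| + 1) (θ * r / 4)
      (|K| * (2 * |K| / θ) + |K| + 2) := by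
  have hK : K ≤ |K| * (2 * |K| / θ) + |K| + 1 := by
    have : 0 ≤ |K| * (2 * |K| / θ) := by positivity
    linarith [le_abs_self K]
  have hlow : ∀ x ∈ closure Ω, -(|K| * (2 * |K| / θ) + |K| + 1) ≤ h x := by
    intro x hx
    obtain ⟨y, hy⟩ := hΩ.frontier_nonempty hn
    have hy' := frontier_subset_closure hy
    obtain ⟨t, -, hz, h1⟩ := exists_mvt_closure hΩ hb.smooth hx hy'
    have h2 := (abs_le.1 (hb.pd_le hΩ hz (y - x))).2
    have h3 := hb.norm_sub_le hΩ hθ y hy' x hx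
    have h4 : K * ‖y - x‖ ≤ |K| * (2 * |K| / θ) := by
      refine (mul_le_mul_of_nonneg_right (le_abs_self K) (norm_nonneg _)).trans ?_
      gcongr
    rw [hb.eq_zero y hy] at h1
    linarith [abs_nonneg K]
  have hneg := hb.nonpos hΩ hn hθ
  -- The Hessian bound holds on the whole closure, so the condition `-δ < h` is discarded and the
  -- value of `δ` is immaterial.
  refine ⟨hb.smooth, hb.eq_zero, hneg, hlow, fun x hx v => (hb.pd_le hΩ hx v).trans (by gcongr),
    fun x hx v w => (hb.pd_pd_le hΩ hx v w).trans (by gcongr),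
    fun x hx v w => (hb.pd_pd_pd_le hΩ hx v w).trans (by gcongr),
    fun x hx _ w => hb.hess_ge' hΩ hx w, fun x hx => ?_,
    fun x hx v hv => hΩ.eventually_mem_of_pd_neg hb.smooth hb.eq_zero hneg hx hv,
    fun x hx w hw => hΩ.pd_eq_zero_of_tangent hb.smooth hb.eq_zero hneg hx hw⟩
  -- Of two points at distance at least `r`, one is at distance at least `r / 2` from `x`. With
  -- `le_pd` this yields the gradient bound `θ r / 4`.
  obtain ⟨y, hy, hxy⟩ : ∃ y ∈ Ω, r / 2 ≤ ‖x - y‖ := by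
    obtain ⟨y₁, h₁, y₂, h₂, hd⟩ := hfar
    by_contra! hcon
    have h3 := hcon y₁ h₁
    have h4 := hcon y₂ h₂
    have h5 := norm_sub_le_norm_sub_add_norm_sub y₁ x y₂
    rw [norm_sub_rev y₁ x] at h5
    linarith
  have h1 := hb.le_pd hΩ hn hθ hx (subset_closure hy)
  rw [← inner_gradientWithin] at h1
  have h2 := h1.trans (real_inner_le_norm _ _)
  have hpos : 0 < ‖x - y‖ := by linarith
  have h3 : θ / 2 * ‖x - y‖ ≤ ‖gradientWithin h (closure Ω) x‖ := by
    have : θ / 2 * ‖x - y‖ * ‖x - y‖ ≤ ‖gradientWithin h (closure Ω) x‖ * ‖x - y‖ := by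
      nlinarith
    exact le_of_mul_le_mul_right this hpos
  refine le_trans ?_ h3
  nlinarith

end IsBoundaryDefiningFunction

end

section
variable {n : ℕ} {S Ω Ω' : Set (E n)} {h : E n → ℝ} {x : E n}

/-! ### Global defining functions -/

namespace IsUniformlyConvexDomain

theorem eventually_segment_mem (hΩ : IsUniformlyConvexDomain Ω) {y₀ q : E n} (hy₀ : y₀ ∈ Ω)
    (hq : q ∈ frontier Ω) : ∀ᶠ t : ℝ in 𝓝[>] 0, q + t • (y₀ - q) ∈ Ω := by
  filter_upwards [Ioo_mem_nhdsGT (zero_lt_one (α := ℝ))] with t ht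
  have := hΩ.convex.add_smul_sub_mem_interior' (frontier_subset_closure hq)
    (by rwa [hΩ.isOpen.interior_eq]) (t := t) ⟨ht.1, ht.2.le⟩
  rwa [hΩ.isOpen.interior_eq] at this

theorem fderiv_outward_nonneg (hΩ : IsUniformlyConvexDomain Ω) {y₀ q : E n} (hy₀ : y₀ ∈ Ω)
    (hq : q ∈ frontier Ω) {g : E n → ℝ} (hg : DifferentiableAt ℝ g q)
    (hneg : ∀ᶠ y in 𝓝[Ω] q, g y ≤ g q) : 0 ≤ fderiv ℝ g q (q - y₀) := by
  have h1 := IsLocalMaxOn.hasFDerivWithinAt_nonpos hneg hg.hasFDerivAt.hasFDerivWithinAt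
    (mem_posTangentConeAt_of_frequently_mem (hΩ.eventually_segment_mem hy₀ hq).frequently)
  rw [← neg_sub, map_neg] at h1
  linarith

/-- By convexity the affine function `y ↦ dρ(q - y)` is nonnegative on the open set `Ω`. If it
vanished at `y₀`, it would be constant and `dρ` would be zero. -/
theorem fderiv_outward_pos (hΩ : IsUniformlyConvexDomain Ω) {y₀ q : E n} (hy₀ : y₀ ∈ Ω)
    (hq : q ∈ frontier Ω) {U : Set (E n)} {ρ : E n → ℝ} (hρ : IsLocalDefiningFunction Ω q U ρ) :
    0 < fderiv ℝ ρ q (q - y₀) := by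
  have hρ0 := hρ.eq_zero hΩ.isOpen hq
  have hneg : ∀ᶠ y in 𝓝[Ω] q, ρ y ≤ ρ q := by
    filter_upwards [self_mem_nhdsWithin, nhdsWithin_le_nhds (hρ.isOpen.mem_nhds hρ.mem)]
      with y hy hyU
    have : y ∈ Ω ∩ U := ⟨hy, hyU⟩
    rw [hρ.inter_eq] at this
    rw [hρ0]; exact this.2.le
  have hall : ∀ y ∈ Ω, 0 ≤ fderiv ℝ ρ q (q - y) := fun y hy =>
    hΩ.fderiv_outward_nonneg hy hq hρ.differentiableAt hneg
  refine (hall y₀ hy₀).lt_of_ne fun h0 => hρ.fderiv_ne_zero (ContinuousLinearMap.ext fun w => ?_)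
  have hev : ∀ w : E n, fderiv ℝ ρ q w ≤ 0 := by
    intro w
    have hcont : Continuous fun t : ℝ => y₀ + t • w := by fun_prop
    have hmem : Ω ∈ 𝓝 (y₀ + (0:ℝ) • w) := by simpa using hΩ.isOpen.mem_nhds hy₀
    have hev : ∀ᶠ t in 𝓝[>] (0:ℝ), y₀ + t • w ∈ Ω :=
      nhdsWithin_le_nhds (hcont.continuousAt hmem)
    obtain ⟨t, ht, ht0⟩ := (hev.and self_mem_nhdsWithin).exists
    have h1 := hall _ ht
    have e : q - (y₀ + t • w) = (q - y₀) - t • w := by abel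
    rw [e, map_sub, ← h0, map_smul, smul_eq_mul] at h1
    have ht1 : (0:ℝ) < t := ht0
    by_contra! hpos
    nlinarith [mul_pos ht1 hpos]
  have h1 := hev w
  have h2 := hev (-w)
  rw [map_neg] at h2
  simpa using le_antisymm h1 (by linarith)

/-- A local defining function times a bump function, which keeps its sign on both sides of the
boundary. Measuring transversality by the common vector field `q - y₀` allows the pieces to be added
without cancellation. -/
theorem exists_local_piece (hΩ : IsUniformlyConvexDomain Ω) {y₀ p : E n} (hy₀ : y₀ ∈ Ω)
    (hp : p ∈ frontier Ω) : ∃ g : E n → ℝ, ContDiff ℝ ∞ g ∧ (∀ q ∈ Ω, g q ≤ 0) ∧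
      (∀ q ∉ Ω, 0 ≤ g q) ∧ ∃ V : Set (E n), IsOpen V ∧ p ∈ V ∧
        ∀ q ∈ V, q ∈ frontier Ω → 0 < fderiv ℝ g q (q - y₀) := by
  obtain ⟨U, ρ, hρ⟩ := hΩ.smoothBoundary p hp
  have hcont : ContinuousOn (fun q => fderiv ℝ ρ q (q - y₀)) U :=
    (hρ.smooth.continuousOn_fderiv_of_isOpen hρ.isOpen (by simp)).clm_apply
      (by fun_prop)
  have hUp : ∀ᶠ q in 𝓝 p, q ∈ U := hρ.isOpen.mem_nhds hρ.mem
  have hW : ∀ᶠ q in 𝓝 p, q ∈ U ∧ 0 < fderiv ℝ ρ q (q - y₀) :=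
    hUp.and
      ((hcont.continuousAt (hρ.isOpen.mem_nhds hρ.mem)).eventually
        (lt_mem_nhds (hΩ.fderiv_outward_pos hy₀ hp hρ)))
  obtain ⟨ε, hε, hball⟩ := Metric.eventually_nhds_iff_ball.1 hW
  let φ : ContDiffBump p := ⟨ε / 4, ε / 2, by linarith, by linarith⟩
  have hUts : ∀ q ∉ U, q ∉ tsupport φ := by
    intro q hq hqt
    rw [φ.tsupport_eq] at hqt
    refine hq (hball q ?_).1
    exact lt_of_le_of_lt (Metric.mem_closedBall.1 hqt) (by change ε / 2 < ε; linarith)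
  have hsign : ∀ q ∈ U, (q ∈ Ω ↔ ρ q < 0) := fun q hq => by
    have : q ∈ Ω ∩ U ↔ q ∈ {x ∈ U | ρ x < 0} := by rw [hρ.inter_eq]
    simpa [hq] using this
  have hφ0 : ∀ q ∉ U, φ q = 0 := fun q hq => image_eq_zero_of_notMem_tsupport (hUts q hq)
  refine ⟨fun q => φ q * ρ q, ?_, fun q hq => ?_, fun q hq => ?_, Metric.ball p (ε / 2),
    Metric.isOpen_ball, Metric.mem_ball_self (by linarith), fun q hq hqf => ?_⟩
  · rw [contDiff_iff_contDiffAt]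
    intro q
    by_cases hq : q ∈ U
    · exact φ.contDiff.contDiffAt.mul (hρ.smooth.contDiffAt (hρ.isOpen.mem_nhds hq))
    · have h0 : (fun q => φ q * ρ q) =ᶠ[𝓝 q] fun _ => 0 := by
        filter_upwards [(isClosed_tsupport φ).isOpen_compl.mem_nhds (hUts q hq)] with y hy
        rw [image_eq_zero_of_notMem_tsupport hy, zero_mul]
      exact contDiffAt_const.congr_of_eventuallyEq h0
  · by_cases hqU : q ∈ U
    · exact mul_nonpos_of_nonneg_of_nonpos φ.nonneg ((hsign q hqU).1 hq).le
    · simp [hφ0 q hqU]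
  · by_cases hqU : q ∈ U
    · exact mul_nonneg φ.nonneg (not_lt.1 fun h => hq ((hsign q hqU).2 h))
    · simp [hφ0 q hqU]
  · obtain ⟨hqU, hpos⟩ := hball q (Metric.ball_subset_ball (by linarith) hq)
    have hρd : DifferentiableAt ℝ ρ q :=
      (hρ.smooth.contDiffAt (hρ.isOpen.mem_nhds hqU)).differentiableAt (by simp)
    have hφd : DifferentiableAt ℝ φ q := φ.contDiffAt.differentiableAt (n := 1) (by simp)
    have hq0 : ρ q = 0 := by
      have hqU' : IsLocalDefiningFunction Ω q U ρ :=
        ⟨hρ.isOpen, hqU, hρ.smooth, fun h => by rw [h] at hpos; simp at hpos, hρ.inter_eq⟩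
      exact hqU'.eq_zero hΩ.isOpen hqf
    -- On the boundary `ρ = 0`, so the derivative of the bump function drops out.
    rw [fderiv_fun_mul hφd hρd]
    simp only [hq0, zero_smul, add_zero, _root_.smul_apply, smul_eq_mul]
    refine mul_pos (φ.pos_of_mem_ball hq) hpos

theorem eq_zero_of_sign (hΩ : IsUniformlyConvexDomain Ω) {g : E n → ℝ} (hg : Continuous g)
    (hneg : ∀ q ∈ Ω, g q ≤ 0) (hpos : ∀ q ∉ Ω, 0 ≤ g q) {q : E n} (hq : q ∈ frontier Ω) :
    g q = 0 := by
  refine le_antisymm ?_ (hpos q (hΩ.notMem_of_mem_frontier hq))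
  exact closure_minimal hneg (isClosed_le hg continuous_const) (frontier_subset_closure hq)

/-- A smooth function on the whole space which defines the domain globally. -/
theorem exists_global_defining (hΩ : IsUniformlyConvexDomain Ω) :
    ∃ ρ : E n → ℝ, ContDiff ℝ ∞ ρ ∧ (∀ x ∈ closure Ω, ρ x ≤ 0) ∧
      (∀ x ∈ closure Ω, ρ x = 0 → x ∈ frontier Ω) ∧
      ∀ x ∈ frontier Ω, ρ x = 0 ∧ IsLocalDefiningFunction Ω x univ ρ := by
  obtain ⟨y₀, hy₀⟩ := hΩ.nonempty
  choose! g hg hgneg hgpos V hV hpV hVpos using fun p hp => hΩ.exists_local_piece (p := p) hy₀ hp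
  obtain ⟨t, ht, hcov⟩ := hΩ.isCompact_frontier.elim_nhds_subcover V
    fun p hp => (hV p hp).mem_nhds (hpV p hp)
  -- Subtracting `f` makes the sum negative also at points of `Ω` where all pieces vanish. At the
  -- boundary `f` attains its minimum `0`, so the differential there is unaffected.
  obtain ⟨f, hfs, hf, hf01⟩ := hΩ.isOpen.exists_contDiff_support_eq (n := ⊤)
  have hf0 : ∀ q, 0 ≤ f q := fun q => (hf01 (mem_range_self q)).1
  have hfout : ∀ q ∉ Ω, f q = 0 := fun q hq => by
    rw [← hfs] at hq; exact Function.notMem_support.1 hq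
  have hfin : ∀ q ∈ Ω, 0 < f q := fun q hq => by
    rw [← hfs] at hq; exact (hf0 q).lt_of_ne (Function.mem_support.1 hq).symm
  set ρ : E n → ℝ := fun q => ∑ p ∈ t, g p q - f q with hρ
  have hρs : ContDiff ℝ ∞ ρ := (ContDiff.sum fun p hp => hg p (ht p hp)).sub hf
  have hρneg : ∀ q ∈ Ω, ρ q < 0 := fun q hq => by
    have h1 : ∑ p ∈ t, g p q ≤ 0 := Finset.sum_nonpos fun p hp => hgneg p (ht p hp) q hq
    have h2 := hfin q hq
    simp only [hρ]; linarith
  have hρpos : ∀ q ∉ Ω, 0 ≤ ρ q := fun q hq => by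
    have h1 : 0 ≤ ∑ p ∈ t, g p q := Finset.sum_nonneg fun p hp => hgpos p (ht p hp) q hq
    simp only [hρ, hfout q hq]; linarith
  have hρ0 : ∀ q ∈ frontier Ω, ρ q = 0 := fun q hq =>
    hΩ.eq_zero_of_sign hρs.continuous (fun q hq => (hρneg q hq).le) hρpos hq
  have hρd : ∀ q ∈ frontier Ω, 0 < fderiv ℝ ρ q (q - y₀) := by
    intro q hq
    have hgd : ∀ p ∈ t, DifferentiableAt ℝ (g p) q := fun p hp =>
      ((hg p (ht p hp)).differentiable (by simp)) q
    have hfd : DifferentiableAt ℝ f q := (hf.differentiable (by simp)) q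
    have hf' : fderiv ℝ f q = 0 := by
      have : IsLocalMin f q := Eventually.of_forall fun y => by
        rw [hfout q (hΩ.notMem_of_mem_frontier hq)]; exact hf0 y
      exact this.fderiv_eq_zero
    have e : fderiv ℝ ρ q (q - y₀) = ∑ p ∈ t, fderiv ℝ (g p) q (q - y₀) := by
      rw [hρ, fderiv_fun_sub (DifferentiableAt.fun_sum hgd) hfd, fderiv_fun_sum hgd, hf']
      simp
    rw [e]
    obtain ⟨p, hp, hqp⟩ := mem_iUnion₂.1 (hcov hq)
    -- Every piece has nonnegative outward derivative, and the piece whose neighbourhood contains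
    -- `q` has a positive one.
    refine Finset.sum_pos' (fun p hp => ?_) ⟨p, hp, hVpos p (ht p hp) q hqp hq⟩
    refine hΩ.fderiv_outward_nonneg hy₀ hq (hgd p hp) ?_
    have h0 := hΩ.eq_zero_of_sign (hg p (ht p hp)).continuous (hgneg p (ht p hp))
      (hgpos p (ht p hp)) hq
    filter_upwards [self_mem_nhdsWithin] with y hy
    rw [h0]; exact hgneg p (ht p hp) y hy
  refine ⟨ρ, hρs, fun x hx => ?_, fun x hx h0 => ?_, fun x hx => ⟨hρ0 x hx, isOpen_univ, mem_univ _,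
    hρs.contDiffOn, fun h => ?_, ?_⟩⟩
  · rcases hΩ.mem_or_mem_frontier hx with h | h
    · exact (hρneg x h).le
    · exact (hρ0 x h).le
  · refine (hΩ.mem_or_mem_frontier hx).resolve_left fun h => ?_
    exact (hρneg x h).ne h0
  · have := hρd x hx
    rw [h] at this
    simp at this
  · ext q
    simp only [inter_univ, mem_univ, true_and, mem_ofPred_eq]
    exact ⟨hρneg q, fun h => by_contra fun hq => absurd (hρpos q hq) (not_le.2 h)⟩

/-- The differentials of two local defining functions at `p` are proportional, so tangency can be
tested with one of them. -/
theorem mem_tangentSpace (hΩ : IsUniformlyConvexDomain Ω) {p : E n} (hp : p ∈ frontier Ω)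
    {U : Set (E n)} {ρ : E n → ℝ} (hρ : IsLocalDefiningFunction Ω p U ρ) {w : E n}
    (hw : fderiv ℝ ρ p w = 0) : w ∈ boundaryTangentSpace Ω p := by
  intro U' ρ' hρ'
  have hneg : ∀ᶠ y in 𝓝[Ω] p, ρ' y ≤ 0 := by
    filter_upwards [self_mem_nhdsWithin, nhdsWithin_le_nhds (hρ'.isOpen.mem_nhds hρ'.mem)]
      with y hy hyU
    have : y ∈ Ω ∩ U' := ⟨hy, hyU⟩
    rw [hρ'.inter_eq] at this
    exact this.2.le
  obtain ⟨c, -, hcv⟩ := hρ.exists_smul (hρ.eq_zero hΩ.isOpen hp)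
    hρ'.differentiableAt.hasFDerivAt.hasFDerivWithinAt (hρ'.eq_zero hΩ.isOpen hp) hneg
  rw [hcv, hw, mul_zero]

end IsUniformlyConvexDomain

/-- If `G` is positive on a compact set wherever the nonnegative function `Q` vanishes, then
`G + k Q` is bounded below by a positive constant for some `k`. -/
theorem exists_add_mul_pos {X : Type*} [TopologicalSpace X] {T : Set X} (hT : IsCompact T)
    {G Q : X → ℝ} (hG : ContinuousOn G T) (hQ : ContinuousOn Q T) (hQ0 : ∀ x ∈ T, 0 ≤ Q x)
    (hpos : ∀ x ∈ T, Q x = 0 → 0 < G x) :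
    ∃ k : ℝ, 0 < k ∧ ∃ ε : ℝ, 0 < ε ∧ ∀ x ∈ T, ε ≤ G x + k * Q x := by
  rcases T.eq_empty_or_nonempty with rfl | hne
  · exact ⟨1, one_pos, 1, one_pos, by simp⟩
  have hk : ∃ k : ℝ, 0 < k ∧ ∀ x ∈ T, 0 < G x + k * Q x := by
    -- A cluster point `z` of points violating the claim for `k + 1` has `G z ≤ 0`, and `Q z = 0`
    -- because `Q` is at most `|min G| / (k + 1)` at those points.
    by_contra! hcon
    choose! y hyT hy using fun k : ℕ => hcon (k + 1) (by positivity)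
    obtain ⟨x₀, -, hmin⟩ := hT.exists_isMinOn hne hG
    obtain ⟨z, hz, hcl⟩ := hT.exists_mapClusterPt (f := atTop) (u := y)
      (tendsto_principal.2 (Eventually.of_forall hyT))
    have hup : ∀ k : ℕ, Q (y k) ≤ |G x₀| / (k + 1) := fun k => by
      rw [le_div_iff₀ (by positivity)]
      have h1 := hy k
      have h2 : G x₀ ≤ G (y k) := hmin (hyT k)
      linarith [neg_abs_le (G x₀)]
    have hcl' : ClusterPt z (map y atTop) := hcl
    have hGz : G z ≤ 0 := by
      by_contra! h
      have h1 : ∀ᶠ w in 𝓝[T] z, 0 < G w := (hG z hz).eventually (lt_mem_nhds h)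
      rw [eventually_nhdsWithin_iff] at h1
      obtain ⟨k, hk⟩ := (hcl.frequently h1).exists
      have h2 := hk (hyT k)
      have h3 := hQ0 _ (hyT k)
      have h4 : (0:ℝ) ≤ (k + 1) * Q (y k) := by positivity
      linarith [hy k]
    have hQz : 0 < Q z := (hQ0 z hz).lt_of_ne fun h => absurd (hpos z hz h.symm) (not_lt.2 hGz)
    have h1 : ∀ᶠ w in 𝓝[T] z, Q z / 2 < Q w :=
      (hQ z hz).eventually (lt_mem_nhds (by linarith))
    rw [eventually_nhdsWithin_iff] at h1
    have h2 : ∀ᶠ k : ℕ in atTop, |G x₀| / (k + 1) < Q z / 2 := by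
      have : Tendsto (fun k : ℕ => |G x₀| * (1 / ((k:ℝ) + 1))) atTop (𝓝 (|G x₀| * 0)) :=
        tendsto_one_div_add_atTop_nhds_zero_nat.const_mul _
      rw [mul_zero] at this
      filter_upwards [this.eventually (gt_mem_nhds (half_pos hQz))] with k hk
      rwa [mul_one_div] at hk
    obtain ⟨k, hk1, hk2⟩ := ((hcl.frequently h1).and_eventually h2).exists
    have := hk1 (hyT k)
    linarith [hup k]
  obtain ⟨k, hk0, hk⟩ := hk
  obtain ⟨x₀, hx₀, hmin⟩ := hT.exists_isMinOn hne (hG.add (continuousOn_const.mul hQ))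
  exact ⟨k, hk0, G x₀ + k * Q x₀, hk x₀ hx₀, fun x hx => hmin hx⟩

end

section
variable {n : ℕ} {S Ω Ω' : Set (E n)} {h : E n → ℝ} {x : E n}

/-! ### Existence of barriers -/

theorem IsBarrier.mono {θ K γ δ θ' K' γ' δ' : ℝ} (hb : IsBarrier Ω h θ K γ δ) (hθ : θ' ≤ θ)
    (hK : K ≤ K') (hγ : γ' ≤ γ) (hδ : δ' ≤ δ) : IsBarrier Ω h θ' K' γ' δ' where
  smooth := hb.smooth
  eq_zero := hb.eq_zero
  nonpos := hb.nonpos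
  neg_le x hx := by linarith [hb.neg_le x hx]
  pd_le x hx v := (hb.pd_le x hx v).trans (by gcongr)
  pd_pd_le x hx v w := (hb.pd_pd_le x hx v w).trans (by gcongr)
  pd_pd_pd_le x hx v w := (hb.pd_pd_pd_le x hx v w).trans (by gcongr)
  hess_ge x hx hd w := (by gcongr : θ' * ‖w‖ ^ 2 ≤ θ * ‖w‖ ^ 2).trans
    (hb.hess_ge x hx (by linarith) w)
  gradient_ge x hx := hγ.trans (hb.gradient_ge x hx)
  inward := hb.inward
  tangent := hb.tangent

theorem continuousOn_hess (hS : IsRegular S) (hh : ContDiffOn ℝ ∞ h S) :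
    ContinuousOn (fun z : E n × E n => pd S z.2 (pd S z.2 h) z.1) (S ×ˢ univ) := by
  have h1 : ContinuousOn (fun z : E n × E n =>
      fderivWithin ℝ (fderivWithin ℝ h S) S z.1 z.2 z.2) (S ×ˢ univ) :=
    (((contDiffOn_fderivWithin hS (contDiffOn_fderivWithin hS hh)).continuousOn.comp
      continuousOn_fst fun z hz => hz.1).clm_apply continuousOn_snd).clm_apply continuousOn_snd
  exact h1.congr fun z hz => pd_pd_eq hS hh hz.1 _ _

theorem hess_ge_of_sphere (hS : IsRegular S) (hh : ContDiffOn ℝ ∞ h S) (hx : x ∈ S) {θ : ℝ}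
    (hθ : ∀ w ∈ Metric.sphere (0 : E n) 1, θ ≤ pd S w (pd S w h) x) (w : E n) :
    θ * ‖w‖ ^ 2 ≤ pd S w (pd S w h) x := by
  rcases eq_or_ne w 0 with rfl | hw
  · rw [pd_pd_eq hS hh hx]; simp
  have hw' := norm_pos_iff.2 hw
  have h1 := hθ (‖w‖⁻¹ • w) (by simp [norm_smul, hw'.ne'])
  rw [pd_pd_eq hS hh hx] at h1 ⊢
  simp only [map_smul, _root_.smul_apply, smul_eq_mul] at h1
  calc θ * ‖w‖ ^ 2 ≤ (‖w‖⁻¹ * (‖w‖⁻¹ * _)) * ‖w‖ ^ 2 := by gcongr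
    _ = _ := by field_simp

set_option maxSynthPendingDepth 3 in
theorem abs_apply_le {V : Type*} [NormedAddCommGroup V] [NormedSpace ℝ V]
    {T : V →L[ℝ] V →L[ℝ] V →L[ℝ] ℝ} {K : ℝ} (hT : ‖T‖ ≤ K) (v v' w : V) : |T v v' w| ≤ K * ‖v‖ * ‖v'‖ * ‖w‖ :=
  (T v v').le_of_opNorm_le ((T v).le_of_opNorm_le (T.le_of_opNorm_le hT v) v') w

namespace IsUniformlyConvexDomain

/-- Here the lower bound on the principal curvatures enters. -/
theorem hess_pos_of_tangent (hΩ : IsUniformlyConvexDomain Ω) {ρ : E n → ℝ} (hρ : ContDiff ℝ ∞ ρ)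
    (hx : x ∈ frontier Ω) (hloc : IsLocalDefiningFunction Ω x univ ρ) {w : E n} (hw : w ≠ 0)
    (hpd : pd (closure Ω) w ρ x = 0) :
    0 < pd (closure Ω) w (pd (closure Ω) w ρ) x := by
  have hS := hΩ.isRegular
  have hx' := frontier_subset_closure hx
  obtain ⟨κ, hκ, hcurv⟩ := hΩ.curvature_pos
  rw [pd, hloc.differentiableAt.fderivWithin (hS.uniqueDiffOn x hx')] at hpd
  have h1 := hcurv x hx univ ρ hloc w (hΩ.mem_tangentSpace hx hloc hpd)
  rw [← iteratedFDerivWithin_eq_iteratedFDeriv hS.uniqueDiffOn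
    (contDiff_infty.1 hρ 2).contDiffAt hx',
    iteratedFDerivWithin_two_apply' ρ hS.uniqueDiffOn hx'] at h1
  rw [pd_pd_eq hS hρ.contDiffOn hx']
  refine lt_of_lt_of_le ?_ h1
  have h2 := norm_pos_iff.2 hloc.fderiv_ne_zero
  have h3 := norm_pos_iff.2 hw
  positivity

/-- Take `h = exp(Aρ) - 1`, whose Hessian form is `A exp(Aρ) (ρ_ww + A ρ_w²)`. Curvature makes it
positive in tangential directions, and a large `A` supplied by `exists_add_mul_pos` handles the
others. -/
theorem exists_convex_defining (hΩ : IsUniformlyConvexDomain Ω) :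
    ∃ h : E n → ℝ, ContDiff ℝ ∞ h ∧ (∀ x ∈ closure Ω, h x ≤ 0) ∧
      (∀ x ∈ closure Ω, h x = 0 → x ∈ frontier Ω) ∧
      ∀ x ∈ frontier Ω, h x = 0 ∧ fderivWithin ℝ h (closure Ω) x ≠ 0 ∧
        ∀ w ≠ 0, 0 < pd (closure Ω) w (pd (closure Ω) w h) x := by
  have hS := hΩ.isRegular
  obtain ⟨ρ, hρ, hneg, hzero, hloc⟩ := hΩ.exists_global_defining
  have hfs := frontier_subset_closure (s := Ω)
  have hsub : frontier Ω ×ˢ Metric.sphere (0 : E n) 1 ⊆ closure Ω ×ˢ univ :=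
    prod_mono hfs (subset_univ _)
  have hQ : ContinuousOn (fun z : E n × E n => pd (closure Ω) z.2 ρ z.1 ^ 2)
      (frontier Ω ×ˢ Metric.sphere (0 : E n) 1) :=
    ((((contDiffOn_fderivWithin hS hρ.contDiffOn).continuousOn.comp continuousOn_fst
      fun z hz => hfs hz.1).clm_apply continuousOn_snd).pow 2)
  obtain ⟨A, hA, ε, hε, hAε⟩ := exists_add_mul_pos
    (hΩ.isCompact_frontier.prod (isCompact_sphere (0 : E n) 1))
    ((continuousOn_hess hS hρ.contDiffOn).mono hsub) hQ (fun _ _ => sq_nonneg _)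
    fun z hz h0 => hΩ.hess_pos_of_tangent hρ hz.1 (hloc _ hz.1).2
      (by rintro h; have := hz.2; simp [h] at this) (pow_eq_zero_iff two_ne_zero |>.1 h0)
  let η : ℝ → ℝ := fun s => Real.exp (A * s) - 1
  have hη : ContDiff ℝ ∞ η := (Real.contDiff_exp.comp (contDiff_const.mul contDiff_id)).sub
    contDiff_const
  have hη' : ∀ s, deriv η s = A * Real.exp (A * s) := fun s => by
    have h1 : HasDerivAt (fun s => A * s) A s := by
      simpa using (hasDerivAt_id s).const_mul A
    rw [(h1.exp.sub_const 1).deriv, mul_comm]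
  have hρS : ContDiffOn ℝ ∞ ρ (closure Ω) := hρ.contDiffOn
  have hpd : ∀ x ∈ closure Ω, ∀ v, pd (closure Ω) v (fun y => η (ρ y)) x =
      A * Real.exp (A * ρ x) * pd (closure Ω) v ρ x := fun x hx v => by
    rw [pd_comp_real hS hη hρS hx, hη']
  have hη2 : ContDiff ℝ ∞ fun s => A * Real.exp (A * s) :=
    contDiff_const.mul (Real.contDiff_exp.comp (contDiff_const.mul contDiff_id))
  have hη2' : ∀ s, deriv (fun s => A * Real.exp (A * s)) s = A ^ 2 * Real.exp (A * s) := fun s => by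
    have h1 : HasDerivAt (fun s => A * s) A s := by
      simpa using (hasDerivAt_id s).const_mul A
    rw [(h1.exp.const_mul A).deriv]; ring
  have hη2ρ : ContDiffOn ℝ ∞ (fun y => A * Real.exp (A * ρ y)) (closure Ω) :=
    hη2.comp_contDiffOn hρS
  have hpd2 : ∀ x ∈ closure Ω, ∀ w, pd (closure Ω) w (pd (closure Ω) w fun y => η (ρ y)) x =
      A * Real.exp (A * ρ x) * (pd (closure Ω) w (pd (closure Ω) w ρ) x
        + A * pd (closure Ω) w ρ x ^ 2) := fun x hx w => by
    rw [pd_congr hx (fun y hy => hpd y hy w) w,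
      pd_mul hS hη2ρ (contDiffOn_pd hS hρS w) hx,
      pd_comp_real hS hη2 hρS hx, hη2']
    ring
  refine ⟨fun y => η (ρ y), hη.comp hρ, fun x hx => ?_, fun x hx h0 => hzero x hx ?_,
    fun x hx => ⟨?_, fun h0 => (hloc x hx).2.fderiv_ne_zero (ContinuousLinearMap.ext fun v => ?_),
      fun w hw => ?_⟩⟩
  · have : A * ρ x ≤ 0 := mul_nonpos_of_nonneg_of_nonpos hA.le (hneg x hx)
    simpa [η] using this
  · have : Real.exp (A * ρ x) = 1 := by simpa [η, sub_eq_zero] using h0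
    rw [Real.exp_eq_one_iff] at this
    exact (mul_eq_zero.1 this).resolve_left hA.ne'
  · simp [η, (hloc x hx).1]
  · have h1 := hpd x (hfs hx) v
    rw [pd, h0, pd, (hloc x hx).2.differentiableAt.fderivWithin
      (hS.uniqueDiffOn x (hfs hx))] at h1
    have h2 : A * Real.exp (A * ρ x) ≠ 0 := by positivity
    simpa using (mul_eq_zero.1 h1.symm).resolve_left h2
  · refine lt_of_lt_of_le ?_ (hess_ge_of_sphere hS (hη.comp hρ).contDiffOn (hfs hx)
      (θ := A * Real.exp (A * ρ x) * ε) (fun w hw => ?_) w)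
    · have := norm_pos_iff.2 hw
      positivity
    · refine le_of_le_of_eq ?_ (hpd2 x (hfs hx) w).symm
      have := hAε (x, w) ⟨hx, hw⟩
      gcongr

-- By compactness `D²h + k(-h) ≥ ε` on unit vectors over the closure, so `D²h ≥ ε/2` in the collar
-- `-h < ε/(2k)`. The remaining constants are extrema of continuous functions on compact sets.
set_option maxSynthPendingDepth 3 in
theorem exists_isBarrier (hΩ : IsUniformlyConvexDomain Ω) (hn : 0 < n) :
    ∃ (h : E n → ℝ) (θ K γ δ : ℝ), 0 < θ ∧ 0 < K ∧ 0 < γ ∧ 0 < δ ∧ IsBarrier Ω h θ K γ δ := by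
  have hS := hΩ.isRegular
  have hc := hΩ.isCompact_closure
  have hfs := frontier_subset_closure (s := Ω)
  obtain ⟨h, hh', hneg, hzero, hfr⟩ := hΩ.exists_convex_defining
  have hh : ContDiffOn ℝ ∞ h (closure Ω) := hh'.contDiffOn
  obtain ⟨k, hk, ε, hε, hkε⟩ := exists_add_mul_pos (Q := fun z : E n × E n => -h z.1)
    (hc.prod (isCompact_sphere (0 : E n) 1))
    ((continuousOn_hess hS hh).mono (prod_mono le_rfl (subset_univ _)))
    (hh'.continuous.comp continuous_fst).neg.continuousOn
    (fun z hz => neg_nonneg.2 (hneg _ hz.1))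
    fun z hz h0 => (hfr _ (hzero _ hz.1 (neg_eq_zero.1 h0))).2.2 _
      (by rintro h; have := hz.2; simp [h] at this)
  have hD := contDiffOn_fderivWithin hS hh
  have hD2 := contDiffOn_fderivWithin hS hD
  have hD3 := contDiffOn_fderivWithin hS hD2
  obtain ⟨K₀, hK₀⟩ := hc.exists_bound_of_continuousOn hh.continuousOn
  obtain ⟨K₁, hK₁⟩ := hc.exists_bound_of_continuousOn hD.continuousOn
  obtain ⟨K₂, hK₂⟩ := hc.exists_bound_of_continuousOn hD2.continuousOn
  obtain ⟨K₃, hK₃⟩ := hc.exists_bound_of_continuousOn hD3.continuousOn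
  obtain ⟨p, hp, hmin⟩ := hΩ.isCompact_frontier.exists_isMinOn (hΩ.frontier_nonempty hn)
    (hD.continuousOn.mono hfs).norm
  set K := |K₀| + |K₁| + |K₂| + |K₃| + 1 with hK
  have a₀ := abs_nonneg K₀
  have a₁ := abs_nonneg K₁
  have a₂ := abs_nonneg K₂
  have a₃ := abs_nonneg K₃
  have h0 : ∀ x ∈ frontier Ω, h x = 0 := fun x hx => (hfr x hx).1
  refine ⟨h, ε / 2, K, ‖fderivWithin ℝ h (closure Ω) p‖, ε / (2 * k), half_pos hε, by positivity,
    norm_pos_iff.2 (hfr p hp).2.1, by positivity, hh, h0, hneg, fun x hx => ?_, fun x hx v => ?_,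
    fun x hx v w => ?_, fun x hx v w => ?_, fun x hx hd w => ?_, fun x hx => ?_, fun x hx v hv => ?_,
    fun x hx w hw => ?_⟩
  · have := (abs_le.1 (hK₀ x hx)).1
    linarith [le_abs_self K₀]
  · refine (((fderivWithin ℝ h (closure Ω) x).le_of_opNorm_le (hK₁ x hx) v)).trans ?_
    gcongr
    linarith [le_abs_self K₁]
  · rw [pd_pd_eq hS hh hx]
    refine (ContinuousLinearMap.le_of_opNorm₂_le_of_le _ (hK₂ x hx) le_rfl le_rfl).trans ?_
    gcongr
    linarith [le_abs_self K₂]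
  · rw [pd_pd_pd_eq hS hh hx]
    refine (abs_apply_le (hK₃ x hx) v v w).trans ?_
    rw [mul_assoc K₃, ← sq]
    gcongr
    linarith [le_abs_self K₃]
  · refine hess_ge_of_sphere hS hh hx (fun w hw => ?_) w
    have h1 := hkε (x, w) ⟨hx, hw⟩
    have h2 : k * -h x ≤ k * (ε / (2 * k)) := by gcongr; linarith
    have h3 : k * (ε / (2 * k)) = ε / 2 := by field_simp
    simp only at h1
    linarith
  · rw [norm_gradientWithin]
    exact hmin hx
  · exact hΩ.eventually_mem_of_pd_neg hh h0 hneg hx hv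
  · exact hΩ.pd_eq_zero_of_tangent hh h0 hneg hx hw

end IsUniformlyConvexDomain

end

/-! ### Choice of constants and conclusion -/

section
variable {n : ℕ}

theorem IsUniformlyConvexDomain.exists_norm_sub_le {Ω : Set (E n)}
    (hΩ : IsUniformlyConvexDomain Ω) :
    ∃ D : ℝ, ∀ x ∈ closure Ω, ∀ y ∈ closure Ω, ‖x - y‖ ≤ D := by
  obtain ⟨D, hD⟩ := Metric.isBounded_iff.1 hΩ.isBounded.closure
  exact ⟨D, fun x hx y hy => by rw [← dist_eq_norm]; exact hD hx hy⟩

theorem IsUniformlyConvexDomain.volume_pos {Ω : Set (E n)} (hΩ : IsUniformlyConvexDomain Ω) :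
    0 < volume.real Ω :=
  ENNReal.toReal_pos (hΩ.isOpen.measure_pos _ hΩ.nonempty).ne' hΩ.isBounded.measure_lt_top.ne

/-- The estimates for a fixed pair of domains. -/
theorem exists_hessianBounds_of_domains (hn : 0 < n) {Ω Ω' : Set (E n)}
    (hΩ : IsUniformlyConvexDomain Ω) (hΩ' : IsUniformlyConvexDomain Ω') :
    ∃ C₉ : ℝ, 0 < C₉ ∧ ∃ C₁₀ : ℝ, 0 < C₁₀ ∧
      ∀ (u : E n → ℝ) (c : ℝ), IsSolution Ω Ω' u c → HessianBounds Ω u C₉ C₁₀ := by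
  obtain ⟨h, θ, K, γ, δ, hθ, hK, hγ, hδ, hb⟩ := hΩ.exists_isBarrier hn
  obtain ⟨h', θ', K', γ', δ', hθ', hK', hγ', hδ', hb'⟩ := hΩ'.exists_isBarrier hn
  obtain ⟨D, hD⟩ := hΩ.exists_norm_sub_le
  obtain ⟨D', hD'⟩ := hΩ'.exists_norm_sub_le
  obtain ⟨r, hr, hfar⟩ := exists_le_norm_sub hn hΩ.volume_pos
  -- The weaker of the two constants is taken in each slot; the `1` only ensures that the diameter
  -- bound is positive.
  let P : Bounds := ⟨min θ θ', max K K', min γ γ', min δ δ', max 1 (max D D'), r,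
    lt_min hθ hθ', lt_max_of_lt_left hK, lt_min hγ hγ', lt_min hδ hδ',
    lt_max_of_lt_left one_pos, hr⟩
  obtain ⟨C₉, h₉, C₁₀, h₁₀, H⟩ := exists_hessian_bounds n P
  refine ⟨C₉, h₉, C₁₀, h₁₀, fun u c hu => H (h := h) (h' := h') (c := c) ⟨hΩ, hΩ',
    hb.mono (min_le_left _ _) (le_max_left _ _) (min_le_left _ _) (min_le_left _ _),
    hb'.mono (min_le_right _ _) (le_max_right _ _) (min_le_right _ _) (min_le_right _ _), hu,
    fun x hx y hy => (hD x hx y hy).trans ((le_max_left _ _).trans (le_max_right _ _)),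
    fun x hx y hy => (hD' x hx y hy).trans ((le_max_right _ _).trans (le_max_right _ _)),
    hfar Ω rfl⟩⟩

/-- The estimates for all pairs of domains with given volumes and boundary defining functions. -/
theorem exists_hessianBounds_of_volume (hn : 0 < n) {θ v v' : ℝ} (K : ℝ) (hθ : 0 < θ)
    (hv : 0 < v) (hv' : 0 < v') :
    ∃ C₉ : ℝ, 0 < C₉ ∧ ∃ C₁₀ : ℝ, 0 < C₁₀ ∧
      ∀ Ω Ω' : Set (E n), IsUniformlyConvexDomain Ω → IsUniformlyConvexDomain Ω' →
      ∀ h h' : E n → ℝ, IsBoundaryDefiningFunction Ω h θ K →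
        IsBoundaryDefiningFunction Ω' h' θ K →
      volume.real Ω = v → volume.real Ω' = v' →
      ∀ (u : E n → ℝ) (c : ℝ), IsSolution Ω Ω' u c → HessianBounds Ω u C₉ C₁₀ := by
  obtain ⟨r, hr, hfar⟩ := exists_le_norm_sub hn hv
  obtain ⟨r', hr', hfar'⟩ := exists_le_norm_sub hn hv'
  -- The volume of the target enters only through the gradient bound, that of `Ω` also through `r`.
  -- Diameters are controlled by `2 |K| / θ`, so no upper volume bound is needed.
  let P : Bounds := ⟨θ, |K| * (2 * |K| / θ) + |K| + 1, min (θ * r / 4) (θ * r' / 4),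
    |K| * (2 * |K| / θ) + |K| + 2, 2 * |K| / θ + 1, r, hθ, by positivity, by positivity,
    by positivity, by positivity, hr⟩
  obtain ⟨C₉, h₉, C₁₀, h₁₀, H⟩ := exists_hessian_bounds n P
  refine ⟨C₉, h₉, C₁₀, h₁₀, fun Ω Ω' hΩ hΩ' h h' hb hb' hvol hvol' u c hu =>
    H (h := h) (h' := h') (c := c) ⟨hΩ, hΩ',
      (hb.isBarrier hΩ hn hθ hr (hfar Ω hvol)).mono le_rfl le_rfl (min_le_left _ _) le_rfl,
      (hb'.isBarrier hΩ' hn hθ hr' (hfar' Ω' hvol')).mono le_rfl le_rfl (min_le_right _ _) le_rfl,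
      hu, fun x hx y hy => (hb.norm_sub_le hΩ hθ x hx y hy).trans (le_add_of_nonneg_right one_pos.le),
      fun x hx y hy => (hb'.norm_sub_le hΩ' hθ x hx y hy).trans (le_add_of_nonneg_right one_pos.le),
      hfar Ω hvol⟩⟩

/-- In dimension zero the interval `(0, nπ/2)` for `c` is empty. -/
theorem not_isSolution_of_dim_zero {Ω Ω' : Set (E 0)} {u : E 0 → ℝ} {c : ℝ} :
    ¬IsSolution Ω Ω' u c := fun hu => by
  have := hu.const_mem
  simp at this

end

end MinimalLagrangian

theorem mainTheorem3 (n : ℕ) :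
    (∀ Ω Ω' : Set (E n), IsUniformlyConvexDomain Ω → IsUniformlyConvexDomain Ω' →
      ∃ C₉ : ℝ, 0 < C₉ ∧ ∃ C₁₀ : ℝ, 0 < C₁₀ ∧
        ∀ (u : E n → ℝ) (c : ℝ), IsSolution Ω Ω' u c → HessianBounds Ω u C₉ C₁₀) ∧
    (∀ θ K v v' : ℝ, 0 < θ → 0 < v → 0 < v' →
      ∃ C₉ : ℝ, 0 < C₉ ∧ ∃ C₁₀ : ℝ, 0 < C₁₀ ∧
        ∀ Ω Ω' : Set (E n), IsUniformlyConvexDomain Ω → IsUniformlyConvexDomain Ω' →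
        ∀ h h' : E n → ℝ, IsBoundaryDefiningFunction Ω h θ K →
          IsBoundaryDefiningFunction Ω' h' θ K →
        volume.real Ω = v → volume.real Ω' = v' →
        ∀ (u : E n → ℝ) (c : ℝ), IsSolution Ω Ω' u c → HessianBounds Ω u C₉ C₁₀) := by
  rcases Nat.eq_zero_or_pos n with rfl | hn
  · exact ⟨fun _ _ _ _ => ⟨1, one_pos, 1, one_pos, fun _ _ hu =>
        absurd hu not_isSolution_of_dim_zero⟩,
      fun _ _ _ _ _ _ _ => ⟨1, one_pos, 1, one_pos, fun _ _ _ _ _ _ _ _ _ _ _ _ hu =>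
        absurd hu not_isSolution_of_dim_zero⟩⟩
  · exact ⟨fun _ _ hΩ hΩ' => exists_hessianBounds_of_domains hn hΩ hΩ',
      fun _ K _ _ hθ hv hv' => exists_hessianBounds_of_volume hn K hθ hv hv'⟩
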